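/- Let $n\ge 0$ and let $B_{n+1}$ be the Coxeter group of type $B$ and rank $n+1$, with generators $t,s_1,\dots,s_n$ and relations $t^2=s_i^2=1$, $s_is_{i+1}s_i=s_{i+1}s_is_{i+1}$, $s_is_j=s_js_i$ for $|i-j|>1$, $ts_1ts_1=s_1ts_1t$, and $ts_i=s_it$ for $i\ge 2$. Let $\{\xi_1,\xi_2\}=\{1,-1\}$, ordered arbitrarily. Let $\lambda^{(2)}$ be a $2$-partition (an ordered pair of Young diagrams with $n+1$ nodes in total), and let $\mathcal T$ be a standard $2$-tableau of shape $\lambda^{(2)}$, that is, a filling of the nodes by $1,\dots,n+1$, each used once, that increases along rows and down columns of both diagrams. If $i$ stands in row $x$ and column $y$ of the $k$-th diagram, put $c_i=y-x$ and $p_i=\xi_k$. Let $f_{\lambda^{(2)}}$ be the inverse of the product of the hook lengths of all nodes of both diagrams. Let $V=\bigoplus_{\mu^{(2)}}V_{\mu^{(2)}}$ be the sum of Young's seminormal representations over all $2$-partitions of $n+1$. It has a basis $(e_{\mathcal S})$ indexed by the standard $2$-tableaux with $n+1$ nodes. The generators act, with $p_i$, $c_i$ and $d=\delta_{p_i,p_{i+1}}/(c_{i+1}-c_i)$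 taken for $\mathcal S$ (and $d=0$ if $p_i\neq p_{i+1}$), by $t\,e_{\mathcal S}=p_1e_{\mathcal S}$ and $s_i\,e_{\mathcal S}=d\,e_{\mathcal S}+(1+d)\,e_{s_i\mathcal S}$. Here $s_i\mathcal S$ is $\mathcal S$ with $i$ and $i+1$ exchanged, and $e_{s_i\mathcal S}:=0$ if this is not standard. Then there is exactly one element $E_{\mathcal T}\in\mathbb C B_{n+1}$ that acts on $V$ by $E_{\mathcal T}e_{\mathcal S}=\delta_{\mathcal S,\mathcal T}\,e_{\mathcal S}$, and it is a primitive idempotent. Put $$\mathbf s_i(p,p',a,a')=s_i+\frac{\delta_{p,p'}}{a-a'},\qquad \mathbf t(p)=\tfrac12(1+pt),$$ $$\phi_{k+1}(v_1,\dots,v_k,v,u_1,\dots,u_k,u)=\mathbf s_k(v,v_k,u,u_k)\cdots\mathbf s_1(v,v_1,u,u_1)\,\mathbf t(v)\,s_1\cdots s_k\quad(0\le k\le n),$$ $$\Phi(v_1,\dots,v_{n+1},u_1,\dots,u_{n+1})=\prod_{k=0,\dots,n}^{\leftarrow}\phi_{k+1}(v_1,\dots,v_{k+1},u_1,\dots,u_{k+1}),$$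 with the factors in descending order of $k$. Thus, for fixed numbers $v_i$, $\Phi$ is a rational function of $u_1,\dots,u_{n+1}$ with values in $\mathbb C B_{n+1}$. Then $$E_{\mathcal T}=f_{\lambda^{(2)}}\,\Phi(v_1,\dots,v_{n+1},u_1,\dots,u_{n+1})\Big|_{v_i=p_i,\ i=1,\dots,n+1}\Big|_{u_1=c_1}\cdots\Big|_{u_n=c_n}\Big|_{u_{n+1}=c_{n+1}},$$ where the evaluations at $u_1=c_1,\dots,u_{n+1}=c_{n+1}$ are done consecutively in this order, and the rational function obtained at each step is non-singular at the next evaluation. Moreover, for any numbers $v_1,\dots,v_{n+1}$, the product defining $\Phi$ is a reduced word for the longest element of $B_{n+1}$ in which some letters $s_i$ are replaced by elements $\mathbf s_i(v_k,v_l,u_k,u_l)$ with $l<k$, and some letters $t$ by elements $\mathbf t(v_k)$. -/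

import Mathlib

namespace FusionB

noncomputable section

/-! ### The hyperoctahedral group -/

/-- The Coxeter matrix of type `B` and rank `n + 1`, with nodes numbered so that `0` is the end of
the diagram carrying the edge of order `4`. Node `0` is the generator `t`, and node `i.succ`, for
`i : Fin n`, is the generator `s_{i+1}` (that is, `s_1, …, s_n` are the nodes `1, …, n`). -/
def matrixB (n : ℕ) : CoxeterMatrix (Fin (n + 1)) :=
  (CoxeterMatrix.B (n + 1)).reindex Fin.revPerm

/-- The Coxeter group `B_{n+1}`, generated by `t, s_1, …, s_n`. -/
abbrev GroupB (n : ℕ) : Type := (matrixB n).Group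

/-- `B_{n+1}` with its Coxeter generators. -/
abbrev coxB (n : ℕ) : CoxeterSystem (matrixB n) (GroupB n) := (matrixB n).toCoxeterSystem

/-- A Coxeter generator, as an element of the group algebra over `K`. -/
def gen (K : Type) [Field K] {n : ℕ} (b : Fin (n + 1)) : MonoidAlgebra K (GroupB n) :=
  MonoidAlgebra.of K (GroupB n) ((coxB n).simple b)

/-- The generator `t`. -/
def genT (K : Type) [Field K] (n : ℕ) : MonoidAlgebra K (GroupB n) := gen K 0

/-- The generator `s_{i+1}`, for `i : Fin n` counted from `0`. -/
def genS (K : Type) [Field K] {n : ℕ} (i : Fin n) : MonoidAlgebra K (GroupB n) := gen K i.succ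

/-! ### Standard 2-tableaux -/

/-- The set of 2-nodes of a 2-partition: triples (position, (row, column)). -/
abbrev Node (shape : Fin 2 → YoungDiagram) : Type :=
  {x : Fin 2 × ℕ × ℕ // x.2 ∈ shape x.1}

/-- A standard 2-tableau of length `m`: a 2-partition, together with a numbering of its 2-nodes by
`Fin m` that increases along the rows and down the columns of both diagrams. -/
structure StandardTableau (m : ℕ) where
  /-- the underlying 2-partition -/
  shape : Fin 2 → YoungDiagram
  /-- `node a` is the 2-node that carries the number `a` -/
  node : Fin m ≃ Node shape
  /-- numbers increase along rows -/
  row_lt : ∀ a b : Fin m, (node a).1.1 = (node b).1.1 → (node a).1.2.1 = (node b).1.2.1 →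
    (node a).1.2.2 < (node b).1.2.2 → a < b
  /-- numbers increase down columns -/
  col_lt : ∀ a b : Fin m, (node a).1.1 = (node b).1.1 → (node a).1.2.2 = (node b).1.2.2 →
    (node a).1.2.1 < (node b).1.2.1 → a < b

namespace StandardTableau

/-- The content `c(T|a)` (column minus row) of the node with number `a`. -/
def content {m : ℕ} (T : StandardTableau m) (a : Fin m) : ℂ :=
  ((T.node a).1.2.2 : ℂ) - ((T.node a).1.2.1 : ℂ)

/-- `p(T|a) = ξ_k`, where `k` is the position of the node with number `a`. -/
def pos {m : ℕ} (ξ : Fin 2 → ℂ) (T : StandardTableau m) (a : Fin m) : ℂ := ξ (T.node a).1.1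

/-- `S` is obtained from `T` by exchanging the consecutive numbers `i` and `i + 1`. -/
def IsSwap {n : ℕ} (i : Fin n) (T S : StandardTableau (n + 1)) : Prop :=
  ∀ a : Fin (n + 1), (S.node a).1 = (T.node (Equiv.swap i.castSucc i.succ a)).1

end StandardTableau

/-- The hook length of the node `α` of `μ`: the number of nodes of `μ` in the row of `α` weakly to
the right of `α`, or in its column weakly below it. -/
def hookLength (μ : YoungDiagram) (α : ℕ × ℕ) : ℕ :=
  (μ.cells.filter fun β => (β.1 = α.1 ∧ α.2 ≤ β.2) ∨ (β.2 = α.2 ∧ α.1 ≤ β.1)).card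

/-- `f`: the inverse of the product of all hook lengths of a 2-partition. -/
def hookFactor (shape : Fin 2 → YoungDiagram) : ℂ :=
  (∏ k : Fin 2, ∏ α ∈ (shape k).cells, (hookLength (shape k) α : ℂ))⁻¹

/-! ### The seminormal basis and its diagonal matrix units -/

/-- The direct sum, over all 2-partitions of `n + 1`, of the vector spaces with basis the standard
2-tableaux of that shape. -/
abbrev TableauSpace (n : ℕ) : Type := StandardTableau (n + 1) →₀ ℂ

/-- The seminormal basis vector of a standard 2-tableau. -/
def basisVec {n : ℕ} (T : StandardTableau (n + 1)) : TableauSpace n := Finsupp.single T 1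

/-- The diagonal coefficient of `s_{i+1}` at `T` in the seminormal form. -/
def diagCoeff {n : ℕ} (ξ : Fin 2 → ℂ) (i : Fin n) (T : StandardTableau (n + 1)) : ℂ :=
  open Classical in
  if T.pos ξ i.castSucc = T.pos ξ i.succ then 1 / (T.content i.succ - T.content i.castSucc) else 0

/-- `ρ` is Young's seminormal form of the irreducible representations of `B_{n+1}`, all shapes taken
together (the formulas preserve the shape of a tableau). As the generators generate the group,
there is at most one such `ρ`. -/
structure IsSeminormal {n : ℕ} (ξ : Fin 2 → ℂ)
    (ρ : MonoidAlgebra ℂ (GroupB n) →ₐ[ℂ] Module.End ℂ (TableauSpace n)) : Prop where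
  t_apply : ∀ T, ρ (genT ℂ n) (basisVec T) = T.pos ξ 0 • basisVec T
  s_apply : ∀ (i : Fin n) (T S : StandardTableau (n + 1)), T.IsSwap i S →
    ρ (genS ℂ i) (basisVec T) =
      diagCoeff ξ i T • basisVec T + (1 + diagCoeff ξ i T) • basisVec S
  s_apply_of_not : ∀ (i : Fin n) (T : StandardTableau (n + 1)),
    (¬ ∃ S : StandardTableau (n + 1), T.IsSwap i S) →
    ρ (genS ℂ i) (basisVec T) = diagCoeff ξ i T • basisVec T

/-- `E = E_T`: the element of `ℂ B_{n+1}` that acts as the diagonal matrix unit of `T` with respect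
to the seminormal bases (thus by zero in the irreducible representations of all other shapes). -/
def IsTableauIdempotent {n : ℕ} (ξ : Fin 2 → ℂ) (T : StandardTableau (n + 1))
    (E : MonoidAlgebra ℂ (GroupB n)) : Prop :=
  ∃ ρ : MonoidAlgebra ℂ (GroupB n) →ₐ[ℂ] Module.End ℂ (TableauSpace n), IsSeminormal ξ ρ ∧
    ρ E (basisVec T) = basisVec T ∧ ∀ S, S ≠ T → ρ E (basisVec S) = 0

/-- A primitive idempotent: a nonzero idempotent that is not the sum of two nonzero orthogonal
idempotents. -/
def IsPrimitiveIdempotent {A : Type} [Ring A] (e : A) : Prop :=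
  e ≠ 0 ∧ IsIdempotentElem e ∧ ∀ a b : A, IsIdempotentElem a → IsIdempotentElem b →
    a * b = 0 → b * a = 0 → a + b = e → a = 0 ∨ b = 0

/-! ### The rational function `Φ` -/

/-- The element `s_{i+1}(p, p', a, a') = s_{i+1} + δ_{p,p'} / (a - a')`. -/
def baxtS {K : Type} [Field K] {n : ℕ} (i : Fin n) (p p' : ℂ) (a a' : K) :
    MonoidAlgebra K (GroupB n) :=
  open Classical in
  genS K i + algebraMap K (MonoidAlgebra K (GroupB n)) (if p = p' then 1 / (a - a') else 0)

/-- The element `t(p) = (1 + p t) / 2`. -/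
def baxtT (K : Type) [Field K] [Algebra ℂ K] (n : ℕ) (p : ℂ) : MonoidAlgebra K (GroupB n) :=
  (1 / 2 : K) • (1 + algebraMap ℂ K p • genT K n)

/-- `phi v u v' u' k` is
`φ_{k+1}(v_1, …, v_k, v', u_1, …, u_k, u')`, for `k = 0, …, n` (entries of `v`, `u` are numbered
from `0`). -/
def phi {K : Type} [Field K] [Algebra ℂ K] {n : ℕ} (v : Fin (n + 1) → ℂ) (u : Fin (n + 1) → K)
    (v' : ℂ) (u' : K) (k : Fin (n + 1)) : MonoidAlgebra K (GroupB n) :=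
  Fin.induction (motive := fun _ => MonoidAlgebra K (GroupB n)) (baxtT K n v')
    (fun i x => baxtS i v' (v i.castSucc) u' (u i.castSucc) * x * genS K i) k

/-- `Φ(v_1, …, v_{n+1}, u_1, …, u_{n+1}) = φ_{n+1} φ_n ⋯ φ_1`. -/
def Phi {K : Type} [Field K] [Algebra ℂ K] {n : ℕ} (v : Fin (n + 1) → ℂ) (u : Fin (n + 1) → K) :
    MonoidAlgebra K (GroupB n) :=
  (List.ofFn fun k : Fin (n + 1) => phi v u (v k) (u k) k).reverse.prod

/-! ### Evaluation of rational functions -/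

/-- The field `ℂ(u_1, …, u_m)` of rational functions. -/
abbrev RatFun (m : ℕ) : Type := FractionRing (MvPolynomial (Fin m) ℂ)

/-- The variable `u_{k+1}` of `ℂ(u_1, …, u_m)`. -/
def uvar {m : ℕ} (k : Fin m) : RatFun m := algebraMap (MvPolynomial (Fin m) ℂ) _ (MvPolynomial.X k)

/-- The substitution of the number `c` for the `k`-th variable of a polynomial. -/
def substVar {m : ℕ} (k : Fin m) (c : ℂ) : MvPolynomial (Fin m) ℂ →ₐ[ℂ] MvPolynomial (Fin m) ℂ :=
  MvPolynomial.aeval (Function.update MvPolynomial.X k (MvPolynomial.C c))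

/-- The rational function `x` is non-singular at `u_k = c`, and `y` is its evaluation there: `x` is
a quotient of polynomials whose denominator does not vanish identically at `u_k = c`. -/
def IsEvalAt {m : ℕ} (k : Fin m) (c : ℂ) (x y : RatFun m) : Prop :=
  ∃ P Q : MvPolynomial (Fin m) ℂ, substVar k c Q ≠ 0 ∧
    x = algebraMap _ (RatFun m) P / algebraMap _ (RatFun m) Q ∧
    y = algebraMap _ (RatFun m) (substVar k c P) / algebraMap _ (RatFun m) (substVar k c Q)

/-- `Y = X |_{u_1 = c_1} |_{u_2 = c_2} ⋯ |_{u_m = c_m}`, for a rational function `X` with values in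
the group algebra: the evaluations are done consecutively, in this order, and each of the rational
functions met is non-singular at the next point of evaluation. -/
def IsConsecutiveEval {G : Type} [Group G] {m : ℕ} (X : MonoidAlgebra (RatFun m) G)
    (c : Fin m → ℂ) (Y : MonoidAlgebra ℂ G) : Prop :=
  ∃ Z : Fin (m + 1) → MonoidAlgebra (RatFun m) G, Z 0 = X ∧
    (∀ (k : Fin m) (g : G), IsEvalAt k (c k) ((Z k.castSucc).coeff g) ((Z k.succ).coeff g)) ∧
    ∀ g : G, (Z (Fin.last m)).coeff g = algebraMap ℂ (RatFun m) (Y.coeff g)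

/-! ### Words for the longest element -/

/-- `x` is the generator with index `b`, possibly Baxterized: for `t` it may be replaced by some
`t(v_k)`, and for `s_i` by some `s_i(v_k, v_l, u_k, u_l)`, `l < k`. -/
def IsLetter {n : ℕ} (v : Fin (n + 1) → ℂ) (b : Fin (n + 1))
    (x : MonoidAlgebra (RatFun (n + 1)) (GroupB n)) : Prop :=
  x = gen (RatFun (n + 1)) b ∨
  (b = 0 ∧ ∃ k, x = baxtT (RatFun (n + 1)) n (v k)) ∨
  ∃ i : Fin n, b = i.succ ∧ ∃ k l, l < k ∧ x = baxtS i (v k) (v l) (uvar k) (uvar l)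

/-- `x` is a reduced word for the longest element of `B_{n+1}` in which some letters are
Baxterized. -/
def IsBaxterizedLongestWord {n : ℕ} (v : Fin (n + 1) → ℂ)
    (x : MonoidAlgebra (RatFun (n + 1)) (GroupB n)) : Prop :=
  ∃ (ω : List (Fin (n + 1))) (L : List (MonoidAlgebra (RatFun (n + 1)) (GroupB n))),
    (coxB n).IsReduced ω ∧ (∀ w, (coxB n).length w ≤ (coxB n).length ((coxB n).wordProd ω)) ∧
    List.Forall₂ (IsLetter v) ω L ∧ x = L.prod

end

end FusionB

/-!
A product `s_k(…) ⋯ s_1(…) t(v) s_1 ⋯ s_k` with the parameters of a standard 2-tableau `𝒯` acts on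
each seminormal basis vector `e_S`, for `S` agreeing with `𝒯` in the numbers `1, …, k`, by a scalar:
if the number `k + 1` of `S` stands in the same diagram as that of `𝒯`, this scalar is a rational
function of `u` divided by `u - c`, where `c` is the content of `k + 1` in `S`, and the rational
function has simple zeros at the contents of the addable nodes. So its value at `u = c_{k+1}` is
zero unless `k + 1` stands at the same node in `S` and in `𝒯`, and then it is the ratio of products
of hook lengths before and after the addition of this node. Hence, as `k` grows, the product of the
factors evaluated so far is the sum of the `E_S` over the `S` that agree with `𝒯` in `1, …, k`, up
to the inverse of a hook factor; after the last evaluation only `E_𝒯` is left.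

The seminormal representation is faithful, since its trace, weighted with the inverses of the hook
lengths, is proportional to the coefficient of `1`. This goes by induction on the rank, with double
cosets of `B_n` in `B_{n+1}`: the induction step reduces to two partial fraction identities for the
ratios of hook products, `∑ r_i = 1` and `∑ r_i / (a_i - c) = 0` for the addable contents `a_i` and
each removable content `c`. The idempotents `E_𝒯` exist because the signs and the contents, which
separate the tableaux, are the eigenvalues of elements of the group algebra.

The word underlying `Φ` has `(n + 1) ^ 2` letters, as many as there are positive roots of type `B`,
and it acts by `x ↦ -x` in the representation by signed permutations, so all of these are inverted.
Double cosets show that no element of the group is longer.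
-/

namespace FusionB

section Presentation

variable {M : Type*} [Monoid M] {n : ℕ} {σ : ℕ → M}

/-- The Coxeter relations of type `B` and rank `n + 1` for elements `σ 0, …, σ n` of a monoid, where
`σ 0` plays the part of `t`. All of `ℕ` serves as index set, so that no casts between the types
`Fin (n + 1)` occur; the values `σ m` for `n < m` are irrelevant. -/
structure TypeBRelations (n : ℕ) (σ : ℕ → M) : Prop where
  mul_self : ∀ m ≤ n, σ m * σ m = 1
  comm : ∀ i j, j ≤ n → i + 2 ≤ j → Commute (σ i) (σ j)
  braid : ∀ i, 1 ≤ i → i + 1 ≤ n → σ i * σ (i + 1) * σ i = σ (i + 1) * σ i * σ (i + 1)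
  braid_four : 1 ≤ n → σ 0 * σ 1 * σ 0 * σ 1 = σ 1 * σ 0 * σ 1 * σ 0

theorem TypeBRelations.mono {m : ℕ} (h : TypeBRelations m σ) (hnm : n ≤ m) :
    TypeBRelations n σ where
  mul_self i hi := h.mul_self i (hi.trans hnm)
  comm i j hj := h.comm i j (hj.trans hnm)
  braid i hi hin := h.braid i hi (hin.trans hnm)
  braid_four hn := h.braid_four (hn.trans hnm)

theorem matrixB_apply (n : ℕ) (i j : Fin (n + 1)) :
    matrixB n i j = if i = j then 1
      else if (i : ℕ) + j = 1 then 4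
      else if (j : ℕ) + 1 = i ∨ (i : ℕ) + 1 = j then 3 else 2 := by
  have unfolded : matrixB n i j = if i.rev = j.rev then 1
      else if (i.rev : ℕ) = n + 1 - 1 ∧ (j.rev : ℕ) = n + 1 - 2 ∨
        (j.rev : ℕ) = n + 1 - 1 ∧ (i.rev : ℕ) = n + 1 - 2 then 4
      else if (j.rev : ℕ) + 1 = i.rev ∨ (i.rev : ℕ) + 1 = j.rev then 3 else 2 := rfl
  simp only [unfolded, Fin.rev_inj, Fin.val_rev]
  split_ifs <;> first | rfl | omega

theorem mul_pow_two_of_commute {a b : M} (ha : a * a = 1) (hb : b * b = 1) (h : Commute a b) :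
    (a * b) ^ 2 = 1 := by
  rw [h.mul_pow, pow_two, pow_two, ha, hb, one_mul]

theorem mul_pow_three_of_braid {a b : M} (ha : a * a = 1) (hb : b * b = 1)
    (h : a * b * a = b * a * b) : (a * b) ^ 3 = 1 :=
  calc (a * b) ^ 3 = (a * b * a) * (b * a * b) := by
        simp only [pow_succ, pow_zero, one_mul, mul_assoc]
    _ = a * (b * (a * a) * b) * a := by rw [← h]; simp only [mul_assoc]
    _ = 1 := by rw [ha, mul_one, hb, mul_one, ha]

theorem mul_pow_four_of_braid {a b : M} (ha : a * a = 1) (hb : b * b = 1)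
    (h : a * b * a * b = b * a * b * a) : (a * b) ^ 4 = 1 :=
  calc (a * b) ^ 4 = (a * b * a * b) * (a * b * a * b) := by
        simp only [pow_succ, pow_zero, one_mul, mul_assoc]
    _ = (a * b * a * b) * (b * a * b * a) := by rw [h]
    _ = a * (b * (a * (b * b) * a) * b) * a := by simp only [mul_assoc]
    _ = 1 := by rw [hb, mul_one, ha, mul_one, hb, mul_one, ha]

theorem TypeBRelations.isLiftable (h : TypeBRelations n σ) :
    (matrixB n).IsLiftable fun i : Fin (n + 1) => σ i := by
  intro i j
  have hi := h.mul_self i (by omega)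
  have hj := h.mul_self j (by omega)
  simp only [matrixB_apply]
  split_ifs with hij hfour hthree
  · rw [hij, pow_one, hj]
  · obtain ⟨hi0, hj1⟩ | ⟨hi1, hj0⟩ : (i : ℕ) = 0 ∧ (j : ℕ) = 1 ∨ (i : ℕ) = 1 ∧ (j : ℕ) = 0 := by
      omega
    · exact mul_pow_four_of_braid hi hj (by rw [hi0, hj1]; exact h.braid_four (by omega))
    · exact mul_pow_four_of_braid hi hj (by rw [hi1, hj0]; exact (h.braid_four (by omega)).symm)
  · obtain hji | hij := hthree
    · exact mul_pow_three_of_braid hi hj (by rw [← hji, h.braid j (by omega) (by omega)])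
    · exact mul_pow_three_of_braid hi hj (by rw [← hij, h.braid i (by omega) (by omega)])
  · obtain hlt | hlt : (i : ℕ) + 2 ≤ j ∨ (j : ℕ) + 2 ≤ i := by omega
    · exact mul_pow_two_of_commute hi hj (h.comm i j (by omega) hlt)
    · exact mul_pow_two_of_commute hi hj (h.comm j i (by omega) hlt).symm

/-- The Coxeter generators of `B_{n+1}` as a sequence; `simpleB n m = 1` is a junk value for
`n < m`. -/
def simpleB (n m : ℕ) : GroupB n :=
  if h : m < n + 1 then (coxB n).simple ⟨m, h⟩ else 1

theorem simpleB_of_lt {m : ℕ} (h : m < n + 1) : simpleB n m = (coxB n).simple ⟨m, h⟩ := dif_pos h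

@[simp] theorem simpleB_val (i : Fin (n + 1)) : simpleB n i = (coxB n).simple i :=
  simpleB_of_lt i.isLt

theorem wordProd_alternatingWord_eq {i j : Fin (n + 1)} {m : ℕ} (h : matrixB n i j = m) :
    (coxB n).wordProd (CoxeterSystem.alternatingWord i j m) =
      (coxB n).wordProd (CoxeterSystem.alternatingWord j i m) := by
  simpa only [CoxeterSystem.braidWord, (matrixB n).symmetric j i, h] using
    (coxB n).wordProd_braidWord_eq i j

theorem typeBRelations_simpleB (n : ℕ) : TypeBRelations n (simpleB n) where
  mul_self m hm := by
    simp only [simpleB_of_lt (Nat.lt_succ_of_le hm), CoxeterSystem.simple_mul_simple_self]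
  comm i j hj hij := by
    have hi' : i < n + 1 := by omega
    have hj' : j < n + 1 := by omega
    have hm : matrixB n ⟨i, hi'⟩ ⟨j, hj'⟩ = 2 := by
      rw [matrixB_apply, if_neg (by simp only [Fin.mk.injEq]; omega), if_neg (by dsimp; omega),
        if_neg (by dsimp; omega)]
    simpa [commute_iff_eq, CoxeterSystem.alternatingWord, CoxeterSystem.wordProd, simpleB_of_lt hi',
      simpleB_of_lt hj'] using wordProd_alternatingWord_eq hm
  braid i hi hin := by
    have hi' : i < n + 1 := by omega
    have hj' : i + 1 < n + 1 := by omega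
    have hm : matrixB n ⟨i, hi'⟩ ⟨i + 1, hj'⟩ = 3 := by
      rw [matrixB_apply, if_neg (by simp only [Fin.mk.injEq]; omega), if_neg (by dsimp; omega),
        if_pos (by simp)]
    simpa [commute_iff_eq, CoxeterSystem.alternatingWord, CoxeterSystem.wordProd, simpleB_of_lt hi',
      simpleB_of_lt hj', ← mul_assoc] using (wordProd_alternatingWord_eq hm).symm
  braid_four hn := by
    have h0 : 0 < n + 1 := by omega
    have h1 : 1 < n + 1 := by omega
    have hm : matrixB n ⟨0, h0⟩ ⟨1, h1⟩ = 4 := by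
      rw [matrixB_apply, if_neg (by simp), if_pos (by simp)]
    simpa [CoxeterSystem.alternatingWord, CoxeterSystem.wordProd, simpleB_of_lt h0,
      simpleB_of_lt h1, ← mul_assoc] using wordProd_alternatingWord_eq hm

end Presentation

section Parabolic

variable {M : Type*} [Monoid M] {n k : ℕ} {σ : ℕ → M}

/-- The palindromes `σ k ⋯ σ 1 σ 0 σ 1 ⋯ σ k`, which change the sign of one coordinate in the
reflection representation. -/
def signChange (σ : ℕ → M) : ℕ → M
  | 0 => σ 0
  | k + 1 => σ (k + 1) * signChange σ k * σ (k + 1)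

/-- The standard parabolic submonoid generated by `σ 0, …, σ (k - 1)`. For Coxeter generators it is
a subgroup, of type `B` and rank `k`. -/
def parabolic (σ : ℕ → M) (k : ℕ) : Submonoid M := Submonoid.closure (σ '' Set.Iio k)

theorem mem_parabolic {m : ℕ} (h : m < k) : σ m ∈ parabolic σ k :=
  Submonoid.subset_closure ⟨m, h, rfl⟩

theorem parabolic_mono : Monotone (parabolic σ) := fun _ _ h =>
  Submonoid.closure_mono (Set.image_mono (Set.Iio_subset_Iio h))

theorem parabolic_zero (σ : ℕ → M) : parabolic σ 0 = ⊥ := by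
  simp [parabolic]

theorem parabolic_simpleB_eq_top (n : ℕ) : parabolic (simpleB n) (n + 1) = ⊤ := by
  rw [← (coxB n).submonoid_closure_range_simple, parabolic]
  congr 1
  ext g
  constructor
  · rintro ⟨m, hm, rfl⟩
    exact ⟨⟨m, hm⟩, (simpleB_of_lt hm).symm⟩
  · rintro ⟨i, rfl⟩
    exact ⟨i, i.isLt, simpleB_val i⟩

theorem signChange_mem_parabolic (σ : ℕ → M) (k : ℕ) : signChange σ k ∈ parabolic σ (k + 1) := by
  induction k with
  | zero => exact mem_parabolic one_pos
  | succ k ih =>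
    have h : σ (k + 1) ∈ parabolic σ (k + 2) := mem_parabolic (by omega)
    exact mul_mem (mul_mem h (parabolic_mono (by omega) ih)) h

theorem commute_of_mem_parabolic {x w : M} (hx : ∀ m < k, Commute x (σ m))
    (hw : w ∈ parabolic σ k) : Commute x w := by
  induction hw using Submonoid.closure_induction with
  | mem _ h => obtain ⟨m, hm, rfl⟩ := h; exact hx m hm
  | one => exact Commute.one_right x
  | mul _ _ _ _ ha hb => exact ha.mul_right hb

theorem TypeBRelations.commute_parabolic (hσ : TypeBRelations n σ) {m : ℕ} (hk : k < m)
    (hm : m ≤ n) {w : M} (hw : w ∈ parabolic σ k) : Commute (σ m) w :=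
  commute_of_mem_parabolic (fun l hl => (hσ.comm l m hm (by omega)).symm) hw

theorem TypeBRelations.commute_signChange_succ (hσ : TypeBRelations n σ) (hk : k + 1 ≤ n) :
    Commute (signChange σ (k + 1)) (σ k) := by
  cases k with
  | zero =>
    change σ 1 * σ 0 * σ 1 * σ 0 = σ 0 * (σ 1 * σ 0 * σ 1)
    simpa only [mul_assoc] using (hσ.braid_four (by omega)).symm
  | succ k =>
    have hb := hσ.braid (k + 1) (by omega) hk
    have hc : σ (k + 2) * signChange σ k = signChange σ k * σ (k + 2) :=
      hσ.commute_parabolic (by omega) hk (signChange_mem_parabolic σ k)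
    change σ (k + 2) * (σ (k + 1) * signChange σ k * σ (k + 1)) * σ (k + 2) * σ (k + 1)
      = σ (k + 1) * (σ (k + 2) * (σ (k + 1) * signChange σ k * σ (k + 1)) * σ (k + 2))
    calc _ = σ (k + 2) * σ (k + 1) * signChange σ k * (σ (k + 1) * σ (k + 2) * σ (k + 1)) := by
          simp only [mul_assoc]
      _ = σ (k + 2) * σ (k + 1) * (signChange σ k * σ (k + 2)) * σ (k + 1) * σ (k + 2) := by
          rw [hb]; simp only [mul_assoc]
      _ = (σ (k + 2) * σ (k + 1) * σ (k + 2)) * signChange σ k * σ (k + 1) * σ (k + 2) := by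
          rw [← hc]; simp only [mul_assoc]
      _ = _ := by rw [← hb]; simp only [mul_assoc]

theorem TypeBRelations.commute_signChange_of_lt (hσ : TypeBRelations n σ) (hk : k ≤ n) {m : ℕ}
    (hm : m < k) : Commute (signChange σ k) (σ m) := by
  induction k with
  | zero => omega
  | succ k ih =>
    obtain hmk | rfl := Nat.lt_succ_iff_lt_or_eq.1 hm
    · have h : Commute (σ (k + 1)) (σ m) := (hσ.comm m (k + 1) hk (by omega)).symm
      exact (h.mul_left (ih (by omega) hmk)).mul_left h
    · exact hσ.commute_signChange_succ hk

theorem TypeBRelations.commute_signChange (hσ : TypeBRelations n σ) (hk : k ≤ n) {w : M}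
    (hw : w ∈ parabolic σ k) : Commute (signChange σ k) w :=
  commute_of_mem_parabolic (fun _ => hσ.commute_signChange_of_lt hk) hw

/-- The normal forms of elements of `parabolic σ (k + 1)` for its (at most three) double cosets with
respect to `parabolic σ k`. The last double coset is a single left coset, because `signChange σ k`
commutes with `parabolic σ k`. For `k = 0` the middle one is left out, as `σ 0 = signChange σ 0`. -/
inductive DoubleCosetForm (σ : ℕ → M) (k : ℕ) : M → Prop
  | of_mem {a : M} (ha : a ∈ parabolic σ k) : DoubleCosetForm σ k a
  | mul_simple_mul {a b : M} (hk : 1 ≤ k) (ha : a ∈ parabolic σ k) (hb : b ∈ parabolic σ k) :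
      DoubleCosetForm σ k (a * σ k * b)
  | mul_signChange {a : M} (ha : a ∈ parabolic σ k) : DoubleCosetForm σ k (a * signChange σ k)

namespace DoubleCosetForm

variable {w : M}

theorem mul_left {a : M} (ha : a ∈ parabolic σ k) (hw : DoubleCosetForm σ k w) :
    DoubleCosetForm σ k (a * w) := by
  cases hw with
  | of_mem hb => exact of_mem (mul_mem ha hb)
  | mul_simple_mul hk hb hc => simpa only [mul_assoc] using mul_simple_mul hk (mul_mem ha hb) hc
  | mul_signChange hb => simpa only [mul_assoc] using mul_signChange (mul_mem ha hb)

theorem mul_right (hσ : TypeBRelations n σ) (hkn : k ≤ n) {b : M} (hb : b ∈ parabolic σ k)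
    (hw : DoubleCosetForm σ k w) : DoubleCosetForm σ k (w * b) := by
  cases hw with
  | of_mem ha => exact of_mem (mul_mem ha hb)
  | mul_simple_mul hk ha hc => simpa only [mul_assoc] using mul_simple_mul hk ha (mul_mem hc hb)
  | mul_signChange ha =>
    simpa only [mul_assoc, (hσ.commute_signChange hkn hb).eq] using mul_signChange (mul_mem ha hb)

theorem sandwich (hσ : TypeBRelations n σ) (hkn : k + 1 ≤ n) (hw : DoubleCosetForm σ k w) :
    DoubleCosetForm σ (k + 1) (σ (k + 1) * w * σ (k + 1)) := by
  have hcomm {c : M} (hc : c ∈ parabolic σ k) : σ (k + 1) * c = c * σ (k + 1) :=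
    hσ.commute_parabolic (by omega) hkn hc
  have hlift {c : M} (hc : c ∈ parabolic σ k) : c ∈ parabolic σ (k + 1) :=
    parabolic_mono k.le_succ hc
  have hσk : σ k ∈ parabolic σ (k + 1) := mem_parabolic k.lt_succ_self
  cases hw with
  | of_mem hw =>
    rw [hcomm hw, mul_assoc, hσ.mul_self (k + 1) hkn, mul_one]
    exact of_mem (hlift hw)
  | @mul_simple_mul a b hk ha hb =>
    have h : σ (k + 1) * (a * σ k * b) * σ (k + 1) = a * σ k * σ (k + 1) * (σ k * b) :=
      calc _ = (σ (k + 1) * a) * σ k * (b * σ (k + 1)) := by simp only [mul_assoc]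
        _ = a * (σ (k + 1) * σ k * σ (k + 1)) * b := by
          rw [hcomm ha, ← hcomm hb]; simp only [mul_assoc]
        _ = _ := by rw [← hσ.braid k hk hkn]; simp only [mul_assoc]
    rw [h]
    exact mul_simple_mul (by omega) (mul_mem (hlift ha) hσk) (mul_mem hσk (hlift hb))
  | @mul_signChange a ha =>
    have h : σ (k + 1) * (a * signChange σ k) * σ (k + 1) = a * signChange σ (k + 1) := by
      rw [← mul_assoc, hcomm ha]; simp only [signChange, mul_assoc]
    exact h ▸ mul_signChange (hlift ha)

theorem mul_simple (hσ : TypeBRelations n σ) (hkn : k ≤ n)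
    (hprev : ∀ l, k = l + 1 → ∀ b ∈ parabolic σ k, DoubleCosetForm σ l b)
    (hw : DoubleCosetForm σ k w) : DoubleCosetForm σ k (w * σ k) := by
  cases hw with
  | of_mem ha =>
    cases k with
    | zero => exact mul_signChange ha
    | succ k => simpa using mul_simple_mul (by omega) ha (one_mem _)
  | @mul_simple_mul a b hk ha hb =>
    obtain ⟨l, rfl⟩ := Nat.exists_eq_add_of_le' hk
    simpa only [mul_assoc] using ((hprev l rfl b hb).sandwich hσ hkn).mul_left ha
  | @mul_signChange a ha =>
    cases k with
    | zero =>
      have h : a * signChange σ 0 * σ 0 = a := by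
        rw [signChange, mul_assoc, hσ.mul_self 0 hkn, mul_one]
      exact h.symm ▸ of_mem ha
    | succ k =>
      have h : a * signChange σ (k + 1) * σ (k + 1) = a * σ (k + 1) * signChange σ k := by
        simp only [signChange, mul_assoc, hσ.mul_self (k + 1) hkn, mul_one]
      exact h ▸ mul_simple_mul (by omega) ha (signChange_mem_parabolic σ k)

theorem of_mem_parabolic (hσ : TypeBRelations n σ) (hkn : k ≤ n) (hw : w ∈ parabolic σ (k + 1)) :
    DoubleCosetForm σ k w := by
  induction k using Nat.strong_induction_on generalizing w with
  | _ k ihk =>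
    induction hw using Submonoid.closure_induction_right with
    | one => exact of_mem (one_mem _)
    | mul_right x _ y hy ih =>
      obtain ⟨m, hm, rfl⟩ := hy
      obtain hm | rfl := Nat.lt_succ_iff_lt_or_eq.1 hm
      · exact ih.mul_right hσ hkn (mem_parabolic hm)
      · exact ih.mul_simple hσ hkn fun l hl b hb => ihk l (by omega) (by omega) (hl ▸ hb)

end DoubleCosetForm

end Parabolic

section Length

variable {n k : ℕ} {w : GroupB n}

theorem length_simpleB_le (n m : ℕ) : (coxB n).length (simpleB n m) ≤ 1 := by
  unfold simpleB
  split_ifs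
  · exact ((coxB n).length_simple _).le
  · simp

theorem length_signChange_le (n k : ℕ) :
    (coxB n).length (signChange (simpleB n) k) ≤ 2 * k + 1 := by
  induction k with
  | zero => exact length_simpleB_le n 0
  | succ k ih =>
    have hs := length_simpleB_le n (k + 1)
    calc (coxB n).length (simpleB n (k + 1) * signChange (simpleB n) k * simpleB n (k + 1))
        ≤ (coxB n).length (simpleB n (k + 1)) + (coxB n).length (signChange (simpleB n) k)
          + (coxB n).length (simpleB n (k + 1)) :=
          ((coxB n).length_mul_le _ _).trans (by gcongr; exact (coxB n).length_mul_le _ _)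
      _ ≤ 2 * (k + 1) + 1 := by omega

theorem exists_eq_mul_length_le (hk : k ≤ n) (hw : w ∈ parabolic (simpleB n) (k + 1)) :
    ∃ a ∈ parabolic (simpleB n) k, ∃ r, w = a * r ∧ (coxB n).length r ≤ 2 * k + 1 := by
  have hσ := typeBRelations_simpleB n
  induction k generalizing w with
  | zero =>
    cases DoubleCosetForm.of_mem_parabolic hσ hk hw with
    | of_mem ha => exact ⟨w, ha, 1, by simp⟩
    | mul_simple_mul h => omega
    | mul_signChange ha => exact ⟨_, ha, _, rfl, length_signChange_le n 0⟩
  | succ k ih =>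
    cases DoubleCosetForm.of_mem_parabolic hσ hk hw with
    | of_mem ha => exact ⟨w, ha, 1, by simp⟩
    | @mul_simple_mul a b _ ha hb =>
      obtain ⟨c, hc, r, rfl, hr⟩ := ih (by omega) hb
      have hcomm := (hσ.commute_parabolic (by omega) hk hc).eq
      refine ⟨a * c, mul_mem ha (parabolic_mono k.le_succ hc), simpleB n (k + 1) * r, ?_, ?_⟩
      · simp only [mul_assoc, ← mul_assoc c, ← hcomm]
      · have hlen := (coxB n).length_mul_le (simpleB n (k + 1)) r
        have hs := length_simpleB_le n (k + 1)
        omega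
    | mul_signChange ha => exact ⟨_, ha, _, rfl, length_signChange_le n _⟩

theorem length_le_sq_of_mem_parabolic (hk : k ≤ n + 1) (hw : w ∈ parabolic (simpleB n) k) :
    (coxB n).length w ≤ k ^ 2 := by
  induction k generalizing w with
  | zero =>
    rw [parabolic_zero, Submonoid.mem_bot] at hw
    simp [hw]
  | succ k ih =>
    obtain ⟨a, ha, r, rfl, hr⟩ := exists_eq_mul_length_le (by omega) hw
    calc (coxB n).length (a * r) ≤ (coxB n).length a + (coxB n).length r :=
          (coxB n).length_mul_le a r
      _ ≤ k ^ 2 + (2 * k + 1) := add_le_add (ih (by omega) ha) hr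
      _ = (k + 1) ^ 2 := by ring

theorem length_le_sq (w : GroupB n) : (coxB n).length w ≤ (n + 1) ^ 2 :=
  length_le_sq_of_mem_parabolic le_rfl (parabolic_simpleB_eq_top n ▸ Submonoid.mem_top w)

end Length

section SignedPermutations

/-- The action of the generators of type `B` on integer sequences by signed permutations: `t`
changes the sign of the entry with index `0`, and `s_{m+1}` exchanges the entries with indices `m`
and `m + 1`. -/
def signedPerm : ℕ → Function.End (ℕ → ℤ)
  | 0 => fun x => Function.update x 0 (-x 0)
  | m + 1 => fun x => x ∘ Equiv.swap m (m + 1)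

theorem signedPerm_zero_apply (x : ℕ → ℤ) (l : ℕ) :
    signedPerm 0 x l = if l = 0 then -x 0 else x l :=
  Function.update_apply x 0 (-x 0) l

theorem signedPerm_succ_apply (m : ℕ) (x : ℕ → ℤ) (l : ℕ) :
    signedPerm (m + 1) x l = x (Equiv.swap m (m + 1) l) := rfl

theorem mul_signedPerm_apply (f g : Function.End (ℕ → ℤ)) (x : ℕ → ℤ) (l : ℕ) :
    (f * g) x l = f (g x) l := rfl

theorem one_signedPerm_apply (x : ℕ → ℤ) (l : ℕ) : (1 : Function.End (ℕ → ℤ)) x l = x l := rfl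

theorem typeBRelations_signedPerm (n : ℕ) : TypeBRelations n signedPerm where
  mul_self m _ := by
    funext x l
    cases m with
    | zero =>
      rw [mul_signedPerm_apply, one_signedPerm_apply]
      by_cases hl : l = 0 <;> simp [signedPerm_zero_apply, hl]
    | succ m => simp [mul_signedPerm_apply, one_signedPerm_apply, signedPerm_succ_apply]
  comm i j _ hij := by
    obtain ⟨j, rfl⟩ : ∃ l, j = l + 1 := ⟨j - 1, by omega⟩
    funext x l
    cases i with
    | zero =>
      simp only [mul_signedPerm_apply, signedPerm_zero_apply, signedPerm_succ_apply,
        Equiv.swap_apply_def]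
      grind
    | succ i =>
      simp only [mul_signedPerm_apply, signedPerm_succ_apply, Equiv.swap_apply_def]
      congr 1
      split_ifs <;> omega
  braid i hi _ := by
    obtain ⟨i, rfl⟩ : ∃ l, i = l + 1 := ⟨i - 1, by omega⟩
    funext x l
    simp only [mul_signedPerm_apply, signedPerm_succ_apply, Equiv.swap_apply_def]
    congr 1
    split_ifs <;> omega
  braid_four _ := by
    funext x l
    have swap_apply (y : ℕ → ℤ) (l : ℕ) :
        signedPerm 1 y l = if l = 0 then y 1 else if l = 1 then y 0 else y l := by
      rw [signedPerm_succ_apply, Equiv.swap_apply_def]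
      split_ifs <;> rfl
    simp only [mul_signedPerm_apply, signedPerm_zero_apply, swap_apply]
    grind

theorem signChange_signedPerm (k : ℕ) (x : ℕ → ℤ) :
    signChange signedPerm k x = Function.update x k (-x k) := by
  induction k generalizing x with
  | zero => rfl
  | succ k ih =>
    funext l
    simp only [signChange, mul_signedPerm_apply, signedPerm_succ_apply]
    change signChange signedPerm k (x ∘ Equiv.swap k (k + 1)) (Equiv.swap k (k + 1) l) = _
    rw [ih]
    simp only [Function.comp, Function.update_apply, Equiv.swap_apply_def]
    split_ifs <;> first | rfl | omega | (congr 1; omega)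

/-- The action of `B_{n+1}` on integer sequences by signed permutations. -/
def signedAction (n : ℕ) : GroupB n →* Function.End (ℕ → ℤ) :=
  (coxB n).lift ⟨_, (typeBRelations_signedPerm n).isLiftable⟩

theorem signedAction_simple {n : ℕ} (i : Fin (n + 1)) :
    signedAction n ((coxB n).simple i) = signedPerm i :=
  (coxB n).lift_apply_simple (typeBRelations_signedPerm n).isLiftable i

end SignedPermutations

section Inversions

open Finset

variable {N : ℕ} {x : ℕ → ℤ}

/-- The positive roots of type `B_N` that take a negative value on the sequence `x`. A pair `(i, j)`
stands for the root `e_j - e_i` if `i < j`, and for `e_i + e_j` (or `e_i`, up to scaling) if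
`j ≤ i`. -/
def inversions (N : ℕ) (x : ℕ → ℤ) : Finset (ℕ × ℕ) :=
  {p ∈ range N ×ˢ range N | if p.1 < p.2 then x p.2 < x p.1 else x p.1 + x p.2 < 0}

theorem mk_mem_inversions {i j : ℕ} :
    (i, j) ∈ inversions N x ↔
      (i < N ∧ j < N) ∧ if i < j then x j < x i else x i + x j < 0 := by
  simp only [inversions, mem_filter, mem_product, mem_range]

theorem card_le_card_add_one_of_involOn {α : Type*} {s t : Finset α} {f : α → α}
    {q : α} (hmaps : ∀ p ∈ s, p ≠ q → f p ∈ t) (hinvol : ∀ p ∈ s, p ≠ q → f (f p) = p) :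
    #s ≤ #t + 1 := by
  classical
  have herase : #(s.erase q) ≤ #t := by
    refine card_le_card_of_injOn f (fun p hp => ?_) (Set.LeftInvOn.injOn (f₁' := f) fun p hp => ?_)
    · exact hmaps p (mem_of_mem_erase hp) (ne_of_mem_erase hp)
    · exact hinvol p (mem_of_mem_erase hp) (ne_of_mem_erase hp)
  exact (Nat.sub_le_iff_le_add.1 s.pred_card_le_card_erase).trans (by gcongr)

/- A simple reflection permutes the positive roots other than its own root. -/
theorem card_inversions_signedPerm_zero_le (N : ℕ) (x : ℕ → ℤ) :
    #(inversions N (signedPerm 0 x)) ≤ #(inversions N x) + 1 := by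
  refine card_le_card_add_one_of_involOn (q := (0, 0))
    (f := fun p => if p.1 = 0 ∨ p.2 = 0 then p.swap else p) ?_ ?_
  · rintro ⟨i, j⟩ hp hne
    simp only [ne_eq, Prod.mk.injEq] at hne
    simp only [mk_mem_inversions, signedPerm_zero_apply] at hp
    split_ifs <;> simp only [Prod.swap_prod_mk, mk_mem_inversions] <;> split_ifs at hp ⊢ <;> grind
  · rintro ⟨i, j⟩ - -
    split_ifs <;> simp_all

theorem card_inversions_signedPerm_succ_le {m : ℕ} (hm : m + 1 < N) (x : ℕ → ℤ) :
    #(inversions N (signedPerm (m + 1) x)) ≤ #(inversions N x) + 1 := by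
  refine card_le_card_add_one_of_involOn (q := (m, m + 1))
    (f := fun p => if p = (m + 1, m) then p
      else p.map (Equiv.swap m (m + 1)) (Equiv.swap m (m + 1))) ?_ ?_
  · rintro ⟨i, j⟩ hp hne
    simp only [ne_eq, Prod.mk.injEq] at hne ⊢
    simp only [mk_mem_inversions, signedPerm_succ_apply] at hp
    split_ifs with hij
    · obtain ⟨rfl, rfl⟩ := hij
      simp_all [mk_mem_inversions, add_comm]
    · simp only [Prod.map_apply, mk_mem_inversions]
      have hlt : Equiv.swap m (m + 1) i < Equiv.swap m (m + 1) j ↔ i < j := by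
        simp only [Equiv.swap_apply_def]
        split_ifs <;> omega
      refine ⟨?_, by simpa only [hlt] using hp.2⟩
      simp only [Equiv.swap_apply_def]
      split_ifs <;> omega
  · rintro ⟨i, j⟩ - hne
    simp only [ne_eq, Prod.mk.injEq] at hne ⊢
    split_ifs <;> simp_all [Equiv.swap_apply_eq_iff]

theorem card_inversions_signedPerm_le {m : ℕ} (hm : m < N) (x : ℕ → ℤ) :
    #(inversions N (signedPerm m x)) ≤ #(inversions N x) + 1 := by
  cases m with
  | zero => exact card_inversions_signedPerm_zero_le N x
  | succ m => exact card_inversions_signedPerm_succ_le hm x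

theorem inversions_eq_empty (hpos : ∀ i < N, 0 < x i) (hmono : StrictMonoOn x (Set.Iio N)) :
    inversions N x = ∅ := by
  refine eq_empty_of_forall_notMem fun ⟨i, j⟩ hp => ?_
  obtain ⟨⟨hi, hj⟩, h⟩ := mk_mem_inversions.1 hp
  split_ifs at h with hij
  · exact h.not_gt (hmono hi hj hij)
  · exact h.not_gt (add_pos (hpos i hi) (hpos j hj))

theorem card_inversions_eq_sq (hneg : ∀ i < N, x i < 0) (hanti : StrictAntiOn x (Set.Iio N)) :
    #(inversions N x) = N ^ 2 := by
  have huniv : inversions N x = range N ×ˢ range N := by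
    refine filter_true_of_mem fun p hp => ?_
    obtain ⟨hi, hj⟩ : p.1 < N ∧ p.2 < N := by simpa using hp
    split_ifs with hij
    · exact hanti hi hj hij
    · exact add_neg (hneg _ hi) (hneg _ hj)
  rw [huniv, card_product, card_range, sq]

theorem card_inversions_wordProd_le {n : ℕ} (hx : inversions (n + 1) x = ∅)
    (ω : List (Fin (n + 1))) :
    #(inversions (n + 1) (signedAction n ((coxB n).wordProd ω) x)) ≤ ω.length := by
  induction ω with
  | nil =>
    rw [CoxeterSystem.wordProd_nil, map_one]
    exact (congrArg card hx).le
  | cons i ω ih =>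
    rw [CoxeterSystem.wordProd_cons, map_mul, signedAction_simple, List.length_cons]
    exact (card_inversions_signedPerm_le i.isLt _).trans (by gcongr)

theorem card_inversions_le_length {n : ℕ} (hx : inversions (n + 1) x = ∅) (w : GroupB n) :
    #(inversions (n + 1) (signedAction n w x)) ≤ (coxB n).length w := by
  obtain ⟨ω, hω, rfl⟩ := (coxB n).exists_isReduced w
  exact hω.eq ▸ card_inversions_wordProd_le hx ω

end Inversions

section LongestWord

open Finset

variable {n : ℕ}

/-- The word `s_k ⋯ s_1 t s_1 ⋯ s_k`. -/
def signChangeWord (k : Fin (n + 1)) : List (Fin (n + 1)) :=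
  Fin.induction (motive := fun _ => List (Fin (n + 1))) [0] (fun i ω => i.succ :: (ω ++ [i.succ])) k

theorem signChangeWord_zero : signChangeWord (0 : Fin (n + 1)) = [0] := rfl

theorem signChangeWord_succ (i : Fin n) :
    signChangeWord i.succ = i.succ :: (signChangeWord i.castSucc ++ [i.succ]) := rfl

theorem length_signChangeWord (k : Fin (n + 1)) : (signChangeWord k).length = 2 * k + 1 := by
  induction k using Fin.induction with
  | zero => rfl
  | succ i ih =>
    simp only [signChangeWord_succ, List.length_cons, List.length_append, ih, List.length_nil,
      Fin.val_castSucc, Fin.val_succ]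
    ring

theorem wordProd_signChangeWord (k : Fin (n + 1)) :
    (coxB n).wordProd (signChangeWord k) = signChange (simpleB n) k := by
  induction k using Fin.induction with
  | zero =>
    rw [signChangeWord_zero, CoxeterSystem.wordProd_singleton, Fin.val_zero, signChange,
      ← simpleB_val, Fin.val_zero]
  | succ i ih =>
    rw [signChangeWord_succ, CoxeterSystem.wordProd_cons, CoxeterSystem.wordProd_append,
      CoxeterSystem.wordProd_singleton, ih, ← simpleB_val, Fin.val_castSucc, Fin.val_succ,
      signChange, mul_assoc]

theorem signedAction_signChange (k : Fin (n + 1)) (x : ℕ → ℤ) :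
    signedAction n (signChange (simpleB n) k) x = Function.update x k (-x k) := by
  have hmap : signedAction n (signChange (simpleB n) k) = signChange signedPerm k := by
    induction k using Fin.induction with
    | zero => exact (congrArg _ (simpleB_val 0)).trans (signedAction_simple 0)
    | succ i ih =>
      have hsimple : signedAction n (simpleB n (i + 1)) = signedPerm (i + 1) :=
        (congrArg _ (simpleB_val i.succ)).trans (signedAction_simple i.succ)
      rw [Fin.val_castSucc] at ih
      rw [Fin.val_succ, signChange, map_mul, map_mul, ih, hsimple, signChange]
  rw [hmap, signChange_signedPerm]

/-- The word of length `(n + 1) ^ 2` that underlies the product `Φ`. -/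
def longestWord (n : ℕ) : List (Fin (n + 1)) :=
  ((List.finRange (n + 1)).reverse.map signChangeWord).flatten

theorem length_longestWord (n : ℕ) : (longestWord n).length = (n + 1) ^ 2 := by
  rw [longestWord, List.length_flatten, List.map_reverse, List.map_reverse, List.sum_reverse,
    List.map_map, ← List.ofFn_eq_map, List.sum_ofFn]
  simp only [Function.comp_apply, length_signChangeWord]
  rw [Fin.sum_univ_eq_sum_range fun i => 2 * i + 1]
  induction n with
  | zero => rfl
  | succ n ih => rw [Finset.sum_range_succ, ih]; ring

theorem signedAction_flatten_signChangeWord {l : List (Fin (n + 1))} (hl : l.Nodup) (x : ℕ → ℤ)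
    (i : ℕ) :
    signedAction n ((coxB n).wordProd (l.map signChangeWord).flatten) x i =
      if i ∈ l.map Fin.val then -x i else x i := by
  induction l generalizing i with
  | nil => simp [one_signedPerm_apply]
  | cons k l ih =>
    obtain ⟨hk, hl⟩ := List.nodup_cons.1 hl
    have hk' : (k : ℕ) ∉ l.map Fin.val := by
      rwa [List.mem_map_of_injective Fin.val_injective]
    rw [List.map_cons, List.flatten_cons, CoxeterSystem.wordProd_append, map_mul,
      mul_signedPerm_apply, wordProd_signChangeWord, signedAction_signChange,
      Function.update_apply, ih hl, ih hl, if_neg hk']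
    by_cases hik : i = k <;> simp [hik]

theorem signedAction_longestWord (x : ℕ → ℤ) {i : ℕ} (hi : i < n + 1) :
    signedAction n ((coxB n).wordProd (longestWord n)) x i = -x i := by
  rw [longestWord, signedAction_flatten_signChangeWord
    (List.nodup_reverse.2 (List.nodup_finRange _)), if_pos]
  exact List.mem_map.2 ⟨⟨i, hi⟩, by simp, rfl⟩

theorem isReduced_longestWord (n : ℕ) : (coxB n).IsReduced (longestWord n) := by
  have hpos : inversions (n + 1) (fun i => (i : ℤ) + 1) = ∅ :=
    inversions_eq_empty (fun _ _ => by positivity) fun i _ j _ hij => by simpa using hij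
  refine le_antisymm ((coxB n).length_wordProd_le _) ?_
  calc (longestWord n).length
      = #(inversions (n + 1) (signedAction n ((coxB n).wordProd (longestWord n))
          fun i => (i : ℤ) + 1)) := by
        rw [length_longestWord, card_inversions_eq_sq]
        · intro i hi
          rw [signedAction_longestWord _ hi]
          linarith
        · intro i hi j hj hij
          rw [signedAction_longestWord _ hi, signedAction_longestWord _ hj]
          linarith [Nat.cast_lt (α := ℤ).2 hij]
    _ ≤ _ := card_inversions_le_length hpos _

theorem exists_isLetter_list_phi (v : Fin (n + 1) → ℂ) {k m : Fin (n + 1)} (hm : m ≤ k) :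
    ∃ L : List (MonoidAlgebra (RatFun (n + 1)) (GroupB n)),
      List.Forall₂ (IsLetter v) (signChangeWord m) L ∧
        phi v uvar (v k) (uvar k) m = L.prod := by
  induction m using Fin.induction with
  | zero =>
    refine ⟨[baxtT (RatFun (n + 1)) n (v k)], ?_, List.prod_singleton.symm⟩
    exact .cons (Or.inr (Or.inl ⟨rfl, k, rfl⟩)) .nil
  | succ i ih =>
    obtain ⟨L, hL, hprod⟩ := ih (Fin.castSucc_lt_succ.le.trans hm)
    refine ⟨baxtS i (v k) (v i.castSucc) (uvar k) (uvar i.castSucc) ::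
      (L ++ [gen (RatFun (n + 1)) i.succ]), .cons (Or.inr (Or.inr ⟨i, rfl, k, i.castSucc, ?_, rfl⟩))
      (List.rel_append hL (.cons (Or.inl rfl) .nil)), ?_⟩
    · exact Fin.castSucc_lt_succ.trans_le hm
    · rw [List.prod_cons, List.prod_append, List.prod_singleton, ← hprod, ← mul_assoc]
      rfl

theorem isBaxterizedLongestWord_Phi (v : Fin (n + 1) → ℂ) :
    IsBaxterizedLongestWord v (Phi v uvar) := by
  choose L hL hprod using fun k : Fin (n + 1) => exists_isLetter_list_phi v (le_refl k)
  refine ⟨longestWord n, ((List.finRange (n + 1)).reverse.map L).flatten, isReduced_longestWord n,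
    fun w => ?_, List.rel_flatten ?_, ?_⟩
  · rw [(isReduced_longestWord n).eq, length_longestWord]
    exact length_le_sq w
  · rw [List.forall₂_map_left_iff, List.forall₂_map_right_iff, List.forall₂_same]
    exact fun k _ => hL k
  · rw [List.prod_flatten, List.map_map, Phi, List.ofFn_eq_map, ← List.map_reverse]
    exact congrArg List.prod (List.map_congr_left fun k _ => hprod k)

end LongestWord

end FusionB

namespace FusionB

open Finset

/-- The content of a node, as an integer. -/
def nodeContent (α : Fin 2 × ℕ × ℕ) : ℤ := (α.2.2 : ℤ) - α.2.1

theorem nodeContent_mk (κ : Fin 2) (r c : ℕ) : nodeContent (κ, r, c) = (c : ℤ) - r := rfl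

/-- The relation between two nodes of the same diagram whose contents differ by one. The numbers `i`
and `i + 1` cannot be exchanged in a standard 2-tableau exactly if their nodes are so related. -/
def Near (α β : Fin 2 × ℕ × ℕ) : Prop :=
  α.1 = β.1 ∧ (nodeContent β - nodeContent α = 1 ∨ nodeContent β - nodeContent α = -1)

instance {α β : Fin 2 × ℕ × ℕ} : Decidable (Near α β) :=
  inferInstanceAs (Decidable (_ ∧ _))

theorem near_comm {α β : Fin 2 × ℕ × ℕ} : Near α β ↔ Near β α := by
  unfold Near
  grind

/-- The sequences of nodes that number the nodes of a standard 2-tableau: each initial segment is a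
2-partition. -/
structure IsStandard {m : ℕ} (x : Fin m → Fin 2 × ℕ × ℕ) : Prop where
  injective : Function.Injective x
  exists_eq : ∀ {b : Fin m} {κ : Fin 2} {p q : ℕ × ℕ}, x b = (κ, q) → p ≤ q →
    ∃ a ≤ b, x a = (κ, p)

namespace IsStandard

variable {m : ℕ} {x : Fin m → Fin 2 × ℕ × ℕ} {a b : Fin m} {κ : Fin 2} {p q : ℕ × ℕ}

theorem le_of_le (hx : IsStandard x) (ha : x a = (κ, p)) (hb : x b = (κ, q)) (h : p ≤ q) :
    a ≤ b := by
  obtain ⟨c, hcb, hc⟩ := hx.exists_eq hb h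
  exact hx.injective (hc.trans ha.symm) ▸ hcb

theorem lt_of_lt (hx : IsStandard x) (ha : x a = (κ, p)) (hb : x b = (κ, q)) (h : p < q) :
    a < b := by
  refine (hx.le_of_le ha hb h.le).lt_of_ne ?_
  rintro rfl
  exact h.ne (Prod.mk.inj (ha.symm.trans hb)).2

theorem comp_castSucc {x : Fin (m + 1) → Fin 2 × ℕ × ℕ} (hx : IsStandard x) :
    IsStandard (x ∘ Fin.castSucc) where
  injective := hx.injective.comp (Fin.castSucc_injective m)
  exists_eq {b} _ _ _ hb h := by
    obtain ⟨a, hab, ha⟩ := hx.exists_eq hb h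
    exact ⟨a.castLT ((Fin.le_def.1 hab).trans_lt b.isLt), hab, ha⟩

theorem snoc (hx : IsStandard x) (hnew : ∀ a, x a ≠ (κ, q))
    (hcorner : ∀ p < q, ∃ a, x a = (κ, p)) :
    IsStandard (Fin.snoc (α := fun _ => Fin 2 × ℕ × ℕ) x (κ, q)) where
  injective := Fin.snoc_injective_iff.2 ⟨hx.injective, fun ⟨a, ha⟩ => hnew a ha⟩
  exists_eq {b} κ' p q' hb h := by
    cases b using Fin.lastCases with
    | last =>
      obtain ⟨rfl, rfl⟩ : κ = κ' ∧ q = q' := by simpa using hb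
      rcases h.eq_or_lt with rfl | hlt
      · exact ⟨Fin.last m, le_rfl, Fin.snoc_last _ _⟩
      · obtain ⟨a, ha⟩ := hcorner p hlt
        exact ⟨a.castSucc, Fin.le_last _, by rw [Fin.snoc_castSucc, ha]⟩
    | cast b =>
      rw [Fin.snoc_castSucc] at hb
      obtain ⟨a, hab, ha⟩ := hx.exists_eq hb h
      exact ⟨a.castSucc, hab, by rw [Fin.snoc_castSucc, ha]⟩

/-- The diagrams of the 2-partition formed by the nodes with numbers less than `k`. -/
def diagram (hx : IsStandard x) (k : ℕ) (κ : Fin 2) : YoungDiagram where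
  cells := ({a | (a : ℕ) < k ∧ (x a).1 = κ} : Finset (Fin m)).image fun a => (x a).2
  isLowerSet := by
    intro q p hpq hq
    simp only [coe_image, coe_filter_univ, Set.mem_image, Set.mem_ofPred_eq] at hq ⊢
    obtain ⟨b, ⟨hbk, rfl⟩, rfl⟩ := hq
    obtain ⟨a, hab, ha⟩ := hx.exists_eq (q := (x b).2) rfl hpq
    exact ⟨a, ⟨(Fin.le_def.1 hab).trans_lt hbk, by rw [ha]⟩, by rw [ha]⟩

theorem mem_diagram (hx : IsStandard x) {k : ℕ} :
    p ∈ hx.diagram k κ ↔ ∃ a : Fin m, (a : ℕ) < k ∧ x a = (κ, p) := by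
  simp only [diagram, ← YoungDiagram.mem_cells, mem_image, mem_filter_univ,
    Prod.ext_iff, and_assoc]

theorem mem_diagram_self (hx : IsStandard x) : p ∈ hx.diagram m κ ↔ ∃ a, x a = (κ, p) := by
  simp only [mem_diagram, Fin.is_lt, true_and]

end IsStandard

namespace StandardTableau

variable {m : ℕ}

/-- The standard 2-tableau with a given sequence of nodes. -/
noncomputable def ofSeq (x : Fin m → Fin 2 × ℕ × ℕ) (hx : IsStandard x) : StandardTableau m where
  shape := hx.diagram m
  node := Equiv.ofBijective (fun a => ⟨x a, hx.mem_diagram_self.2 ⟨a, rfl⟩⟩)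
    ⟨fun _ _ h => hx.injective (congrArg Subtype.val h), fun ⟨_, hα⟩ =>
      (hx.mem_diagram_self.1 hα).imp fun _ ha => Subtype.ext ha⟩
  row_lt a b hκ hr hc := hx.lt_of_lt (κ := (x b).1) (p := (x a).2) (q := (x b).2)
    (Prod.ext hκ rfl) rfl (Prod.lt_iff.2 (Or.inr ⟨hr.le, hc⟩))
  col_lt a b hκ hc hr := hx.lt_of_lt (κ := (x b).1) (p := (x a).2) (q := (x b).2)
    (Prod.ext hκ rfl) rfl (Prod.lt_iff.2 (Or.inl ⟨hr, hc.le⟩))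

/-- The sequence of nodes carrying the numbers `0, 1, …`. -/
def seq (T : StandardTableau m) (a : Fin m) : Fin 2 × ℕ × ℕ := (T.node a).1

theorem seq_ofSeq (x : Fin m → Fin 2 × ℕ × ℕ) (hx : IsStandard x) : (ofSeq x hx).seq = x := rfl

theorem seq_injective (T : StandardTableau m) : Function.Injective T.seq :=
  Subtype.val_injective.comp T.node.injective

theorem mem_shape_iff (T : StandardTableau m) {κ : Fin 2} {p : ℕ × ℕ} :
    p ∈ T.shape κ ↔ ∃ a, T.seq a = (κ, p) := by
  refine ⟨fun h => ⟨T.node.symm ⟨(κ, p), h⟩, ?_⟩, fun ⟨a, ha⟩ => ?_⟩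
  · rw [seq, Equiv.apply_symm_apply]
  · have hmem : (T.seq a).2 ∈ T.shape (T.seq a).1 := (T.node a).2
    rwa [ha] at hmem

theorem seq_ext {T S : StandardTableau m} (h : T.seq = S.seq) : T = S := by
  have hshape : T.shape = S.shape := by
    funext κ
    ext p
    rw [YoungDiagram.mem_cells, YoungDiagram.mem_cells, mem_shape_iff, mem_shape_iff, h]
  obtain ⟨shapeT, nodeT, _, _⟩ := T
  obtain ⟨shapeS, nodeS, _, _⟩ := S
  obtain rfl : shapeT = shapeS := hshape
  obtain rfl : nodeT = nodeS := Equiv.ext fun a => Subtype.ext (congrFun h a)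
  rfl

theorem isStandard_seq (T : StandardTableau m) : IsStandard T.seq := by
  refine ⟨T.seq_injective, fun {b κ p q} hb hpq => ?_⟩
  obtain ⟨r, c⟩ := p
  obtain ⟨r', c'⟩ := q
  obtain ⟨hr, hc⟩ : r ≤ r' ∧ c ≤ c' := hpq
  have hmem : (r', c') ∈ T.shape κ := T.mem_shape_iff.2 ⟨b, hb⟩
  obtain ⟨a, ha⟩ := T.mem_shape_iff.1 ((T.shape κ).up_left_mem hr hc hmem)
  obtain ⟨d, hd⟩ := T.mem_shape_iff.1 ((T.shape κ).up_left_mem hr le_rfl hmem)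
  have had : a ≤ d := by
    rcases hc.eq_or_lt with rfl | hlt
    · exact (T.seq_injective (ha.trans hd.symm)).le
    · refine (T.row_lt a d ?_ ?_ ?_).le <;> simp_all only [seq]
  have hdb : d ≤ b := by
    rcases hr.eq_or_lt with rfl | hlt
    · exact (T.seq_injective (hd.trans hb.symm)).le
    · refine (T.col_lt d b ?_ ?_ ?_).le <;> simp_all only [seq]
  exact ⟨a, had.trans hdb, ha⟩

theorem row_add_col_le (T : StandardTableau m) {a : Fin m} {κ : Fin 2} {r c : ℕ}
    (ha : T.seq a = (κ, r, c)) : r + c ≤ a := by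
  induction h : r + c generalizing a r c with
  | zero => exact Nat.zero_le _
  | succ k ih =>
    obtain ⟨r', c', hlt, hsum⟩ : ∃ r' c', (r', c') < (r, c) ∧ r' + c' = k := by
      rcases r.eq_zero_or_pos with rfl | hr
      · exact ⟨0, c - 1, Prod.mk_lt_mk.2 (by omega), by omega⟩
      · exact ⟨r - 1, c, Prod.mk_lt_mk.2 (by omega), by omega⟩
    obtain ⟨b, -, hb⟩ := T.isStandard_seq.exists_eq ha hlt.le
    exact (ih hb hsum).trans_lt (T.isStandard_seq.lt_of_lt hb ha hlt)

theorem row_le (T : StandardTableau m) (a : Fin m) : (T.seq a).2.1 ≤ a :=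
  (Nat.le_add_right _ _).trans (T.row_add_col_le (Eq.refl (T.seq a)))

theorem col_le (T : StandardTableau m) (a : Fin m) : (T.seq a).2.2 ≤ a :=
  (Nat.le_add_left _ _).trans (T.row_add_col_le (Eq.refl (T.seq a)))

instance : Finite (StandardTableau m) := by
  refine Finite.of_injective (β := Fin m → Fin 2 × Fin m × Fin m) (fun T a =>
    ((T.seq a).1, ⟨_, (T.row_le a).trans_lt a.2⟩, ⟨_, (T.col_le a).trans_lt a.2⟩))
    fun T S h => seq_ext (funext fun a => ?_)
  simpa only [Prod.mk.injEq, Fin.mk.injEq, ← Prod.ext_iff] using congrFun h a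

noncomputable instance : Fintype (StandardTableau m) := Fintype.ofFinite _

noncomputable instance : DecidableEq (StandardTableau m) := Classical.decEq _

theorem not_lt_of_forall_lt_seq_eq {T S : StandardTableau m} {a : Fin m}
    (h : ∀ b < a, T.seq b = S.seq b) {κ : Fin 2} {p q : ℕ × ℕ} (hT : T.seq a = (κ, p))
    (hS : S.seq a = (κ, q)) : ¬p < q := fun hpq => by
  obtain ⟨b, -, hb⟩ := S.isStandard_seq.exists_eq hS hpq.le
  have hba : b < a := S.isStandard_seq.lt_of_lt hb hS hpq
  exact hba.ne (T.seq_injective ((h b hba).trans (hb.trans hT.symm)))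

theorem seq_eq_of_nodeContent_eq {T S : StandardTableau m} {k : ℕ}
    (h : ∀ a : Fin m, (a : ℕ) < k →
      (T.seq a).1 = (S.seq a).1 ∧ nodeContent (T.seq a) = nodeContent (S.seq a))
    {a : Fin m} (ha : (a : ℕ) < k) : T.seq a = S.seq a := by
  induction a using WellFoundedLT.induction with
  | ind a ih =>
    have hlt : ∀ b < a, T.seq b = S.seq b := fun b hb => ih b hb (lt_trans hb ha)
    obtain ⟨hκ, hcont⟩ := h a ha
    rcases hT : T.seq a with ⟨κ, r, c⟩
    rcases hS : S.seq a with ⟨κ', r', c'⟩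
    obtain rfl : κ = κ' := by simpa only [hT, hS] using hκ
    have hTS := not_lt_of_forall_lt_seq_eq hlt hT hS
    have hST := not_lt_of_forall_lt_seq_eq (fun b hb => (hlt b hb).symm) hS hT
    rw [Prod.mk_lt_mk] at hTS hST
    rw [hT, hS, nodeContent_mk, nodeContent_mk] at hcont
    obtain ⟨rfl, rfl⟩ : r = r' ∧ c = c' := by omega
    rfl

theorem nodeContent_ne (T : StandardTableau m) {a b : Fin m} (hab : a < b) (hb : (b : ℕ) ≤ a + 2)
    (h : (T.seq a).1 = (T.seq b).1) : nodeContent (T.seq a) ≠ nodeContent (T.seq b) := by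
  intro hcont
  rcases ha : T.seq a with ⟨κ, r, c⟩
  rcases hb' : T.seq b with ⟨κ', r', c'⟩
  obtain rfl : κ = κ' := by simpa only [ha, hb'] using h
  rw [ha, hb', nodeContent_mk, nodeContent_mk] at hcont
  have hr : r < r' := by
    by_contra hle
    exact hab.not_ge (T.isStandard_seq.le_of_le hb' ha (Prod.mk_le_mk.2 (by omega)))
  have between {p : ℕ × ℕ} (hp : (r, c) < p) (hp' : p < (r', c')) :
      ∃ d, (a < d ∧ d < b) ∧ T.seq d = (κ, p) := by
    obtain ⟨d, -, hd⟩ := T.isStandard_seq.exists_eq hb' hp'.le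
    exact ⟨d, ⟨T.isStandard_seq.lt_of_lt ha hd hp, T.isStandard_seq.lt_of_lt hd hb' hp'⟩, hd⟩
  obtain ⟨d, hd, hseq⟩ := between (p := (r, c + 1))
    (Prod.mk_lt_mk.2 (by omega)) (Prod.mk_lt_mk.2 (by omega))
  obtain ⟨d', hd', hseq'⟩ := between (p := (r + 1, c))
    (Prod.mk_lt_mk.2 (by omega)) (Prod.mk_lt_mk.2 (by omega))
  obtain rfl : d = d' := by omega
  simp [hseq] at hseq'

section Swap

variable {n : ℕ} {i : Fin n} {T S : StandardTableau (n + 1)}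

theorem isSwap_iff : T.IsSwap i S ↔ S.seq = T.seq ∘ Equiv.swap i.castSucc i.succ :=
  ⟨fun h => funext h, fun h => congrFun h⟩

theorem near_of_seq_lt {κ : Fin 2} {p q : ℕ × ℕ} (hp : T.seq i.castSucc = (κ, p))
    (hq : T.seq i.succ = (κ, q)) (hpq : p < q) : Near (κ, p) (κ, q) := by
  have eq_of_between {s : ℕ × ℕ} (hps : p < s) (hsq : s ≤ q) : s = q := by
    obtain ⟨d, hd, hds⟩ := T.isStandard_seq.exists_eq hq hsq
    have hlt : i.castSucc < d := T.isStandard_seq.lt_of_lt hp hds hps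
    obtain rfl : d = i.succ := hd.antisymm (Fin.castSucc_lt_iff_succ_le.1 hlt)
    exact (Prod.mk.inj (hds.symm.trans hq)).2
  obtain ⟨r, c⟩ := p
  obtain ⟨r', c'⟩ := q
  refine ⟨rfl, ?_⟩
  rw [Prod.mk_lt_mk] at hpq
  rw [nodeContent_mk, nodeContent_mk]
  by_cases hr : r < r'
  · have := eq_of_between (s := (r + 1, c)) (Prod.mk_lt_mk.2 (by omega))
      (Prod.mk_le_mk.2 (by omega))
    grind
  · have := eq_of_between (s := (r, c + 1)) (Prod.mk_lt_mk.2 (by omega))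
      (Prod.mk_le_mk.2 (by omega))
    grind

theorem not_near_of_isSwap (h : T.IsSwap i S) : ¬Near (T.seq i.castSucc) (T.seq i.succ) := by
  rintro ⟨hκ, hcont⟩
  rcases hp : T.seq i.castSucc with ⟨κ, r, c⟩
  rcases hq : T.seq i.succ with ⟨κ', r', c'⟩
  obtain rfl : κ = κ' := by simpa only [hp, hq] using hκ
  rw [hp, hq, nodeContent_mk, nodeContent_mk] at hcont
  have hlt : i.castSucc < i.succ := Fin.castSucc_lt_succ
  have hp' : S.seq i.succ = (κ, r, c) := by
    rw [isSwap_iff.1 h, Function.comp_apply, Equiv.swap_apply_right, hp]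
  have hq' : S.seq i.castSucc = (κ, r', c') := by
    rw [isSwap_iff.1 h, Function.comp_apply, Equiv.swap_apply_left, hq]
  have hT : ¬(r', c') ≤ (r, c) := fun hle =>
    hlt.not_ge (T.isStandard_seq.le_of_le hq hp hle)
  have hS : ¬(r, c) ≤ (r', c') := fun hle =>
    hlt.not_ge (S.isStandard_seq.le_of_le hp' hq' hle)
  rw [Prod.mk_le_mk] at hT hS
  omega

theorem isStandard_comp_swap (h : ¬Near (T.seq i.castSucc) (T.seq i.succ)) :
    IsStandard (T.seq ∘ Equiv.swap i.castSucc i.succ) where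
  injective := T.seq_injective.comp (Equiv.injective _)
  exists_eq {b κ p q} hb hpq := by
    rcases hpq.eq_or_lt with rfl | hlt
    · exact ⟨b, le_rfl, hb⟩
    obtain ⟨a, -, ha⟩ := T.isStandard_seq.exists_eq hb hpq
    have hab : a < Equiv.swap i.castSucc i.succ b := T.isStandard_seq.lt_of_lt ha hb hlt
    refine ⟨Equiv.swap i.castSucc i.succ a, ?_, by
      rwa [Function.comp_apply, Equiv.swap_apply_self]⟩
    by_cases hbad : a = i.castSucc ∧ b = i.castSucc
    · obtain ⟨rfl, rfl⟩ := hbad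
      rw [Function.comp_apply, Equiv.swap_apply_left] at hb
      exact absurd (ha ▸ hb ▸ near_of_seq_lt ha hb hlt) h
    · simp only [Equiv.swap_apply_def, Fin.lt_def, Fin.le_def, Fin.ext_iff] at hab hbad ⊢
      split_ifs at hab ⊢ <;> simp only [Fin.val_castSucc, Fin.val_succ] at * <;> omega

theorem exists_isSwap_iff : (∃ S, T.IsSwap i S) ↔ ¬Near (T.seq i.castSucc) (T.seq i.succ) :=
  ⟨fun ⟨_, hS⟩ => not_near_of_isSwap hS,
    fun h => ⟨ofSeq _ (isStandard_comp_swap h), isSwap_iff.2 rfl⟩⟩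

end Swap

/-- The tableau without its largest number. -/
noncomputable def restrict (T : StandardTableau (m + 1)) : StandardTableau m :=
  ofSeq (T.seq ∘ Fin.castSucc) T.isStandard_seq.comp_castSucc

theorem seq_restrict (T : StandardTableau (m + 1)) (a : Fin m) :
    T.restrict.seq a = T.seq a.castSucc := rfl

theorem eq_of_restrict_eq {T S : StandardTableau (m + 1)} (h : T.restrict = S.restrict)
    (hlast : T.seq (Fin.last m) = S.seq (Fin.last m)) : T = S :=
  seq_ext (funext (Fin.lastCases hlast fun a => congrFun (congrArg seq h) a))

/-- The number of nodes with numbers less than `k` in row `i` of the diagram `κ`. -/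
def rows (T : StandardTableau m) (k : ℕ) (κ : Fin 2) (i : ℕ) : ℕ :=
  (T.isStandard_seq.diagram k κ).rowLen i

theorem lt_rows_iff (T : StandardTableau m) {k : ℕ} {κ : Fin 2} {i c : ℕ} :
    c < T.rows k κ i ↔ ∃ a : Fin m, (a : ℕ) < k ∧ T.seq a = (κ, i, c) := by
  rw [rows, ← YoungDiagram.mem_iff_lt_rowLen, IsStandard.mem_diagram]

theorem rows_antitone (T : StandardTableau m) (k : ℕ) (κ : Fin 2) : Antitone (T.rows k κ) :=
  (T.isStandard_seq.diagram k κ).rowLen_anti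

theorem col_eq_rows (T : StandardTableau m) (a : Fin m) :
    (T.seq a).2.2 = T.rows a (T.seq a).1 (T.seq a).2.1 := by
  rcases ha : T.seq a with ⟨κ, r, c⟩
  refine eq_of_forall_lt_iff fun d => ?_
  rw [lt_rows_iff]
  constructor
  · intro hd
    have hlt : (r, d) < (r, c) := Prod.mk_lt_mk_iff_right.2 hd
    obtain ⟨b, -, hb⟩ := T.isStandard_seq.exists_eq ha hlt.le
    exact ⟨b, T.isStandard_seq.lt_of_lt hb ha hlt, hb⟩
  · rintro ⟨b, hba, hb⟩
    by_contra hle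
    exact hba.not_ge (T.isStandard_seq.le_of_le ha hb (Prod.mk_le_mk.2 ⟨le_rfl, not_lt.1 hle⟩))

theorem rows_zero (T : StandardTableau m) (κ : Fin 2) : T.rows 0 κ = fun _ => 0 := by
  funext i
  by_contra h
  obtain ⟨a, ha, -⟩ := T.lt_rows_iff.1 (Nat.pos_of_ne_zero h)
  exact (Nat.not_lt_zero _ ha).elim

theorem rows_succ (T : StandardTableau m) (a : Fin m) (κ : Fin 2) (i : ℕ) :
    T.rows (a + 1) κ i = T.rows a κ i + if (T.seq a).1 = κ ∧ (T.seq a).2.1 = i then 1 else 0 := by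
  refine eq_of_forall_lt_iff fun c => ?_
  have hsplit : c < T.rows (a + 1) κ i ↔ c < T.rows a κ i ∨ T.seq a = (κ, i, c) := by
    simp only [lt_rows_iff, Nat.lt_succ_iff_lt_or_eq, or_and_right, exists_or, Fin.val_inj,
      exists_eq_left]
  rw [hsplit]
  split_ifs with h
  · obtain ⟨rfl, rfl⟩ := h
    rw [Nat.lt_succ_iff_lt_or_eq, ← col_eq_rows, Prod.ext_iff, Prod.ext_iff]
    simp only [true_and, eq_comm]
  · rw [add_zero, or_iff_left]
    rintro ha
    exact h ⟨by rw [ha], by rw [ha]⟩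

theorem rows_eq_rowLen (T : StandardTableau m) (κ : Fin 2) (i : ℕ) :
    T.rows m κ i = (T.shape κ).rowLen i := by
  refine eq_of_forall_lt_iff fun c => ?_
  simp only [lt_rows_iff, Fin.is_lt, true_and, ← YoungDiagram.mem_iff_lt_rowLen, mem_shape_iff]

theorem rows_eq_zero (T : StandardTableau m) (k : ℕ) (κ : Fin 2) {i : ℕ} (hi : m ≤ i) :
    T.rows k κ i = 0 := by
  by_contra h
  obtain ⟨a, -, ha⟩ := T.lt_rows_iff.1 (Nat.pos_of_ne_zero h)
  have := T.row_add_col_le ha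
  omega

theorem rows_congr {T S : StandardTableau m} {k : ℕ}
    (h : ∀ a : Fin m, (a : ℕ) < k → T.seq a = S.seq a) (κ : Fin 2) (i : ℕ) :
    T.rows k κ i = S.rows k κ i := by
  refine eq_of_forall_lt_iff fun c => ?_
  rw [lt_rows_iff, lt_rows_iff]
  exact exists_congr fun a => and_congr_right fun ha => by rw [h a ha]

theorem rows_restrict (T : StandardTableau (m + 1)) (κ : Fin 2) (i : ℕ) :
    T.restrict.rows m κ i = T.rows m κ i := by
  refine eq_of_forall_lt_iff fun c => ?_
  rw [lt_rows_iff, lt_rows_iff]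
  exact ⟨fun ⟨a, ha, he⟩ => ⟨a.castSucc, ha, he⟩, fun ⟨a, ha, he⟩ => ⟨⟨a, ha⟩, ha, he⟩⟩

theorem rows_lt_of_lt (T : StandardTableau m) (a : Fin m) {j : ℕ} (hj : j < (T.seq a).2.1) :
    T.rows a (T.seq a).1 (T.seq a).2.1 < T.rows a (T.seq a).1 j := by
  have h := T.rows_antitone (a + 1) (T.seq a).1 hj.le
  rw [rows_succ, rows_succ, if_pos ⟨rfl, rfl⟩, if_neg fun h' => hj.ne' h'.2] at h
  exact h

theorem exists_restrict_eq (U : StandardTableau m) (κ : Fin 2) (i : ℕ)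
    (h : ∀ j < i, U.rows m κ i < U.rows m κ j) :
    ∃ S : StandardTableau (m + 1), S.restrict = U ∧
      S.seq (Fin.last m) = (κ, i, U.rows m κ i) := by
  have hx := U.isStandard_seq.snoc (κ := κ) (q := (i, U.rows m κ i))
    (fun a ha => lt_irrefl _ (U.lt_rows_iff.2 ⟨a, a.isLt, ha⟩)) fun (r, c) hlt => by
      have hc : c < U.rows m κ r := by
        rcases Prod.mk_lt_mk.1 hlt with ⟨hr, hc⟩ | ⟨hr, hc⟩
        · exact hc.trans_lt (h r hr)
        · exact hc.trans_le (U.rows_antitone m κ hr)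
      exact (U.lt_rows_iff.1 hc).imp fun _ => And.right
  refine ⟨ofSeq _ hx, seq_ext (funext fun a => ?_), ?_⟩
  · rw [seq_restrict, seq_ofSeq, Fin.snoc_castSucc]
  · rw [seq_ofSeq, Fin.snoc_last]

end StandardTableau

end FusionB

namespace FusionB

open StandardTableau

section Coefficients

variable (K : Type*) [Field K]

/-- The inverse of the axial distance between two nodes of the same diagram, extended by zero to
nodes of different diagrams. It is the diagonal coefficient of the seminormal form. -/
def invAxialDist (α β : Fin 2 × ℕ × ℕ) : K :=
  if α.1 = β.1 then ((nodeContent β - nodeContent α : ℤ) : K)⁻¹ else 0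

/-- The off-diagonal coefficient of the seminormal form; it vanishes if the exchange of the two
nodes does not lead to a standard tableau. -/
def offDiagCoeff (α β : Fin 2 × ℕ × ℕ) : K := if Near α β then 0 else 1 + invAxialDist K α β

variable {K}

theorem invAxialDist_comm (α β : Fin 2 × ℕ × ℕ) : invAxialDist K β α = -invAxialDist K α β := by
  unfold invAxialDist
  by_cases h : α.1 = β.1
  · rw [if_pos h, if_pos h.symm, ← inv_neg, ← Int.cast_neg, neg_sub]
  · rw [if_neg h, if_neg (Ne.symm h), neg_zero]

theorem offDiagCoeff_mul_offDiagCoeff (α β : Fin 2 × ℕ × ℕ) :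
    offDiagCoeff K α β * offDiagCoeff K β α = 1 - invAxialDist K α β ^ 2 := by
  unfold offDiagCoeff
  by_cases h : Near α β
  · rw [if_pos h, zero_mul]
    obtain ⟨hκ, hcont | hcont⟩ := h <;> simp [invAxialDist, hκ, hcont]
  · rw [if_neg h, if_neg (mt near_comm.1 h), invAxialDist_comm α β]
    ring

/- The partial fraction identity `1 / xy = (1 / x + 1 / y) / (x + y)` behind the braid relation. -/
theorem invAxialDist_mul_add [CharZero K] {α β γ : Fin 2 × ℕ × ℕ}
    (hαβ : α.1 = β.1 → nodeContent α ≠ nodeContent β)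
    (hβγ : β.1 = γ.1 → nodeContent β ≠ nodeContent γ)
    (hαγ : α.1 = γ.1 → nodeContent α ≠ nodeContent γ) :
    invAxialDist K α γ * (invAxialDist K α β + invAxialDist K β γ) =
      invAxialDist K α β * invAxialDist K β γ := by
  have cast_ne {a b : ℤ} (h : a ≠ b) : ((b - a : ℤ) : K) ≠ 0 :=
    Int.cast_ne_zero.2 (sub_ne_zero.2 h.symm)
  unfold invAxialDist
  by_cases hab : α.1 = β.1
  · by_cases hbc : β.1 = γ.1
    · have hac := hab.trans hbc
      have hab' := cast_ne (hαβ hab)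
      have hbc' := cast_ne (hβγ hbc)
      have hac' := cast_ne (hαγ hac)
      rw [if_pos hab, if_pos hbc, if_pos hac]
      field_simp
      push_cast
      ring
    · simp [hbc, hab]
  · by_cases hbc : β.1 = γ.1
    · simp [hab, ← hbc]
    · simp [hab, hbc]

end Coefficients

theorem braid_of_seminormal {K V : Type*} [CommRing K] [AddCommGroup V] [Module K V]
    {A B : Module.End K V} {x y₁ y₂ y₃ z₁ z₂ : V} {a b c g₁ g₁' g₂ g₂' g₃ : K}
    (hA : A x = a • x + g₁ • y₁) (hA₁ : A y₁ = (-a) • y₁ + g₁' • x) (hA₂ : A y₂ = b • y₂ + g₂ • y₃)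
    (hAz : A z₁ = c • z₁ + g₃ • z₂) (hB : B x = b • x + g₂ • z₁) (hB₁ : B y₁ = c • y₁ + g₃ • y₂)
    (hBz : B z₁ = (-b) • z₁ + g₂' • x) (hBz₂ : B z₂ = a • z₂ + g₁ • y₃)
    (hg₁ : g₁ * g₁' = 1 - a ^ 2) (hg₂ : g₂ * g₂' = 1 - b ^ 2) (habc : c * (a + b) = a * b) :
    A (B (A x)) = B (A (B x)) := by
  simp only [hA, hB, map_add, map_smul, hB₁, hAz, hA₁, hA₂, hBz, hBz₂]
  match_scalars
  · linear_combination (-c) * hg₂ + c * hg₁ + (b - a) * habc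
  · linear_combination (-g₁) * habc
  · linear_combination g₂ * habc
  all_goals ring

theorem comp_swap_comp_swap {α β : Type*} [DecidableEq α] (x : α → β) (p q : α) :
    (x ∘ Equiv.swap p q) ∘ Equiv.swap p q = x :=
  funext fun a => congrArg x (Equiv.swap_apply_self p q a)

theorem comp_swap_braid {α β : Type*} [DecidableEq α] (x : α → β) {p q r : α} (hpq : p ≠ q)
    (hpr : p ≠ r) (hqr : q ≠ r) :
    ((x ∘ Equiv.swap q r) ∘ Equiv.swap p q) ∘ Equiv.swap q r =
      ((x ∘ Equiv.swap p q) ∘ Equiv.swap q r) ∘ Equiv.swap p q := by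
  funext a
  refine congrArg x ?_
  simp only [Equiv.swap_apply_def]
  grind

section Operators

variable (K : Type*) [Field K] {n : ℕ}

/-- The seminormal basis vector of a sequence of nodes, which is zero by convention unless the
sequence is standard. -/
noncomputable def seqVec (x : Fin (n + 1) → Fin 2 × ℕ × ℕ) : StandardTableau (n + 1) →₀ K :=
  open Classical in if h : IsStandard x then Finsupp.single (ofSeq x h) 1 else 0

variable {K}

theorem seqVec_seq (T : StandardTableau (n + 1)) : seqVec K T.seq = Finsupp.single T 1 := by
  rw [seqVec, dif_pos T.isStandard_seq]
  exact congrArg (Finsupp.single · 1) (seq_ext rfl)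

theorem seqVec_of_not {x : Fin (n + 1) → Fin 2 × ℕ × ℕ} (hx : ¬IsStandard x) : seqVec K x = 0 := by
  rw [seqVec, dif_neg hx]

theorem IsStandard.exists_seq_eq {m : ℕ} {x : Fin m → Fin 2 × ℕ × ℕ} (hx : IsStandard x) :
    ∃ T : StandardTableau m, T.seq = x :=
  ⟨ofSeq x hx, rfl⟩

theorem seqVec_ext {V : Type*} [AddCommGroup V] [Module K V]
    {A B : (StandardTableau (n + 1) →₀ K) →ₗ[K] V}
    (h : ∀ T : StandardTableau (n + 1), A (seqVec K T.seq) = B (seqVec K T.seq)) : A = B :=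
  Finsupp.lhom_ext' fun T => LinearMap.ext_ring (by have := h T; rwa [seqVec_seq] at this)

variable (K)

/-- The operator that is diagonal in the seminormal basis, with entries `f`. -/
noncomputable def diagOp (f : StandardTableau (n + 1) → K) :
    Module.End K (StandardTableau (n + 1) →₀ K) :=
  Finsupp.linearCombination K fun T => f T • seqVec K T.seq

/-- The operator of `s_{i+1}` in the seminormal form. -/
noncomputable def swapOp (i : Fin n) : Module.End K (StandardTableau (n + 1) →₀ K) :=
  Finsupp.linearCombination K fun T =>
    invAxialDist K (T.seq i.castSucc) (T.seq i.succ) • seqVec K T.seq +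
      offDiagCoeff K (T.seq i.castSucc) (T.seq i.succ) •
        seqVec K (T.seq ∘ Equiv.swap i.castSucc i.succ)

variable {K}

theorem diagOp_seqVec (f : StandardTableau (n + 1) → K) (T : StandardTableau (n + 1)) :
    diagOp K f (seqVec K T.seq) = f T • seqVec K T.seq := by
  conv_lhs => rw [seqVec_seq, diagOp, Finsupp.linearCombination_single, one_smul]

theorem diagOp_one : diagOp K (1 : StandardTableau (n + 1) → K) = 1 :=
  seqVec_ext fun T => (diagOp_seqVec _ T).trans (one_smul K _)

theorem diagOp_mul_diagOp (f g : StandardTableau (n + 1) → K) :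
    diagOp K f * diagOp K g = diagOp K (f * g) :=
  seqVec_ext fun T => by
    rw [Module.End.mul_apply, diagOp_seqVec, map_smul, diagOp_seqVec, diagOp_seqVec, smul_smul,
      Pi.mul_apply, mul_comm]

theorem commute_diagOp_diagOp (f g : StandardTableau (n + 1) → K) :
    Commute (diagOp K f) (diagOp K g) := by
  rw [commute_iff_eq, diagOp_mul_diagOp, diagOp_mul_diagOp, mul_comm]

theorem near_of_isStandard_comp_swap {x : Fin (n + 1) → Fin 2 × ℕ × ℕ} {i : Fin n}
    (hx : ¬IsStandard x) (hy : IsStandard (x ∘ Equiv.swap i.castSucc i.succ)) :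
    Near (x i.castSucc) (x i.succ) := by
  by_contra hnear
  refine hx ?_
  obtain ⟨T, hT⟩ := hy.exists_seq_eq
  rw [← comp_swap_comp_swap x i.castSucc i.succ, ← hT]
  refine isStandard_comp_swap ?_
  rwa [hT, Function.comp_apply, Function.comp_apply, Equiv.swap_apply_left, Equiv.swap_apply_right,
    near_comm]

theorem swapOp_seqVec (i : Fin n) (x : Fin (n + 1) → Fin 2 × ℕ × ℕ) :
    swapOp K i (seqVec K x) = invAxialDist K (x i.castSucc) (x i.succ) • seqVec K x +
      offDiagCoeff K (x i.castSucc) (x i.succ) •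
        seqVec K (x ∘ Equiv.swap i.castSucc i.succ) := by
  by_cases hx : IsStandard x
  · obtain ⟨T, rfl⟩ := hx.exists_seq_eq
    conv_lhs => rw [seqVec_seq, swapOp, Finsupp.linearCombination_single, one_smul]
  · rw [seqVec_of_not hx, map_zero, smul_zero, zero_add]
    by_cases hy : IsStandard (x ∘ Equiv.swap i.castSucc i.succ)
    · rw [offDiagCoeff, if_pos (near_of_isStandard_comp_swap hx hy), zero_smul]
    · rw [seqVec_of_not hy, smul_zero]

theorem diagOp_node_seqVec (f : Fin 2 × ℕ × ℕ → K) (a : Fin (n + 1))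
    (x : Fin (n + 1) → Fin 2 × ℕ × ℕ) :
    diagOp K (fun T => f (T.seq a)) (seqVec K x) = f (x a) • seqVec K x := by
  by_cases hx : IsStandard x
  · obtain ⟨T, rfl⟩ := hx.exists_seq_eq
    exact diagOp_seqVec _ T
  · rw [seqVec_of_not hx, map_zero, smul_zero]

theorem swapOp_mul_self (i : Fin n) : swapOp K i * swapOp K i = 1 := by
  refine seqVec_ext fun T => ?_
  rw [Module.End.mul_apply, Module.End.one_apply, swapOp_seqVec, map_add, map_smul, map_smul,
    swapOp_seqVec, swapOp_seqVec, comp_swap_comp_swap, Function.comp_apply, Function.comp_apply,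
    Equiv.swap_apply_left, Equiv.swap_apply_right, invAxialDist_comm (T.seq i.castSucc)]
  have hoff := offDiagCoeff_mul_offDiagCoeff (K := K) (T.seq i.castSucc) (T.seq i.succ)
  match_scalars
  · linear_combination hoff
  · ring

theorem commute_diagOp_swapOp (f : Fin 2 × ℕ × ℕ → K) {a : Fin (n + 1)} {i : Fin n}
    (ha : a ≠ i.castSucc) (ha' : a ≠ i.succ) :
    Commute (diagOp K fun T => f (T.seq a)) (swapOp K i) := by
  refine seqVec_ext fun T => ?_
  simp only [Module.End.mul_apply, diagOp_node_seqVec, swapOp_seqVec, map_add, map_smul,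
    Function.comp_apply, Equiv.swap_apply_of_ne_of_ne ha ha']
  module

theorem swapOp_mul_diagOp_fst (f : Fin 2 → K) (i : Fin n) :
    swapOp K i * diagOp K (fun T => f (T.seq i.succ).1) =
      diagOp K (fun T => f (T.seq i.castSucc).1) * swapOp K i := by
  refine seqVec_ext fun T => ?_
  simp only [Module.End.mul_apply, diagOp_node_seqVec (fun α => f α.1), swapOp_seqVec, map_smul,
    map_add, Function.comp_apply, Equiv.swap_apply_left]
  by_cases h : (T.seq i.castSucc).1 = (T.seq i.succ).1
  · rw [h]; module
  · rw [invAxialDist, if_neg h]; module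

theorem swapOp_mul_diagOp_nodeContent [CharZero K] (i : Fin n) :
    swapOp K i * diagOp K (fun T => (nodeContent (T.seq i.succ) : K)) =
      diagOp K (fun T => (nodeContent (T.seq i.castSucc) : K)) * swapOp K i +
        diagOp K (fun T => if (T.seq i.castSucc).1 = (T.seq i.succ).1 then 1 else 0) := by
  refine seqVec_ext fun T => ?_
  simp only [Module.End.mul_apply, LinearMap.add_apply,
    diagOp_node_seqVec (fun α => (nodeContent α : K)), diagOp_seqVec, swapOp_seqVec, map_smul,
    map_add, Function.comp_apply, Equiv.swap_apply_left]
  by_cases h : (T.seq i.castSucc).1 = (T.seq i.succ).1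
  · have hne : (nodeContent (T.seq i.succ) : K) - nodeContent (T.seq i.castSucc) ≠ 0 :=
      sub_ne_zero.2 (mt Int.cast_inj.1 (T.nodeContent_ne Fin.castSucc_lt_succ (by simp) h).symm)
    rw [invAxialDist, if_pos h, if_pos h]
    push_cast
    match_scalars <;> field_simp
    ring
  · rw [invAxialDist, if_neg h, if_neg h]; module

theorem swapOp_mul_diagOp_fst_mul_swapOp (f : Fin 2 → K) (i : Fin n) :
    swapOp K i * diagOp K (fun T => f (T.seq i.castSucc).1) * swapOp K i =
      diagOp K (fun T => f (T.seq i.succ).1) := by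
  rw [mul_assoc, ← swapOp_mul_diagOp_fst, ← mul_assoc, swapOp_mul_self, one_mul]

theorem commute_swapOp_swapOp {i j : Fin n} (hij : (i : ℕ) + 2 ≤ j) :
    Commute (swapOp K i) (swapOp K j) := by
  have h₁ : i.castSucc ≠ j.castSucc := by simp only [ne_eq, Fin.ext_iff, Fin.val_castSucc]; omega
  have h₂ : i.castSucc ≠ j.succ := by
    simp only [ne_eq, Fin.ext_iff, Fin.val_castSucc, Fin.val_succ]; omega
  have h₃ : i.succ ≠ j.castSucc := by
    simp only [ne_eq, Fin.ext_iff, Fin.val_castSucc, Fin.val_succ]; omega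
  have h₄ : i.succ ≠ j.succ := by simp only [ne_eq, Fin.ext_iff, Fin.val_succ]; omega
  refine seqVec_ext fun T => ?_
  have hcomm : (T.seq ∘ Equiv.swap i.castSucc i.succ) ∘ Equiv.swap j.castSucc j.succ =
      (T.seq ∘ Equiv.swap j.castSucc j.succ) ∘ Equiv.swap i.castSucc i.succ := by
    funext a
    refine congrArg T.seq ?_
    simp only [Equiv.swap_apply_def]
    split_ifs <;> simp_all
  simp only [Module.End.mul_apply, swapOp_seqVec, map_add, map_smul, Function.comp_apply,
    Equiv.swap_apply_of_ne_of_ne h₁ h₂, Equiv.swap_apply_of_ne_of_ne h₃ h₄,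
    Equiv.swap_apply_of_ne_of_ne h₁.symm h₃.symm, Equiv.swap_apply_of_ne_of_ne h₂.symm h₄.symm,
    hcomm]
  module

theorem StandardTableau.invAxialDist_mul_add [CharZero K] (T : StandardTableau (n + 1))
    {i j : Fin n} (hij : (i : ℕ) + 1 = j) :
    invAxialDist K (T.seq i.castSucc) (T.seq j.succ) *
      (invAxialDist K (T.seq i.castSucc) (T.seq i.succ) +
        invAxialDist K (T.seq i.succ) (T.seq j.succ)) =
      invAxialDist K (T.seq i.castSucc) (T.seq i.succ) *
        invAxialDist K (T.seq i.succ) (T.seq j.succ) := by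
  refine FusionB.invAxialDist_mul_add (T.nodeContent_ne ?_ ?_) (T.nodeContent_ne ?_ ?_)
    (T.nodeContent_ne ?_ ?_) <;> simp only [Fin.lt_def, Fin.val_succ, Fin.val_castSucc] <;> omega

theorem swapOp_braid [CharZero K] {i j : Fin n} (hij : (i : ℕ) + 1 = j) :
    swapOp K i * swapOp K j * swapOp K i = swapOp K j * swapOp K i * swapOp K j := by
  refine seqVec_ext fun T => ?_
  have hij' : j.castSucc = i.succ := by rw [Fin.ext_iff, Fin.val_castSucc, Fin.val_succ, hij]
  have hi := swapOp_seqVec (K := K) i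
  have hj := swapOp_seqVec (K := K) j
  have hpq : i.castSucc < i.succ := Fin.castSucc_lt_succ
  have hqr : i.succ < j.succ := hij' ▸ Fin.castSucc_lt_succ
  have hdist := T.invAxialDist_mul_add (K := K) hij
  rw [hij'] at hj
  set p := i.castSucc
  set q := i.succ
  set r := j.succ
  set x := T.seq
  have hswap_p := Equiv.swap_apply_of_ne_of_ne hpq.ne (hpq.trans hqr).ne
  have hswap_r := Equiv.swap_apply_of_ne_of_ne (hpq.trans hqr).ne' hqr.ne'
  refine braid_of_seminormal (y₁ := seqVec K (x ∘ Equiv.swap p q))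
    (y₂ := seqVec K ((x ∘ Equiv.swap p q) ∘ Equiv.swap q r))
    (y₃ := seqVec K (((x ∘ Equiv.swap p q) ∘ Equiv.swap q r) ∘ Equiv.swap p q))
    (z₁ := seqVec K (x ∘ Equiv.swap q r))
    (z₂ := seqVec K ((x ∘ Equiv.swap q r) ∘ Equiv.swap p q))
    (g₁' := offDiagCoeff K (x q) (x p)) (g₂' := offDiagCoeff K (x r) (x q))
    (g₃ := offDiagCoeff K (x p) (x r)) (hi _) ?_ ?_ ?_ (hj _) ?_ ?_ ?_
    (offDiagCoeff_mul_offDiagCoeff _ _) (offDiagCoeff_mul_offDiagCoeff _ _) hdist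
  · rw [hi, comp_swap_comp_swap, ← invAxialDist_comm]; simp
  · rw [hi]; simp [hswap_p, hswap_r]
  · rw [hi]; simp [hswap_p]
  · rw [hj]; simp [hswap_r]
  · rw [hj, comp_swap_comp_swap, ← invAxialDist_comm]; simp
  · rw [hj, comp_swap_braid _ hpq.ne (hpq.trans hqr).ne hqr.ne]; simp [hswap_p, hswap_r]

variable (n) in
/-- The operators of the generators `t, s_1, …, s_n` in the seminormal form, where `t` acts on the
nodes of the diagram `κ` by `τ κ`; indices greater than `n` carry the junk value `1`. -/
noncomputable def genOp (τ : Fin 2 → K) : ℕ → Module.End K (StandardTableau (n + 1) →₀ K)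
  | 0 => diagOp K fun T => τ (T.seq 0).1
  | m + 1 => if h : m < n then swapOp K ⟨m, h⟩ else 1

theorem genOp_of_lt (τ : Fin 2 → K) {m : ℕ} (h : m < n) :
    genOp n τ (m + 1) = swapOp K ⟨m, h⟩ := dif_pos h

theorem genOp_succ (τ : Fin 2 → K) (i : Fin n) : genOp n τ i.succ = swapOp K i :=
  genOp_of_lt τ i.isLt

theorem typeBRelations_genOp [CharZero K] {τ : Fin 2 → K} (hτ : ∀ k, τ k ^ 2 = 1) :
    TypeBRelations n (genOp n τ) where
  mul_self m hm := by
    cases m with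
    | zero =>
      rw [genOp, diagOp_mul_diagOp, ← diagOp_one]
      exact congrArg (diagOp K) (funext fun T => (pow_two _).symm.trans (hτ _))
    | succ m => rw [genOp_of_lt τ hm, swapOp_mul_self]
  comm i j hj hij := by
    obtain ⟨j, rfl⟩ : ∃ l, j = l + 1 := ⟨j - 1, by omega⟩
    rw [genOp_of_lt τ hj]
    cases i with
    | zero =>
      refine commute_diagOp_swapOp (fun α => τ α.1) (Fin.ne_of_lt ?_) (Fin.succ_ne_zero _).symm
      exact Fin.lt_def.2 (show 0 < j by omega)
    | succ i =>
      rw [genOp_of_lt τ (show i < n by omega)]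
      exact commute_swapOp_swapOp (show i + 2 ≤ j by omega)
  braid i hi hin := by
    obtain ⟨i, rfl⟩ : ∃ l, i = l + 1 := ⟨i - 1, by omega⟩
    rw [genOp_of_lt τ (show i < n by omega), genOp_of_lt τ hin]
    exact swapOp_braid rfl
  braid_four hn := by
    have conj : genOp n τ 1 * genOp n τ 0 * genOp n τ 1 =
        diagOp K fun T => τ (T.seq (Fin.succ ⟨0, hn⟩)).1 := by
      rw [genOp_of_lt τ hn, ← swapOp_mul_diagOp_fst_mul_swapOp]
      rfl
    rw [conj, mul_assoc, mul_assoc, ← mul_assoc (genOp n τ 1), conj]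
    exact commute_diagOp_diagOp _ _

end Operators

section Representation

variable {K : Type} [Field K] [CharZero K] {n : ℕ} {τ : Fin 2 → K}

variable (n) in
/-- Young's seminormal form, as a representation of the group. -/
noncomputable def seminormal (hτ : ∀ k, τ k ^ 2 = 1) :
    GroupB n →* Module.End K (StandardTableau (n + 1) →₀ K) :=
  (coxB n).lift ⟨_, (typeBRelations_genOp hτ).isLiftable⟩

theorem seminormal_simple (hτ : ∀ k, τ k ^ 2 = 1) (i : Fin (n + 1)) :
    seminormal n hτ ((coxB n).simple i) = genOp n τ i :=
  (coxB n).lift_apply_simple (typeBRelations_genOp hτ).isLiftable i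

variable (n) in
/-- Young's seminormal form, as a representation of the group algebra. -/
noncomputable def seminormalAlg (hτ : ∀ k, τ k ^ 2 = 1) :
    MonoidAlgebra K (GroupB n) →ₐ[K] Module.End K (StandardTableau (n + 1) →₀ K) :=
  MonoidAlgebra.lift K _ _ (seminormal n hτ)

theorem seminormalAlg_of (hτ : ∀ k, τ k ^ 2 = 1) (g : GroupB n) :
    seminormalAlg n hτ (MonoidAlgebra.of K _ g) = seminormal n hτ g :=
  MonoidAlgebra.lift_of _ _

theorem seminormalAlg_genS (hτ : ∀ k, τ k ^ 2 = 1) (i : Fin n) :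
    seminormalAlg n hτ (genS K i) = swapOp K i := by
  rw [genS, gen, seminormalAlg_of, seminormal_simple, genOp_succ]

theorem seminormalAlg_genT (hτ : ∀ k, τ k ^ 2 = 1) :
    seminormalAlg n hτ (genT K n) = diagOp K fun T => τ (T.seq 0).1 := by
  rw [genT, gen, seminormalAlg_of, seminormal_simple]
  rfl

end Representation

end FusionB

namespace FusionB

open Finset StandardTableau

section HookLengths

variable (μ : YoungDiagram) {i j : ℕ}

/-- The difference of the contents at the ends of the rows `i ≤ m`. For `i < m` these numbers are
the gaps in the set of hook lengths of the row `i`. -/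
def hookGap (i m : ℕ) : ℕ := μ.rowLen i - μ.rowLen m + (m - i)

theorem filter_hook_eq (h : (i, j) ∈ μ) :
    (μ.cells.filter fun β => (β.1 = i ∧ j ≤ β.2) ∨ (β.2 = j ∧ i ≤ β.1)) =
      ({i} ×ˢ Ico j (μ.rowLen i)) ∪ (Ico (i + 1) (μ.colLen j) ×ˢ {j}) := by
  have hj := YoungDiagram.mem_iff_lt_rowLen.1 h
  ext ⟨a, b⟩
  simp only [mem_filter, YoungDiagram.mem_cells, mem_union, mem_product, mem_singleton, mem_Ico]
  constructor
  · rintro ⟨hab, ⟨rfl, hb⟩ | ⟨rfl, ha⟩⟩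
    · exact Or.inl ⟨rfl, hb, YoungDiagram.mem_iff_lt_rowLen.1 hab⟩
    · rcases ha.eq_or_lt with rfl | hlt
      · exact Or.inl ⟨rfl, le_rfl, hj⟩
      · exact Or.inr ⟨⟨hlt, YoungDiagram.mem_iff_lt_colLen.1 hab⟩, rfl⟩
  · rintro (⟨rfl, hb, hab⟩ | ⟨⟨ha, hab⟩, rfl⟩)
    · exact ⟨YoungDiagram.mem_iff_lt_rowLen.2 hab, Or.inl ⟨rfl, hb⟩⟩
    · exact ⟨YoungDiagram.mem_iff_lt_colLen.2 hab, Or.inr ⟨rfl, by omega⟩⟩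

theorem hookLength_add (h : (i, j) ∈ μ) :
    hookLength μ (i, j) + i + j + 1 = μ.rowLen i + μ.colLen j := by
  have hj := YoungDiagram.mem_iff_lt_rowLen.1 h
  have hi := YoungDiagram.mem_iff_lt_colLen.1 h
  have hdisj : Disjoint ({i} ×ˢ Ico j (μ.rowLen i)) (Ico (i + 1) (μ.colLen j) ×ˢ {j}) := by
    rw [disjoint_product]
    exact Or.inl (by simp)
  have hcard : hookLength μ (i, j) = (μ.rowLen i - j) + (μ.colLen j - (i + 1)) := by
    rw [hookLength, filter_hook_eq μ h, card_union_of_disjoint hdisj]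
    simp
  omega

theorem strictAntiOn_hookLength (i : ℕ) :
    StrictAntiOn (fun j => hookLength μ (i, j)) (Set.Iio (μ.rowLen i)) := by
  intro a ha b hb hab
  have hook_a := hookLength_add μ (YoungDiagram.mem_iff_lt_rowLen.2 ha)
  have hook_b := hookLength_add μ (YoungDiagram.mem_iff_lt_rowLen.2 hb)
  have := μ.colLen_anti a b hab.le
  dsimp only
  omega

theorem strictMonoOn_hookGap (i : ℕ) : StrictMonoOn (hookGap μ i) (Set.Ici i) := by
  intro a ha b _ hab
  rw [Set.mem_Ici] at ha
  have := μ.rowLen_anti i a ha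
  have := μ.rowLen_anti a b hab.le
  simp only [hookGap]
  omega

theorem injOn_hookLength (i : ℕ) :
    Set.InjOn (fun j => hookLength μ (i, j)) (range (μ.rowLen i)) := by
  rw [coe_range]
  exact (strictAntiOn_hookLength μ i).injOn

theorem injOn_hookGap (i L : ℕ) : Set.InjOn (hookGap μ i) (Ico (i + 1) L) := by
  rw [coe_Ico]
  exact (strictMonoOn_hookGap μ i).injOn.mono
    (Set.Ico_subset_Ici_self.trans (Set.Ici_subset_Ici.2 i.le_succ))

theorem hookLength_ne_hookGap {m : ℕ} (h : (i, j) ∈ μ) (hm : i ≤ m) :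
    hookLength μ (i, j) ≠ hookGap μ i m := by
  have hook := hookLength_add μ h
  have := YoungDiagram.mem_iff_lt_colLen.1 h
  have hmj : j < μ.rowLen m ↔ m < μ.colLen j := by
    rw [← YoungDiagram.mem_iff_lt_rowLen, ← YoungDiagram.mem_iff_lt_colLen]
  have := μ.rowLen_anti i m hm
  simp only [hookGap]
  omega

theorem disjoint_image_hookLength_image_hookGap (i L : ℕ) :
    Disjoint ((range (μ.rowLen i)).image fun j => hookLength μ (i, j))
      ((Ico (i + 1) L).image (hookGap μ i)) := by
  simp only [disjoint_left, mem_image, mem_range, mem_Ico, not_exists, not_and]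
  rintro _ ⟨j, hj, rfl⟩ m hm
  exact (hookLength_ne_hookGap μ (YoungDiagram.mem_iff_lt_rowLen.2 hj) (by omega)).symm

variable {μ} {L : ℕ}

theorem image_hookLength_union_image_hookGap (hi : i < L) (hL : μ.rowLen L = 0) :
    (range (μ.rowLen i)).image (fun j => hookLength μ (i, j)) ∪
        (Ico (i + 1) L).image (hookGap μ i) =
      Ico 1 (μ.rowLen i + (L - 1 - i) + 1) := by
  refine eq_of_subset_of_card_le (fun c hc => ?_) ?_
  · rw [mem_Ico]
    simp only [mem_union, mem_image, mem_range, mem_Ico] at hc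
    obtain ⟨j, hj, rfl⟩ | ⟨m, hm, rfl⟩ := hc
    · have hij := YoungDiagram.mem_iff_lt_rowLen.2 hj
      have hook := hookLength_add μ hij
      have := YoungDiagram.mem_iff_lt_colLen.1 hij
      have hLj : ¬L < μ.colLen j := by
        rw [← YoungDiagram.mem_iff_lt_colLen, YoungDiagram.mem_iff_lt_rowLen, hL]
        exact Nat.not_lt_zero j
      omega
    · have := μ.rowLen_anti i m (by omega)
      simp only [hookGap]
      omega
  · rw [card_union_of_disjoint (disjoint_image_hookLength_image_hookGap μ i L),
      card_image_of_injOn (injOn_hookLength μ i), card_image_of_injOn (injOn_hookGap μ i L)]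
    simp only [Nat.card_Ico, card_range]
    omega

theorem prod_hookLength_row_mul_prod_hookGap (hi : i < L) (hL : μ.rowLen L = 0) :
    (∏ j ∈ range (μ.rowLen i), hookLength μ (i, j)) * ∏ m ∈ Ico (i + 1) L, hookGap μ i m =
      (μ.rowLen i + (L - 1 - i)).factorial := by
  rw [← prod_Ico_id_eq_factorial, ← image_hookLength_union_image_hookGap hi hL,
    prod_union (disjoint_image_hookLength_image_hookGap μ i L), prod_image (injOn_hookLength μ i),
    prod_image (injOn_hookGap μ i L)]

end HookLengths

section TransitionRatios

/-- The content of the node that can be added to the `i`-th row, for rows of lengths `l`. -/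
def addableContent (l : ℕ → ℕ) (i : ℕ) : ℤ := (l i : ℤ) - i

theorem addableContent_strictAnti {l : ℕ → ℕ} (hl : Antitone l) :
    StrictAnti (addableContent l) := by
  intro i j h
  have := hl h.le
  simp only [addableContent]
  omega

theorem addableContent_update (l : ℕ → ℕ) (a : ℕ) :
    addableContent (Function.update l a (l a + 1)) =
      Function.update (addableContent l) a (addableContent l a + 1) := by
  funext i
  obtain rfl | h := eq_or_ne i a
  · simp only [addableContent, Function.update_self]
    push_cast
    ring
  · simp only [addableContent, Function.update_of_ne h]

theorem cast_hookGap {K : Type*} [Ring K] (μ : YoungDiagram) {i m : ℕ} (h : i ≤ m) :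
    (hookGap μ i m : K) = ((addableContent μ.rowLen i - addableContent μ.rowLen m : ℤ) : K) := by
  rw [← Int.cast_natCast]
  congr 1
  have := μ.rowLen_anti i m h
  simp only [hookGap, addableContent]
  omega

variable (K : Type*) [Field K]

/-- The inverse of the product of the hook lengths, in terms of the row lengths `l`, of which all
but the first `L` are zero. -/
noncomputable def rowHookFactor (L : ℕ) (l : ℕ → ℕ) : K :=
  (∏ i ∈ range L, ∏ m ∈ Ico (i + 1) L, ((addableContent l i : K) - addableContent l m)) /
    ∏ i ∈ range L, ((l i + (L - 1 - i)).factorial : K)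

/-- The ratio of hook factors for the addition of a node to the row `i`. -/
noncomputable def transitionRatio (L : ℕ) (l : ℕ → ℕ) (i : ℕ) : K :=
  (∏ j ∈ range L, ((addableContent l i : K) - addableContent l j + 1)) /
    ∏ j ∈ (range (L + 1)).erase i, ((addableContent l i : K) - addableContent l j)

/-- The rational function with zeros at the contents of the addable nodes and poles at those of the
removable nodes; both are met with cancelling spurious ones. -/
noncomputable def contentFun (L : ℕ) (l : ℕ → ℕ) (u : K) : K :=
  (∏ j ∈ range (L + 1), (u - addableContent l j)) / ∏ j ∈ range L, (u - addableContent l j + 1)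

variable {K}

section Products

variable {M : Type*} [CommMonoid M] {L a : ℕ}

theorem prod_range_erase (ha : a < L) (f : ℕ → M) :
    ∏ j ∈ (range L).erase a, f j = (∏ j ∈ range a, f j) * ∏ j ∈ Ico (a + 1) L, f j := by
  have hdisj : Disjoint (range a) (Ico (a + 1) L) := by
    simp only [disjoint_left, mem_range, mem_Ico]
    omega
  rw [← prod_union hdisj]
  refine prod_congr (Finset.ext fun j => ?_) fun _ _ => rfl
  simp only [mem_erase, mem_range, mem_union, mem_Ico]
  omega

theorem prod_prod_Ico_eq (ha : a < L) (f : ℕ → ℕ → M) :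
    ∏ i ∈ range L, ∏ m ∈ Ico (i + 1) L, f i m =
      (∏ i ∈ (range L).erase a, ∏ m ∈ (Ico (i + 1) L).erase a, f i m) *
        ((∏ i ∈ range a, f i a) * ∏ m ∈ Ico (a + 1) L, f a m) := by
  have below : ∏ i ∈ range a, ∏ m ∈ Ico (i + 1) L, f i m =
      (∏ i ∈ range a, f i a) * ∏ i ∈ range a, ∏ m ∈ (Ico (i + 1) L).erase a, f i m := by
    rw [← prod_mul_distrib]
    exact prod_congr rfl fun i hi =>
      (mul_prod_erase _ _ (mem_Ico.2 ⟨mem_range.1 hi, ha⟩)).symm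
  have above : ∏ i ∈ Ico (a + 1) L, ∏ m ∈ (Ico (i + 1) L).erase a, f i m =
      ∏ i ∈ Ico (a + 1) L, ∏ m ∈ Ico (i + 1) L, f i m :=
    prod_congr rfl fun i hi => by
      rw [erase_eq_of_notMem]
      simp only [mem_Ico] at hi ⊢
      omega
  rw [← mul_prod_erase _ _ (mem_range.2 ha), prod_range_erase ha, prod_range_erase ha, below,
    above]
  ac_rfl

theorem prod_prod_sub_update {R : Type*} [CommRing R] (x : ℕ → R) (c : R) (ha : a < L) :
    (∏ i ∈ range L, ∏ m ∈ Ico (i + 1) L, (Function.update x a c i - Function.update x a c m)) *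
        ∏ j ∈ (range L).erase a, (x a - x j) =
      (∏ i ∈ range L, ∏ m ∈ Ico (i + 1) L, (x i - x m)) *
        ∏ j ∈ (range L).erase a, (c - x j) := by
  have away : ∏ i ∈ (range L).erase a, ∏ m ∈ (Ico (i + 1) L).erase a,
        (Function.update x a c i - Function.update x a c m) =
      ∏ i ∈ (range L).erase a, ∏ m ∈ (Ico (i + 1) L).erase a, (x i - x m) :=
    prod_congr rfl fun i hi => prod_congr rfl fun m hm => by
      rw [Function.update_of_ne (ne_of_mem_erase hi), Function.update_of_ne (ne_of_mem_erase hm)]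
  have below : ∏ i ∈ range a, (Function.update x a c i - c) = ∏ i ∈ range a, (x i - c) :=
    prod_congr rfl fun i hi => by rw [Function.update_of_ne (mem_range.1 hi).ne]
  have above : ∏ m ∈ Ico (a + 1) L, (c - Function.update x a c m) =
      ∏ m ∈ Ico (a + 1) L, (c - x m) := prod_congr rfl fun m hm => by
    rw [Function.update_of_ne (Nat.lt_of_succ_le (mem_Ico.1 hm).1).ne']
  have signs : (∏ i ∈ range a, (x i - c)) * ∏ i ∈ range a, (x a - x i) =
      (∏ i ∈ range a, (x i - x a)) * ∏ i ∈ range a, (c - x i) := by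
    rw [← prod_mul_distrib, ← prod_mul_distrib]
    exact prod_congr rfl fun i _ => by ring
  rw [prod_prod_Ico_eq ha, prod_prod_Ico_eq ha, away, prod_range_erase ha fun j => x a - x j,
    prod_range_erase ha fun j => c - x j, Function.update_self, below, above]
  linear_combination (∏ i ∈ (range L).erase a, ∏ m ∈ (Ico (i + 1) L).erase a, (x i - x m)) *
    (∏ m ∈ Ico (a + 1) L, (c - x m)) * (∏ m ∈ Ico (a + 1) L, (x a - x m)) * signs

end Products

variable {L a : ℕ} {l : ℕ → ℕ}

theorem inv_prod_hookLength [CharZero K] {μ : YoungDiagram} (hL : μ.rowLen L = 0) :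
    (∏ α ∈ μ.cells, (hookLength μ α : K))⁻¹ = rowHookFactor K L μ.rowLen := by
  have mem_cells_iff (p : ℕ × ℕ) : p ∈ μ.cells ↔ p.1 ∈ range L ∧ p.2 ∈ range (μ.rowLen p.1) := by
    rw [YoungDiagram.mem_cells, ← Prod.mk.eta (p := p), YoungDiagram.mem_iff_lt_rowLen, mem_range,
      mem_range]
    refine ⟨fun h => ⟨?_, h⟩, And.right⟩
    by_contra hi
    have := μ.rowLen_anti L p.1 (by omega)
    omega
  have hrow : (∏ α ∈ μ.cells, (hookLength μ α : K)) * ∏ i ∈ range L, ∏ m ∈ Ico (i + 1) L,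
        ((addableContent μ.rowLen i : K) - addableContent μ.rowLen m) =
      ∏ i ∈ range L, ((μ.rowLen i + (L - 1 - i)).factorial : K) := by
    rw [prod_finset_product μ.cells (range L) (fun i => range (μ.rowLen i)) mem_cells_iff,
      ← prod_mul_distrib]
    refine prod_congr rfl fun i hi => ?_
    rw [← prod_hookLength_row_mul_prod_hookGap (mem_range.1 hi) hL]
    push_cast
    refine congrArg _ (prod_congr rfl fun m hm => ?_)
    rw [cast_hookGap μ (Nat.le_of_succ_le (mem_Ico.1 hm).1), Int.cast_sub]
  have hfact : ∏ i ∈ range L, ((μ.rowLen i + (L - 1 - i)).factorial : K) ≠ 0 :=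
    prod_ne_zero_iff.2 fun i _ => Nat.cast_ne_zero.2 (Nat.factorial_ne_zero _)
  rw [rowHookFactor, eq_div_iff hfact, ← hrow,
    inv_mul_cancel_left₀ (left_ne_zero_of_mul (hrow ▸ hfact))]

theorem addableContent_cast_injective [CharZero K] (hl : Antitone l) :
    Function.Injective fun i => (addableContent l i : K) :=
  Int.cast_injective.comp (addableContent_strictAnti hl).injective

theorem prod_factorial_update (ha : a < L) (hL : l L = 0) :
    ∏ i ∈ range L, ((Function.update l a (l a + 1) i + (L - 1 - i)).factorial : K) =
      ((addableContent l a : K) - addableContent l L) *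
        ∏ i ∈ range L, ((l i + (L - 1 - i)).factorial : K) := by
  have hfact : ((l a + 1 + (L - 1 - a)).factorial : K) =
      ((addableContent l a : K) - addableContent l L) * (l a + (L - 1 - a)).factorial := by
    rw [show l a + 1 + (L - 1 - a) = l a + (L - 1 - a) + 1 by ring, Nat.factorial_succ,
      Nat.cast_mul, ← Int.cast_natCast (l a + (L - 1 - a) + 1), ← Int.cast_sub]
    congr 2
    simp only [addableContent]
    omega
  rw [← mul_prod_erase _ _ (mem_range.2 ha), ← mul_prod_erase (range L) (fun i =>
    ((l i + (L - 1 - i)).factorial : K)) (mem_range.2 ha), Function.update_self, hfact, mul_assoc]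
  congr 2
  exact prod_congr rfl fun i hi => by rw [Function.update_of_ne (ne_of_mem_erase hi)]

theorem rowHookFactor_update [CharZero K] (hl : Antitone l) (ha : a < L) (hL : l L = 0) :
    rowHookFactor K L (Function.update l a (l a + 1)) =
      rowHookFactor K L l * transitionRatio K L l a := by
  set x : ℕ → K := fun i => addableContent l i
  have hx : (fun i => (addableContent (Function.update l a (l a + 1)) i : K)) =
      Function.update x a (x a + 1) := by
    rw [addableContent_update]
    funext i
    obtain rfl | h := eq_or_ne i a
    · simp [x]
    · simp [x, h]
  have hsub {j : ℕ} (h : j ≠ a) : x a - x j ≠ 0 :=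
    sub_ne_zero.2 ((addableContent_cast_injective hl).ne h.symm)
  have hnum : ∏ j ∈ range L, (x a - x j + 1) = ∏ j ∈ (range L).erase a, (x a + 1 - x j) := by
    rw [← mul_prod_erase _ _ (mem_range.2 ha), sub_self, zero_add, one_mul]
    exact prod_congr rfl fun j _ => by ring
  have hden : ∏ j ∈ (range (L + 1)).erase a, (x a - x j) =
      (x a - x L) * ∏ j ∈ (range L).erase a, (x a - x j) := by
    rw [range_add_one, erase_insert_of_ne ha.ne', prod_insert (by simp)]
  have hvan := prod_prod_sub_update x (x a + 1) ha
  have hprod : ∏ j ∈ (range L).erase a, (x a - x j) ≠ 0 :=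
    prod_ne_zero_iff.2 fun j hj => hsub (ne_of_mem_erase hj)
  have hfact : ∏ i ∈ range L, ((l i + (L - 1 - i)).factorial : K) ≠ 0 :=
    prod_ne_zero_iff.2 fun i _ => Nat.cast_ne_zero.2 (Nat.factorial_ne_zero _)
  have hL' := hsub ha.ne'
  rw [rowHookFactor, rowHookFactor, transitionRatio, prod_factorial_update ha hL]
  simp only [congrFun hx]
  change _ / ((x a - x L) * _) = _ / _ * ((∏ j ∈ range L, (x a - x j + 1)) /
    ∏ j ∈ (range (L + 1)).erase a, (x a - x j))
  rw [hnum, hden]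
  field_simp
  exact hvan

theorem contentFun_zero (L : ℕ) {u : K} (hu : ∀ z : ℤ, u ≠ z) :
    contentFun K L (fun _ => 0) u = u := by
  have hshift (j : ℕ) : u - (addableContent (fun _ => 0) (j + 1) : ℤ) =
      u - (addableContent (fun _ => 0) j : ℤ) + 1 := by
    simp only [addableContent]
    push_cast
    ring
  have hden : ∏ j ∈ range L, (u - (addableContent (fun _ => 0) j : ℤ) + 1) ≠ 0 :=
    prod_ne_zero_iff.2 fun j _ => by
      rw [← hshift]
      exact sub_ne_zero.2 (hu _)
  rw [contentFun, prod_range_succ', prod_congr rfl fun j _ => hshift j, mul_div_assoc, mul_comm,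
    div_mul_cancel₀ _ hden]
  simp [addableContent]

theorem contentFun_update (ha : a < L) {u : K} (hu : ∀ z : ℤ, u ≠ z) :
    contentFun K L (Function.update l a (l a + 1)) u =
      contentFun K L l u * (1 - (1 / (u - addableContent l a)) ^ 2) := by
  have away {j : ℕ} (h : j ≠ a) : addableContent (Function.update l a (l a + 1)) j =
      addableContent l j := by rw [addableContent_update, Function.update_of_ne h]
  have hne (z : ℤ) : u - z + 1 ≠ 0 := by
    have := sub_ne_zero.2 (hu (z - 1))
    push_cast at this
    rwa [← sub_add] at this
  have hprod : ∏ j ∈ (range L).erase a, (u - addableContent l j + 1) ≠ 0 :=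
    prod_ne_zero_iff.2 fun j _ => hne _
  have ha' : a ∈ range (L + 1) := mem_range.2 (ha.trans L.lt_succ_self)
  rw [contentFun, contentFun, ← mul_prod_erase _ _ ha', ← mul_prod_erase _ _ (mem_range.2 ha),
    ← mul_prod_erase _ (fun j => u - (addableContent l j : K)) ha',
    ← mul_prod_erase _ (fun j => u - (addableContent l j : K) + 1) (mem_range.2 ha),
    prod_congr rfl fun j hj => by rw [away (ne_of_mem_erase hj)],
    prod_congr (s₁ := (range L).erase a) rfl fun j hj => by rw [away (ne_of_mem_erase hj)],
    addableContent_update, Function.update_self]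
  have h := sub_ne_zero.2 (hu (addableContent l a))
  have h' := hne (addableContent l a)
  push_cast
  rw [show u - ((addableContent l a : K) + 1) + 1 = u - addableContent l a by ring]
  field_simp
  ring

theorem sum_transitionRatio [CharZero K] (L : ℕ) (hl : Antitone l) :
    ∑ i ∈ range (L + 1), transitionRatio K L l i = 1 := by
  set P : Polynomial K :=
    ∏ j ∈ range L, (Polynomial.X - Polynomial.C ((addableContent l j : K) - 1)) with hP
  have hmonic : P.Monic := Polynomial.monic_prod_X_sub_C _ _
  have hdeg : P.degree = L := by
    simp only [hP, Polynomial.degree_prod, Polynomial.degree_X_sub_C]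
    simp
  have h := Lagrange.leadingCoeff_eq_sum (P := P) (addableContent_cast_injective (K := K) hl).injOn
    (s := range (L + 1)) (by rw [hdeg, card_range]; rfl)
  rw [hmonic.leadingCoeff] at h
  rw [h]
  refine sum_congr rfl fun i _ => ?_
  rw [transitionRatio, hP, Polynomial.eval_prod]
  refine congrArg (· / _) (prod_congr rfl fun j _ => ?_)
  rw [Polynomial.eval_sub, Polynomial.eval_X, Polynomial.eval_C]
  ring

theorem sum_transitionRatio_mul_inv [CharZero K] (hl : Antitone l) (ha : a < L)
    (hlt : l (a + 1) < l a) :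
    ∑ i ∈ range (L + 1), transitionRatio K L l i *
      ((addableContent l i - (addableContent l a - 1) : ℤ) : K)⁻¹ = 0 := by
  set P : Polynomial K :=
    ∏ j ∈ (range L).erase a, (Polynomial.X - Polynomial.C ((addableContent l j : K) - 1)) with hP
  have hdeg : P.degree = (L - 1 : ℕ) := by
    simp only [hP, Polynomial.degree_prod, Polynomial.degree_X_sub_C]
    simp [ha]
  have h := Lagrange.coeff_eq_sum (P := P) (addableContent_cast_injective (K := K) hl).injOn
    (s := range (L + 1)) (by rw [hdeg, card_range]; norm_cast; omega)
  rw [Polynomial.coeff_eq_zero_of_degree_lt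
    (by rw [hdeg, card_range]; norm_cast; omega)] at h
  rw [h]
  refine sum_congr rfl fun i _ => ?_
  have hne : addableContent l i - (addableContent l a - 1) ≠ 0 := by
    rcases lt_trichotomy i a with h | rfl | h
    · have := addableContent_strictAnti hl h
      omega
    · omega
    · have := hl (show a + 1 ≤ i from h)
      simp only [addableContent]
      omega
  have hnum : ∏ j ∈ range L, ((addableContent l i : K) - addableContent l j + 1) =
      ((addableContent l i - (addableContent l a - 1) : ℤ) : K) *
        P.eval (addableContent l i : K) := by
    rw [← mul_prod_erase _ _ (mem_range.2 ha), hP, Polynomial.eval_prod]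
    push_cast
    refine congrArg₂ (· * ·) (by ring) (prod_congr rfl fun j _ => ?_)
    rw [Polynomial.eval_sub, Polynomial.eval_X, Polynomial.eval_C]
    ring
  rw [transitionRatio, hnum]
  have := (Int.cast_ne_zero (α := K)).2 hne
  field_simp

end TransitionRatios

section HookWeights

variable (K : Type*) [Field K]

/-- The inverse of the product of the hook lengths of a 2-tableau, in any field. -/
noncomputable def hookWeight {m : ℕ} (T : StandardTableau m) : K :=
  ∏ κ : Fin 2, (∏ α ∈ (T.shape κ).cells, (hookLength (T.shape κ) α : K))⁻¹

/-- The hook weight of the 2-tableau formed by the numbers less than `k`, computed with `L` rows in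
both diagrams. -/
noncomputable def partialHookWeight {m : ℕ} (L : ℕ) (T : StandardTableau m) (k : ℕ) : K :=
  ∏ κ : Fin 2, rowHookFactor K L (T.rows k κ)

variable {K} {m L : ℕ}

theorem transitionRatio_eq_zero {l : ℕ → ℕ} (hl : Antitone l) {i j : ℕ} (hi : i ≤ L) (hj : j < i)
    (h : l j ≤ l i) : transitionRatio K L l i = 0 := by
  have hij : l (i - 1) ≤ l i := (hl (Nat.le_sub_one_of_lt hj)).trans h
  have hli : l i ≤ l (i - 1) := hl (Nat.sub_le i 1)
  have hfactor : addableContent l i - addableContent l (i - 1) + 1 = 0 := by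
    simp only [addableContent]
    omega
  rw [transitionRatio, prod_eq_zero (mem_range.2 (show i - 1 < L by omega)) (by
    exact_mod_cast congrArg (Int.cast (R := K)) hfactor), zero_div]

theorem sum_hookWeight_mul (F : StandardTableau (m + 1) → K) (G : StandardTableau m → K) :
    ∑ S : StandardTableau (m + 1), hookWeight K S * (F S * G S.restrict) =
      ∑ U : StandardTableau m,
        (∑ S : StandardTableau (m + 1) with S.restrict = U, hookWeight K S * F S) * G U := by
  rw [← sum_fiberwise (s := univ) (g := fun S : StandardTableau (m + 1) => S.restrict)]
  refine sum_congr rfl fun U _ => ?_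
  rw [sum_mul]
  refine sum_congr rfl fun S hS => ?_
  rw [(mem_filter_univ S).1 hS, mul_assoc]

theorem rows_succ_eq_update (T : StandardTableau m) (a : Fin m) :
    T.rows (a + 1) (T.seq a).1 = Function.update (T.rows a (T.seq a).1) (T.seq a).2.1
      (T.rows a (T.seq a).1 (T.seq a).2.1 + 1) := by
  funext i
  rw [rows_succ, Function.update_apply]
  by_cases h : i = (T.seq a).2.1
  · rw [if_pos ⟨rfl, h.symm⟩, if_pos h, h]
  · rw [if_neg fun h' => h h'.2.symm, if_neg h, add_zero]

theorem rows_succ_of_ne (T : StandardTableau m) (a : Fin m) {κ : Fin 2} (h : (T.seq a).1 ≠ κ) :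
    T.rows (a + 1) κ = T.rows a κ := by
  funext i
  rw [rows_succ, if_neg fun h' => h h'.1, add_zero]

variable [CharZero K]

theorem hookWeight_eq_partialHookWeight (h : m ≤ L) (T : StandardTableau m) :
    hookWeight K T = partialHookWeight K L T m :=
  prod_congr rfl fun κ _ => by
    rw [show T.rows m κ = (T.shape κ).rowLen from funext fun i => T.rows_eq_rowLen κ i]
    exact inv_prod_hookLength (by rw [← T.rows_eq_rowLen, T.rows_eq_zero _ _ h])

theorem partialHookWeight_succ (h : m ≤ L) (T : StandardTableau m) (a : Fin m) :
    partialHookWeight K L T (a + 1) = partialHookWeight K L T a *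
      transitionRatio K L (T.rows a (T.seq a).1) (T.seq a).2.1 := by
  have hother : ∏ κ ∈ univ.erase (T.seq a).1, rowHookFactor K L (T.rows (a + 1) κ) =
      ∏ κ ∈ univ.erase (T.seq a).1, rowHookFactor K L (T.rows a κ) :=
    prod_congr rfl fun κ hκ => by rw [rows_succ_of_ne T a (ne_of_mem_erase hκ).symm]
  rw [partialHookWeight, partialHookWeight, ← mul_prod_erase univ _ (mem_univ (T.seq a).1),
    ← mul_prod_erase univ (fun κ => rowHookFactor K L (T.rows a κ)) (mem_univ (T.seq a).1),
    rows_succ_eq_update, rowHookFactor_update (T.rows_antitone _ _)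
      ((T.row_le a).trans_lt (a.2.trans_le h)) (T.rows_eq_zero _ _ h), hother]
  ring

theorem partialHookWeight_zero (T : StandardTableau m) : partialHookWeight K L T 0 = 1 := by
  refine prod_eq_one fun κ _ => ?_
  have hbot (i : ℕ) : (⊥ : YoungDiagram).rowLen i = 0 := by
    by_contra h
    exact YoungDiagram.notMem_bot (i, 0)
      (YoungDiagram.mem_iff_lt_rowLen.2 (Nat.pos_of_ne_zero h))
  rw [rows_zero, ← funext hbot, ← inv_prod_hookLength (hbot L)]
  simp

theorem hookWeight_eq_restrict (S : StandardTableau (m + 1)) :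
    hookWeight K S = hookWeight K S.restrict * transitionRatio K (m + 1)
      (S.restrict.rows m (S.seq (Fin.last m)).1) (S.seq (Fin.last m)).2.1 := by
  have hrows (κ : Fin 2) : S.restrict.rows m κ = S.rows m κ := funext fun i => S.rows_restrict κ i
  rw [hookWeight_eq_partialHookWeight (Nat.le_succ m) S.restrict,
    hookWeight_eq_partialHookWeight le_rfl S]
  simp only [partialHookWeight, hrows]
  exact partialHookWeight_succ le_rfl S (Fin.last m)

theorem seq_last_eq_of_restrict_eq {S : StandardTableau (m + 1)} {U : StandardTableau m}
    (h : S.restrict = U) : S.seq (Fin.last m) = ((S.seq (Fin.last m)).1, (S.seq (Fin.last m)).2.1,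
      U.rows m (S.seq (Fin.last m)).1 (S.seq (Fin.last m)).2.1) := by
  subst h
  refine Prod.ext rfl (Prod.ext rfl ?_)
  rw [rows_restrict]
  exact S.col_eq_rows (Fin.last m)

theorem sum_hookWeight_restrict (U : StandardTableau m) (F : Fin 2 × ℕ × ℕ → K) :
    ∑ S : StandardTableau (m + 1) with S.restrict = U, hookWeight K S * F (S.seq (Fin.last m)) =
      hookWeight K U * ∑ κ : Fin 2, ∑ i ∈ range (m + 1 + 1),
        transitionRatio K (m + 1) (U.rows m κ) i * F (κ, i, U.rows m κ i) := by
  let R (p : Fin 2 × ℕ) : K :=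
    transitionRatio K (m + 1) (U.rows m p.1) p.2 * F (p.1, p.2, U.rows m p.1 p.2)
  let row (S : StandardTableau (m + 1)) : Fin 2 × ℕ :=
    ((S.seq (Fin.last m)).1, (S.seq (Fin.last m)).2.1)
  have row_injOn :
      Set.InjOn row (univ.filter fun S : StandardTableau (m + 1) => S.restrict = U) := by
    intro S hS S' hS' h
    rw [coe_filter_univ, Set.mem_ofPred_eq] at hS hS'
    refine eq_of_restrict_eq (hS.trans hS'.symm) ?_
    rw [seq_last_eq_of_restrict_eq hS, seq_last_eq_of_restrict_eq hS']
    exact congrArg (fun p => (p.1, p.2, U.rows m p.1 p.2)) h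
  have hterm : ∑ S : StandardTableau (m + 1) with S.restrict = U,
        hookWeight K S * F (S.seq (Fin.last m)) =
      ∑ S : StandardTableau (m + 1) with S.restrict = U, hookWeight K U * R (row S) :=
    sum_congr rfl fun S hS => by
      have hSU := (mem_filter_univ S).1 hS
      rw [hookWeight_eq_restrict S, hSU, mul_assoc]
      exact congrArg (fun x => _ * (_ * F x)) (seq_last_eq_of_restrict_eq hSU)
  rw [hterm, ← mul_sum, ← sum_image (f := R) row_injOn, ← sum_product univ (range (m + 1 + 1)) R]
  refine congrArg _ (sum_subset (fun p hp => ?_) ?_)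
  · obtain ⟨S, -, rfl⟩ := mem_image.1 hp
    exact mem_product.2
      ⟨mem_univ _, mem_range.2 ((S.row_le (Fin.last m)).trans_lt (by simp))⟩
  · rintro ⟨κ, i⟩ hp hnot
    have hi : i ≤ m + 1 := Nat.lt_succ_iff.1 (mem_range.1 (mem_product.1 hp).2)
    obtain ⟨j, hj, hle⟩ : ∃ j < i, U.rows m κ j ≤ U.rows m κ i := by
      by_contra! haddable
      obtain ⟨S, hS, hlast⟩ := U.exists_restrict_eq κ i haddable
      refine hnot (mem_image.2 ⟨S, (mem_filter_univ S).2 hS, ?_⟩)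
      simp only [row, hlast]
    exact mul_eq_zero_of_left (transitionRatio_eq_zero (U.rows_antitone _ _) hi hj hle) _

theorem sum_hookWeight_restrict_one (U : StandardTableau m) :
    ∑ S : StandardTableau (m + 1) with S.restrict = U, hookWeight K S * (1 : K) =
      hookWeight K U * 2 := by
  rw [sum_hookWeight_restrict U fun _ => 1]
  simp only [mul_one, sum_transitionRatio (m + 1) (U.rows_antitone m _)]
  simp

theorem sum_hookWeight_restrict_fst (U : StandardTableau m) {τ : Fin 2 → K} (hτ : τ 0 + τ 1 = 0) :
    ∑ S : StandardTableau (m + 1) with S.restrict = U,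
      hookWeight K S * τ (S.seq (Fin.last m)).1 = 0 := by
  rw [sum_hookWeight_restrict U fun α => τ α.1]
  simp only [← sum_mul, sum_transitionRatio (m + 1) (U.rows_antitone m _), one_mul]
  simp [hτ]

theorem sum_hookWeight_restrict_invAxialDist (U : StandardTableau (m + 1)) :
    ∑ S : StandardTableau (m + 1 + 1) with S.restrict = U,
      hookWeight K S * invAxialDist K (U.seq (Fin.last m)) (S.seq (Fin.last (m + 1))) = 0 := by
  rw [sum_hookWeight_restrict U fun β => invAxialDist K (U.seq (Fin.last m)) β]
  set α := U.seq (Fin.last m)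
  have hupdate := rows_succ_eq_update U (Fin.last m)
  have hcol : α.2.2 = U.rows m α.1 α.2.1 := U.col_eq_rows (Fin.last m)
  have hrow : α.2.1 ≤ m := U.row_le (Fin.last m)
  rw [Fin.val_last] at hupdate
  have hrowLen : U.rows (m + 1) α.1 α.2.1 = α.2.2 + 1 := by
    rw [hupdate, Function.update_self, hcol]
  have hlt : U.rows (m + 1) α.1 (α.2.1 + 1) < U.rows (m + 1) α.1 α.2.1 := by
    rw [hrowLen, hupdate, Function.update_of_ne (Nat.succ_ne_self _), hcol]
    exact Nat.lt_succ_of_le (U.rows_antitone m α.1 (Nat.le_succ α.2.1))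
  rw [sum_eq_single_of_mem α.1 (mem_univ _)]
  · refine mul_eq_zero_of_right _ (Eq.trans (sum_congr rfl fun i _ => ?_)
      (sum_transitionRatio_mul_inv (K := K) (L := m + 1 + 1) (U.rows_antitone (m + 1) α.1)
        (a := α.2.1) (by omega) hlt))
    rw [invAxialDist, if_pos rfl]
    congr 3
    simp only [nodeContent, addableContent, hrowLen]
    push_cast
    ring
  · exact fun κ _ hκ => sum_eq_zero fun i _ => by rw [invAxialDist, if_neg hκ.symm, mul_zero]

end HookWeights

section Inclusion

variable {n : ℕ}

/-- The inclusion of `B_{n+1}` into `B_{n+2}`. -/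
noncomputable def inclB (n : ℕ) : GroupB n →* GroupB (n + 1) :=
  (coxB n).lift ⟨_, ((typeBRelations_simpleB (n + 1)).mono n.le_succ).isLiftable⟩

theorem inclB_simple (i : Fin (n + 1)) :
    inclB n ((coxB n).simple i) = (coxB (n + 1)).simple i.castSucc :=
  ((coxB n).lift_apply_simple _ i).trans (simpleB_of_lt (i.is_lt.trans n.succ.lt_succ_self))

theorem exists_inclB_eq {g : GroupB (n + 1)} (hg : g ∈ parabolic (simpleB (n + 1)) (n + 1)) :
    ∃ h, inclB n h = g := by
  have hle : parabolic (simpleB (n + 1)) (n + 1) ≤ MonoidHom.mrange (inclB n) := by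
    rw [parabolic, Submonoid.closure_le]
    rintro _ ⟨m, hm : m < n + 1, rfl⟩
    refine ⟨(coxB n).simple ⟨m, hm⟩, ?_⟩
    rw [inclB_simple, simpleB_of_lt (hm.trans n.succ.lt_succ_self)]
    rfl
  exact hle hg

end Inclusion

section RemoveLast

variable {K : Type*} [Field K] {n : ℕ}

theorem seqVec_apply (x : Fin (n + 1) → Fin 2 × ℕ × ℕ) (S : StandardTableau (n + 1)) :
    seqVec K x S = if S.seq = x then 1 else 0 := by
  by_cases hx : IsStandard x
  · obtain ⟨T, rfl⟩ := hx.exists_seq_eq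
    rw [seqVec_seq, Finsupp.single_apply]
    exact if_congr ⟨fun h => h ▸ rfl, fun h => (seq_ext h).symm⟩ rfl rfl
  · rw [seqVec_of_not hx, if_neg, Finsupp.zero_apply]
    rintro rfl
    exact hx S.isStandard_seq

/-- The operator that removes the largest number of a tableau if that number stands at the node `α`,
and kills the tableau otherwise. -/
noncomputable def removeLast (K : Type*) [Field K] (α : Fin 2 × ℕ × ℕ) :
    (StandardTableau (n + 2) →₀ K) →ₗ[K] (StandardTableau (n + 1) →₀ K) :=
  Finsupp.linearCombination K fun T =>
    if T.seq (Fin.last (n + 1)) = α then seqVec K T.restrict.seq else 0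

theorem removeLast_seqVec (α : Fin 2 × ℕ × ℕ) (T : StandardTableau (n + 2)) :
    removeLast K α (seqVec K T.seq) =
      if T.seq (Fin.last (n + 1)) = α then seqVec K T.restrict.seq else 0 := by
  rw [seqVec_seq, removeLast, Finsupp.linearCombination_single, one_smul]

theorem removeLast_apply_restrict (S : StandardTableau (n + 2)) (v : StandardTableau (n + 2) →₀ K) :
    removeLast K (S.seq (Fin.last (n + 1))) v S.restrict = v S := by
  suffices Finsupp.lapply S.restrict ∘ₗ removeLast K (S.seq (Fin.last (n + 1))) =
      (Finsupp.lapply S : (StandardTableau (n + 2) →₀ K) →ₗ[K] K) from LinearMap.congr_fun this v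
  refine seqVec_ext fun T => ?_
  simp only [LinearMap.comp_apply, Finsupp.lapply_apply, removeLast_seqVec, seqVec_apply]
  by_cases hT : T = S
  · simp only [hT, if_true, seqVec_apply]
  · have hST : S.seq ≠ T.seq := fun h => hT (seq_ext h.symm)
    rw [if_neg hST]
    split_ifs with hl
    · rw [seqVec_apply, if_neg fun h => hT (eq_of_restrict_eq (seq_ext h).symm hl)]
    · rfl

theorem removeLast_swapOp (α : Fin 2 × ℕ × ℕ) (i : Fin n) (v : StandardTableau (n + 2) →₀ K) :
    removeLast K α (swapOp K i.castSucc v) = swapOp K i (removeLast K α v) := by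
  suffices removeLast K α ∘ₗ swapOp K i.castSucc = swapOp K i ∘ₗ removeLast K α from
    LinearMap.congr_fun this v
  refine seqVec_ext fun T => ?_
  have hfst : T.seq i.castSucc.castSucc = T.restrict.seq i.castSucc := by rw [seq_restrict]
  have hsnd : T.seq i.castSucc.succ = T.restrict.seq i.succ := by
    rw [seq_restrict, Fin.castSucc_succ]
  rw [LinearMap.comp_apply, LinearMap.comp_apply, removeLast_seqVec, swapOp_seqVec, map_add,
    map_smul, map_smul, removeLast_seqVec]
  by_cases hnear : Near (T.seq i.castSucc.castSucc) (T.seq i.castSucc.succ)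
  · rw [offDiagCoeff, if_pos hnear, zero_smul, add_zero, apply_ite (swapOp K i), map_zero,
      swapOp_seqVec, offDiagCoeff, ← hfst, ← hsnd, if_pos hnear, zero_smul, add_zero, smul_ite,
      smul_zero]
  · obtain ⟨S, hS⟩ := exists_isSwap_iff.2 hnear
    rw [isSwap_iff] at hS
    have hlast : S.seq (Fin.last (n + 1)) = T.seq (Fin.last (n + 1)) := by
      rw [hS, Function.comp_apply, Equiv.swap_apply_of_ne_of_ne] <;>
        simp only [Ne, Fin.ext_iff, Fin.val_last, Fin.val_castSucc, Fin.val_succ] <;> omega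
    have hrestrict : S.restrict.seq = T.restrict.seq ∘ Equiv.swap i.castSucc i.succ := by
      funext a
      rw [seq_restrict, hS, Function.comp_apply, Function.comp_apply, seq_restrict,
        ← Fin.castSucc_succ, Fin.castSucc_injective _ |>.map_swap]
    rw [← hS, removeLast_seqVec, hlast, hfst, hsnd, apply_ite (swapOp K i), map_zero,
      swapOp_seqVec, hrestrict]
    split_ifs <;> simp only [smul_zero, add_zero]

theorem removeLast_diagOp (f : Fin 2 × ℕ × ℕ → K) (α : Fin 2 × ℕ × ℕ) (a : Fin (n + 1))
    (v : StandardTableau (n + 2) →₀ K) :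
    removeLast K α (diagOp K (fun T => f (T.seq a.castSucc)) v) =
      diagOp K (fun T => f (T.seq a)) (removeLast K α v) := by
  suffices removeLast K α ∘ₗ diagOp K (fun T => f (T.seq a.castSucc)) =
      diagOp K (fun T => f (T.seq a)) ∘ₗ removeLast K α from LinearMap.congr_fun this v
  refine seqVec_ext fun T => ?_
  rw [LinearMap.comp_apply, LinearMap.comp_apply, diagOp_seqVec, map_smul, removeLast_seqVec,
    apply_ite (diagOp K _), map_zero, diagOp_seqVec, seq_restrict, smul_ite, smul_zero]

end RemoveLast

section Restriction

variable {K : Type} [Field K] [CharZero K] {n : ℕ} {τ : Fin 2 → K} (hτ : ∀ k, τ k ^ 2 = 1)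

theorem removeLast_seminormal (α : Fin 2 × ℕ × ℕ) (h : GroupB n)
    (v : StandardTableau (n + 2) →₀ K) :
    removeLast K α (seminormal (n + 1) hτ (inclB n h) v) =
      seminormal n hτ h (removeLast K α v) := by
  induction h using (coxB n).simple_induction_left generalizing v with
  | one => simp only [map_one, Module.End.one_apply]
  | mul_simple_left h i ih =>
    rw [map_mul, map_mul, map_mul, inclB_simple, seminormal_simple, seminormal_simple,
      Module.End.mul_apply, Module.End.mul_apply, ← ih]
    cases i using Fin.cases with
    | zero => exact removeLast_diagOp (fun α => τ α.1) α 0 _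
    | succ i =>
      rw [genOp_succ, Fin.castSucc_succ, genOp_succ]
      exact removeLast_swapOp α i _

theorem seminormal_inclB_apply_self (h : GroupB n) (S : StandardTableau (n + 2)) :
    seminormal (n + 1) hτ (inclB n h) (seqVec K S.seq) S =
      seminormal n hτ h (seqVec K S.restrict.seq) S.restrict := by
  rw [← removeLast_apply_restrict, removeLast_seminormal, removeLast_seqVec, if_pos rfl]

theorem seminormal_inclB_apply_of_ne (h : GroupB n) {S R : StandardTableau (n + 2)}
    (hl : S.seq (Fin.last (n + 1)) ≠ R.seq (Fin.last (n + 1))) :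
    seminormal (n + 1) hτ (inclB n h) (seqVec K S.seq) R = 0 := by
  rw [← removeLast_apply_restrict, removeLast_seminormal, removeLast_seqVec, if_neg hl, map_zero,
    Finsupp.zero_apply]

end Restriction

section WeightedTrace

variable (K : Type) [Field K] {n : ℕ}

/-- The trace on the seminormal representations in which a tableau counts with the inverse of the
product of the hook lengths of its shape. By the hook length formula this is the trace of the
regular representation, up to a scalar. -/
noncomputable def weightedTrace (n : ℕ) : Module.End K (StandardTableau (n + 1) →₀ K) →ₗ[K] K :=
  LinearMap.trace K _ ∘ₗ LinearMap.mulRight K (diagOp K (hookWeight K))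

variable {K}

theorem weightedTrace_apply (A : Module.End K (StandardTableau (n + 1) →₀ K)) :
    weightedTrace K n A = ∑ S, hookWeight K S * A (seqVec K S.seq) S := by
  rw [weightedTrace, LinearMap.comp_apply, LinearMap.mulRight_apply,
    LinearMap.trace_eq_matrix_trace K (Finsupp.basisSingleOne (ι := StandardTableau (n + 1)))]
  refine sum_congr rfl fun S _ => ?_
  rw [Matrix.diag_apply, LinearMap.toMatrix_apply]
  change ((A * diagOp K (hookWeight K) : Module.End K (StandardTableau (n + 1) →₀ K))
    (Finsupp.single S 1) : StandardTableau (n + 1) →₀ K) S = _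
  rw [← seqVec_seq, Module.End.mul_apply, diagOp_seqVec, map_smul, Finsupp.smul_apply, smul_eq_mul]

theorem weightedTrace_mul_comm {A B : Module.End K (StandardTableau (n + 1) →₀ K)}
    (hB : Commute B (diagOp K (hookWeight K))) :
    weightedTrace K n (A * B) = weightedTrace K n (B * A) := by
  simp only [weightedTrace, LinearMap.comp_apply, LinearMap.mulRight_apply]
  rw [mul_assoc, hB.eq, ← mul_assoc, LinearMap.trace_mul_comm, mul_assoc]

theorem mul_apply_seqVec_self (A B : Module.End K (StandardTableau (n + 1) →₀ K))
    (S : StandardTableau (n + 1)) :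
    (A * B) (seqVec K S.seq) S = ∑ R, B (seqVec K S.seq) R * A (seqVec K R.seq) S := by
  rw [Module.End.mul_apply]
  conv_lhs => rw [← Finsupp.univ_sum_single (B (seqVec K S.seq))]
  rw [map_sum, Finsupp.finsetSum_apply]
  refine sum_congr rfl fun R _ => ?_
  rw [seqVec_seq R, ← smul_eq_mul, ← Finsupp.smul_apply, ← map_smul, Finsupp.smul_single_one]

theorem hookWeight_eq_of_isSwap {i : Fin n} {T S : StandardTableau (n + 1)} (h : T.IsSwap i S) :
    hookWeight K S = hookWeight K T := by
  have hshape : S.shape = T.shape := by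
    funext κ
    refine YoungDiagram.ext (Finset.ext fun c => ?_)
    rw [YoungDiagram.mem_cells, YoungDiagram.mem_cells, mem_shape_iff, mem_shape_iff,
      isSwap_iff.1 h]
    exact (Equiv.swap i.castSucc i.succ).exists_congr_left.trans
      (by simp only [Function.comp_apply, Equiv.apply_symm_apply])
  rw [hookWeight, hookWeight, hshape]

theorem commute_swapOp_hookWeight (i : Fin n) :
    Commute (swapOp K i) (diagOp K (hookWeight K)) := by
  refine seqVec_ext fun T => ?_
  rw [Module.End.mul_apply, Module.End.mul_apply, diagOp_seqVec, map_smul, swapOp_seqVec, map_add,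
    map_smul, map_smul, diagOp_seqVec]
  by_cases hnear : Near (T.seq i.castSucc) (T.seq i.succ)
  · rw [offDiagCoeff, if_pos hnear, zero_smul, zero_smul, add_zero, add_zero, smul_comm]
  · obtain ⟨S, hS⟩ := exists_isSwap_iff.2 hnear
    rw [← isSwap_iff.1 hS, diagOp_seqVec, hookWeight_eq_of_isSwap hS]
    module

theorem swapOp_last_seqVec_apply {R S : StandardTableau (n + 2)}
    (h : R.seq (Fin.last (n + 1)) = S.seq (Fin.last (n + 1))) :
    swapOp K (Fin.last n) (seqVec K R.seq) S =
      if S = R then invAxialDist K (S.restrict.seq (Fin.last n)) (S.seq (Fin.last (n + 1)))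
      else 0 := by
  have hne : S.seq ≠ R.seq ∘ Equiv.swap (Fin.last n).castSucc (Fin.last n).succ := by
    intro he
    have hlast := congrFun he (Fin.last n).succ
    rw [Function.comp_apply, Equiv.swap_apply_right, Fin.succ_last, ← h] at hlast
    exact (Fin.castSucc_lt_last _).ne' (R.seq_injective hlast)
  rw [swapOp_seqVec, Finsupp.add_apply, Finsupp.smul_apply, Finsupp.smul_apply, seqVec_apply,
    seqVec_apply, if_neg hne, smul_zero, add_zero, smul_eq_mul, mul_ite, mul_one, mul_zero]
  by_cases hSR : S = R
  · rw [if_pos hSR, if_pos (congrArg seq hSR), hSR, seq_restrict, Fin.succ_last]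
  · rw [if_neg hSR, if_neg fun he => hSR (seq_ext he)]

variable [CharZero K]

theorem sum_hookWeight (m : ℕ) : ∑ S : StandardTableau m, hookWeight K S = 2 ^ m := by
  induction m with
  | zero =>
    have hone (U : StandardTableau 0) : hookWeight K U = 1 := by
      rw [hookWeight_eq_partialHookWeight le_rfl, partialHookWeight_zero]
    have : Unique (StandardTableau 0) :=
      { default := ofSeq Fin.elim0 ⟨fun a => a.elim0, fun {a} => a.elim0⟩
        uniq := fun U => seq_ext (funext fun a => a.elim0) }
    rw [Fintype.sum_unique, hone, pow_zero]
  | succ m ih =>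
    calc ∑ S : StandardTableau (m + 1), hookWeight K S
        = ∑ U, ∑ S with S.restrict = U, hookWeight K S := (sum_fiberwise univ restrict _).symm
      _ = ∑ U : StandardTableau m, hookWeight K U * 2 := sum_congr rfl fun U _ => by
          simpa only [mul_one] using sum_hookWeight_restrict_one (K := K) U
      _ = 2 ^ (m + 1) := by rw [← sum_mul, ih, pow_succ]

theorem weightedTrace_one (n : ℕ) : weightedTrace K n 1 = 2 ^ (n + 1) := by
  rw [weightedTrace_apply, ← sum_hookWeight]
  refine sum_congr rfl fun S _ => ?_
  rw [Module.End.one_apply, seqVec_apply, if_pos rfl, mul_one]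

theorem weightedTrace_diagOp_fst_last {τ : Fin 2 → K} (hτ : τ 0 + τ 1 = 0) :
    weightedTrace K n (diagOp K fun T => τ (T.seq (Fin.last n)).1) = 0 := by
  have h := sum_hookWeight_mul (K := K) (fun S => τ (S.seq (Fin.last n)).1) fun _ => 1
  simp only [sum_hookWeight_restrict_fst _ hτ, sum_const_zero, mul_one] at h
  rw [weightedTrace_apply, ← h]
  refine sum_congr rfl fun S _ => ?_
  rw [diagOp_seqVec, Finsupp.smul_apply, seqVec_apply, if_pos rfl, smul_eq_mul, mul_one]

variable {τ : Fin 2 → K} (hτ : ∀ k, τ k ^ 2 = 1)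

theorem commute_seminormal_hookWeight (g : GroupB n) :
    Commute (seminormal n hτ g) (diagOp K (hookWeight K)) := by
  induction g using (coxB n).simple_induction_left with
  | one => rw [map_one]; exact Commute.one_left _
  | mul_simple_left g i ih =>
    rw [map_mul, seminormal_simple]
    refine Commute.mul_left ?_ ih
    cases i using Fin.cases with
    | zero => exact commute_diagOp_diagOp _ _
    | succ i =>
      rw [genOp_succ]
      exact commute_swapOp_hookWeight i

theorem seminormal_simpleB {m : ℕ} (hm : m < n + 1) :
    seminormal n hτ (simpleB n m) = genOp n τ m := by
  rw [simpleB_of_lt hm, seminormal_simple]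

theorem seminormal_signChange (k : Fin (n + 1)) :
    seminormal n hτ (signChange (simpleB n) k) = diagOp K fun T => τ (T.seq k).1 := by
  induction k using Fin.induction with
  | zero => exact seminormal_simpleB hτ n.succ_pos
  | succ i ih =>
    rw [Fin.val_castSucc] at ih
    rw [Fin.val_succ, signChange, map_mul, map_mul, ih,
      seminormal_simpleB hτ (Nat.succ_lt_succ i.is_lt), genOp_of_lt τ i.is_lt]
    exact swapOp_mul_diagOp_fst_mul_swapOp τ i

theorem weightedTrace_inclB (h : GroupB n) :
    weightedTrace K (n + 1) (seminormal (n + 1) hτ (inclB n h)) =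
      2 * weightedTrace K n (seminormal n hτ h) := by
  have hsum := sum_hookWeight_mul (K := K) (fun _ => 1) fun U : StandardTableau (n + 1) =>
    seminormal n hτ h (seqVec K U.seq) U
  simp only [one_mul, sum_hookWeight_restrict_one] at hsum
  simp only [weightedTrace_apply, seminormal_inclB_apply_self, hsum, mul_sum]
  exact sum_congr rfl fun U _ => by ring

theorem weightedTrace_inclB_mul_signChange (hτ₀ : τ 0 + τ 1 = 0) (h : GroupB n) :
    weightedTrace K (n + 1) (seminormal (n + 1) hτ
      (inclB n h * signChange (simpleB (n + 1)) (n + 1))) = 0 := by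
  have hs := seminormal_signChange hτ (Fin.last (n + 1))
  rw [Fin.val_last] at hs
  have hsum := sum_hookWeight_mul (K := K) (fun S => τ (S.seq (Fin.last (n + 1))).1)
    fun U : StandardTableau (n + 1) => seminormal n hτ h (seqVec K U.seq) U
  simp only [sum_hookWeight_restrict_fst _ hτ₀, zero_mul, sum_const_zero] at hsum
  rw [map_mul, hs, weightedTrace_apply, ← hsum]
  refine sum_congr rfl fun S _ => ?_
  rw [Module.End.mul_apply, diagOp_seqVec, map_smul, Finsupp.smul_apply,
    seminormal_inclB_apply_self, smul_eq_mul]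

theorem swapOp_last_mul_inclB_apply_self (h : GroupB n) (S : StandardTableau (n + 2)) :
    (swapOp K (Fin.last n) * seminormal (n + 1) hτ (inclB n h)) (seqVec K S.seq) S =
      invAxialDist K (S.restrict.seq (Fin.last n)) (S.seq (Fin.last (n + 1))) *
        seminormal n hτ h (seqVec K S.restrict.seq) S.restrict := by
  rw [mul_apply_seqVec_self, Fintype.sum_eq_single S]
  · rw [swapOp_last_seqVec_apply rfl, if_pos rfl, seminormal_inclB_apply_self, mul_comm]
  · intro R hRS
    by_cases hl : S.seq (Fin.last (n + 1)) = R.seq (Fin.last (n + 1))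
    · rw [swapOp_last_seqVec_apply hl.symm, if_neg hRS.symm, mul_zero]
    · rw [seminormal_inclB_apply_of_ne hτ h hl, zero_mul]

theorem weightedTrace_simpleB_mul_inclB (h : GroupB n) :
    weightedTrace K (n + 1)
      (seminormal (n + 1) hτ (simpleB (n + 1) (n + 1) * inclB n h)) = 0 := by
  have hs : seminormal (n + 1) hτ (simpleB (n + 1) (n + 1)) = swapOp K (Fin.last n) :=
    (seminormal_simpleB hτ (n + 1).lt_succ_self).trans (genOp_of_lt τ n.lt_succ_self)
  rw [map_mul, hs, weightedTrace_apply]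
  simp only [swapOp_last_mul_inclB_apply_self]
  rw [sum_hookWeight_mul (fun S => invAxialDist K (S.restrict.seq (Fin.last n))
    (S.seq (Fin.last (n + 1)))) fun U => seminormal n hτ h (seqVec K U.seq) U]
  refine sum_eq_zero fun U _ => ?_
  refine mul_eq_zero_of_left (Eq.trans (sum_congr rfl fun S hS => ?_)
    (sum_hookWeight_restrict_invAxialDist (K := K) U)) _
  rw [(mem_filter_univ S).1 hS]

theorem weightedTrace_seminormal (hτ₀ : τ 0 + τ 1 = 0) {g : GroupB n} (hg : g ≠ 1) :
    weightedTrace K n (seminormal n hτ g) = 0 := by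
  have hform : DoubleCosetForm (simpleB n) n g :=
    .of_mem_parabolic (typeBRelations_simpleB n) le_rfl
      (parabolic_simpleB_eq_top n ▸ Submonoid.mem_top g)
  induction n with
  | zero =>
    rcases hform with ha | ⟨hk, -, -⟩ | ha
    · rw [parabolic_zero, Submonoid.mem_bot] at ha
      exact absurd ha hg
    · exact absurd hk Nat.one_pos.not_ge
    · rw [parabolic_zero, Submonoid.mem_bot] at ha
      rw [ha, one_mul]
      exact (congrArg _ (seminormal_signChange hτ (Fin.last 0))).trans
        (weightedTrace_diagOp_fst_last hτ₀)
  | succ n ih =>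
    rcases hform with ha | ⟨-, ha, hb⟩ | ha
    · obtain ⟨h, rfl⟩ := exists_inclB_eq ha
      have hh : h ≠ 1 := by
        rintro rfl
        exact hg (map_one _)
      rw [weightedTrace_inclB, ih hh, mul_zero]
      exact .of_mem_parabolic (typeBRelations_simpleB n) le_rfl
        (parabolic_simpleB_eq_top n ▸ Submonoid.mem_top h)
    · obtain ⟨a, rfl⟩ := exists_inclB_eq ha
      obtain ⟨b, rfl⟩ := exists_inclB_eq hb
      rw [mul_assoc, map_mul, ← weightedTrace_mul_comm (commute_seminormal_hookWeight hτ _),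
        ← map_mul, mul_assoc, ← map_mul (inclB n)]
      exact weightedTrace_simpleB_mul_inclB hτ _
    · obtain ⟨a, rfl⟩ := exists_inclB_eq ha
      exact weightedTrace_inclB_mul_signChange hτ hτ₀ a

theorem weightedTrace_inv_mul_seminormalAlg (hτ₀ : τ 0 + τ 1 = 0)
    (x : MonoidAlgebra K (GroupB n)) (g : GroupB n) :
    weightedTrace K n (seminormal n hτ g⁻¹ * seminormalAlg n hτ x) =
      x.coeff g * 2 ^ (n + 1) := by
  classical
  have hterm (h : GroupB n) : weightedTrace K n (seminormal n hτ g⁻¹ *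
      x.coeff h • seminormal n hτ h) = if h = g then x.coeff g * 2 ^ (n + 1) else 0 := by
    rw [mul_smul_comm, map_smul, ← map_mul, smul_eq_mul]
    split_ifs with hgh
    · rw [hgh, inv_mul_cancel, map_one, weightedTrace_one]
    · rw [weightedTrace_seminormal hτ hτ₀ fun h' => hgh (inv_mul_eq_one.1 h').symm, mul_zero]
  rw [seminormalAlg, MonoidAlgebra.lift_apply, Finsupp.sum, mul_sum, map_sum]
  simp only [hterm, sum_ite_eq', Finsupp.mem_support_iff, ne_eq, ite_not, ite_eq_right_iff]
  intro hx
  rw [hx, zero_mul]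

theorem seminormalAlg_injective (hτ₀ : τ 0 + τ 1 = 0) :
    Function.Injective (seminormalAlg n hτ) := by
  rw [injective_iff_map_eq_zero]
  intro x hx
  ext g
  have h := weightedTrace_inv_mul_seminormalAlg hτ hτ₀ x g
  rw [hx, mul_zero, map_zero] at h
  exact (mul_eq_zero.1 h.symm).resolve_right (pow_ne_zero _ two_ne_zero)

end WeightedTrace

section Fusion

variable {K : Type} [Field K] {n : ℕ}

theorem nodeContent_seq_zero (S : StandardTableau (n + 1)) : nodeContent (S.seq 0) = 0 := by
  have hrow := S.row_le 0
  have hcol := S.col_le 0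
  rw [Fin.val_zero, Nat.le_zero] at hrow hcol
  rw [nodeContent, hrow, hcol, sub_self]

theorem StandardTableau.nodeContent_seq {m : ℕ} (T : StandardTableau m) (a : Fin m) :
    nodeContent (T.seq a) = addableContent (T.rows a (T.seq a).1) (T.seq a).2.1 := by
  rw [addableContent, ← T.col_eq_rows]
  rfl

theorem contentFun_rows_succ (T : StandardTableau (n + 1)) (i : Fin n) (κ : Fin 2) {u : K}
    (hu : ∀ z : ℤ, u ≠ z) :
    contentFun K (n + 1) (T.rows i.succ κ) u = contentFun K (n + 1) (T.rows i.castSucc κ) u *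
      if (T.seq i.castSucc).1 = κ then 1 - (1 / (u - nodeContent (T.seq i.castSucc))) ^ 2
      else 1 := by
  have hrows : T.rows i.succ κ = T.rows ((i.castSucc : Fin (n + 1)) + 1) κ := rfl
  rw [hrows]
  split_ifs with hκ
  · subst hκ
    rw [rows_succ_eq_update, contentFun_update ((T.row_le _).trans_lt (Fin.is_lt _)) hu,
      T.nodeContent_seq i.castSucc]
  · rw [rows_succ_of_ne T _ hκ, mul_one]

theorem apply_swapOp_seqVec [CharZero K] {X : Module.End K (StandardTableau (n + 1) →₀ K)}
    {i : Fin n} {κ : Fin 2} {c u : K} (hu : ∀ z : ℤ, u ≠ z) (S : StandardTableau (n + 1))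
    (hX : ∀ x, (∀ a < i.castSucc, x a = S.seq a) → X (seqVec K x) =
      (if (x i.castSucc).1 = κ then c / (u - nodeContent (x i.castSucc)) else 0) • seqVec K x) :
    X (swapOp K i (seqVec K S.seq)) =
      (if (S.seq i.succ).1 = κ then c / (u - nodeContent (S.seq i.succ)) else 0) •
        (swapOp K i (seqVec K S.seq) -
          (if (S.seq i.castSucc).1 = κ then 1 / (u - nodeContent (S.seq i.castSucc)) else 0) •
            seqVec K S.seq) := by
  have hswap := hX (S.seq ∘ Equiv.swap i.castSucc i.succ) fun a ha => by
    rw [Function.comp_apply, Equiv.swap_apply_of_ne_of_ne ha.ne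
      (ha.trans Fin.castSucc_lt_succ).ne]
  rw [Function.comp_apply, Equiv.swap_apply_left] at hswap
  rw [swapOp_seqVec, map_add, map_smul, map_smul, hX _ fun _ _ => rfl, hswap]
  by_cases h : (S.seq i.castSucc).1 = (S.seq i.succ).1
  · have hα := sub_ne_zero.2 (hu (nodeContent (S.seq i.castSucc)))
    have hβ := sub_ne_zero.2 (hu (nodeContent (S.seq i.succ)))
    have hne : (nodeContent (S.seq i.succ) : K) - nodeContent (S.seq i.castSucc) ≠ 0 :=
      sub_ne_zero.2 (mt Int.cast_inj.1 (S.nodeContent_ne Fin.castSucc_lt_succ (by simp) h).symm)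
    rw [invAxialDist, if_pos h, h]
    push_cast
    split_ifs
    · match_scalars <;> field_simp
      ring
    · module
  · rw [invAxialDist, if_neg h]
    by_cases hκ : (S.seq i.succ).1 = κ
    · have hα : (S.seq i.castSucc).1 ≠ κ := fun hα => h (hα.trans hκ.symm)
      simp only [if_neg hα]
      module
    · rw [if_neg hκ]
      module

theorem mul_eq_ite_of_sq_eq_one {R ι : Type*} [CommRing R] [IsDomain R] [DecidableEq ι] {ξ : ι → R}
    (hξ : ∀ k, ξ k ^ 2 = 1) (hξ' : Function.Injective ξ) (k l : ι) :
    ξ k * ξ l = if k = l then 1 else -1 := by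
  split_ifs with h
  · rw [h, ← pow_two, hξ]
  · have hneg : ξ k = -ξ l :=
      (sq_eq_sq_iff_eq_or_eq_neg.1 ((hξ k).trans (hξ l).symm)).resolve_left (hξ'.ne h)
    rw [hneg, neg_mul, ← pow_two, hξ]

variable [CharZero K] [Algebra ℂ K] {ξ : Fin 2 → ℂ}

theorem algebraMap_sq_eq_one (K : Type) [Field K] [Algebra ℂ K] (hξ : ∀ k, ξ k ^ 2 = 1)
    (k : Fin 2) : algebraMap ℂ K (ξ k) ^ 2 = 1 := by
  rw [← map_pow, hξ, map_one]

/-- The seminormal form with the parameters `ξ`, over an extension field of the complex numbers. -/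
noncomputable abbrev seminormalExt (K : Type) [Field K] [CharZero K] [Algebra ℂ K] (n : ℕ)
    (hξ : ∀ k, ξ k ^ 2 = 1) :
    MonoidAlgebra K (GroupB n) →ₐ[K] Module.End K (StandardTableau (n + 1) →₀ K) :=
  seminormalAlg n (algebraMap_sq_eq_one K hξ)

theorem seminormalExt_injective (hξ : ∀ k, ξ k ^ 2 = 1) (hξ' : Function.Injective ξ) :
    Function.Injective (seminormalExt K n hξ) := by
  have hneg : ξ 0 = -ξ 1 :=
    (sq_eq_sq_iff_eq_or_eq_neg.1 ((hξ 0).trans (hξ 1).symm)).resolve_left (hξ'.ne (by decide))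
  exact seminormalAlg_injective _ (by rw [← map_add, hneg, neg_add_cancel, map_zero])

theorem seminormalExt_baxtT (hξ : ∀ k, ξ k ^ 2 = 1) (hξ' : Function.Injective ξ) (κ : Fin 2) :
    seminormalExt K n hξ (baxtT K n (ξ κ)) =
      diagOp K fun S => if (S.seq 0).1 = κ then 1 else 0 := by
  rw [baxtT, map_smul, map_add, map_one, map_smul, seminormalAlg_genT]
  refine seqVec_ext fun S => ?_
  rw [diagOp_seqVec, LinearMap.smul_apply, LinearMap.add_apply, LinearMap.smul_apply,
    Module.End.one_apply, diagOp_seqVec, smul_smul, ← map_mul, mul_eq_ite_of_sq_eq_one hξ hξ' κ]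
  by_cases h : (S.seq 0).1 = κ
  · rw [if_pos h, if_pos h.symm, map_one]
    module
  · rw [if_neg h, if_neg (Ne.symm h), map_neg, map_one]
    module

theorem seminormalExt_baxtS (hξ : ∀ k, ξ k ^ 2 = 1) (hξ' : Function.Injective ξ) (i : Fin n)
    (κ κ' : Fin 2) (a a' : K) (w : StandardTableau (n + 1) →₀ K) :
    seminormalExt K n hξ (baxtS i (ξ κ) (ξ κ') a a') w =
      swapOp K i w + (if κ = κ' then 1 / (a - a') else 0) • w := by
  rw [baxtS, map_add, seminormalAlg_genS, AlgHom.commutes, LinearMap.add_apply,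
    Module.algebraMap_end_apply]
  simp only [hξ'.eq_iff]

theorem seminormalExt_phi_seqVec (hξ : ∀ k, ξ k ^ 2 = 1) (hξ' : Function.Injective ξ)
    (T : StandardTableau (n + 1)) (u : Fin (n + 1) → K) (κ : Fin 2) {u' : K}
    (hu' : ∀ z : ℤ, u' ≠ z) (r : Fin (n + 1)) (hu : ∀ a < r, u a = nodeContent (T.seq a))
    (x : Fin (n + 1) → Fin 2 × ℕ × ℕ) (hx : ∀ a < r, x a = T.seq a) :
    seminormalExt K n hξ (phi (T.pos ξ) u (ξ κ) u' r) (seqVec K x) =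
      (if (x r).1 = κ then contentFun K (n + 1) (T.rows r κ) u' / (u' - nodeContent (x r)) else 0) •
        seqVec K x := by
  by_cases hstd : IsStandard x
  swap
  · rw [seqVec_of_not hstd, map_zero, smul_zero]
  obtain ⟨S, rfl⟩ := hstd.exists_seq_eq
  induction r using Fin.induction generalizing S with
  | zero =>
    have hphi : phi (T.pos ξ) u (ξ κ) u' 0 = baxtT K n (ξ κ) := rfl
    have hu₀ : u' ≠ 0 := by simpa using hu' 0
    rw [hphi, seminormalExt_baxtT hξ hξ', diagOp_seqVec, Fin.val_zero, rows_zero,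
      contentFun_zero _ hu', nodeContent_seq_zero, Int.cast_zero, sub_zero, div_self hu₀]
  | succ i ih =>
    have hphi : phi (T.pos ξ) u (ξ κ) u' i.succ =
        baxtS i (ξ κ) (ξ (T.seq i.castSucc).1) u' (u i.castSucc) *
          phi (T.pos ξ) u (ξ κ) u' i.castSucc * genS K i := rfl
    have hlast : S.seq i.castSucc = T.seq i.castSucc := hx _ Fin.castSucc_lt_succ
    have happly := apply_swapOp_seqVec (X := seminormalExt K n hξ (phi (T.pos ξ) u (ξ κ) u'
      i.castSucc)) (κ := κ) (c := contentFun K (n + 1) (T.rows i.castSucc κ) u') hu' S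
      fun x hxS => by
        by_cases hstd : IsStandard x
        · obtain ⟨R, rfl⟩ := hstd.exists_seq_eq
          exact ih (fun a ha => hu a (ha.trans Fin.castSucc_lt_succ)) R (fun a ha =>
            (hxS a ha).trans (hx a (ha.trans Fin.castSucc_lt_succ))) hstd
        · rw [seqVec_of_not hstd, map_zero, smul_zero]
    have hinvol : swapOp K i (swapOp K i (seqVec K S.seq)) = seqVec K S.seq :=
      LinearMap.congr_fun (swapOp_mul_self i) _
    rw [hphi, map_mul, map_mul, Module.End.mul_apply, Module.End.mul_apply, seminormalAlg_genS,
      happly, map_smul, seminormalExt_baxtS hξ hξ', map_sub, map_smul, hinvol, hlast,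
      hu _ Fin.castSucc_lt_succ, contentFun_rows_succ T i κ hu']
    simp only [eq_comm (a := κ)]
    split_ifs <;> module

end Fusion

section ExtensionOfScalars

variable {n : ℕ} {ξ : Fin 2 → ℂ} (K : Type) [Field K] [Algebra ℂ K]

/-- Extension of scalars of the group algebra. -/
noncomputable abbrev baseChange (n : ℕ) :
    MonoidAlgebra ℂ (GroupB n) →+* MonoidAlgebra K (GroupB n) :=
  MonoidAlgebra.mapRingHom (GroupB n) (algebraMap ℂ K)

theorem baseChange_of (g : GroupB n) :
    baseChange K n (MonoidAlgebra.of ℂ _ g) = MonoidAlgebra.of K _ g := by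
  simp [baseChange, MonoidAlgebra.of_apply]

theorem baseChange_smul (c : ℂ) (x : MonoidAlgebra ℂ (GroupB n)) :
    baseChange K n (c • x) = algebraMap ℂ K c • baseChange K n x := by
  ext g
  simp [baseChange, Algebra.smul_def]

/-- Extension of scalars of the seminormal space. -/
noncomputable def extendScalars (n : ℕ) :
    (StandardTableau (n + 1) →₀ ℂ) →ₗ[ℂ] (StandardTableau (n + 1) →₀ K) :=
  Finsupp.mapRange.linearMap (Algebra.linearMap ℂ K)

theorem extendScalars_smul (c : ℂ) (v : StandardTableau (n + 1) →₀ ℂ) :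
    extendScalars K n (c • v) = algebraMap ℂ K c • extendScalars K n v := by
  rw [map_smul, algebraMap_smul]

theorem extendScalars_seqVec (x : Fin (n + 1) → Fin 2 × ℕ × ℕ) :
    extendScalars K n (seqVec ℂ x) = seqVec K x := by
  by_cases hx : IsStandard x
  · obtain ⟨T, rfl⟩ := hx.exists_seq_eq
    simp [extendScalars, seqVec_seq]
  · rw [seqVec_of_not hx, seqVec_of_not hx, map_zero]

end ExtensionOfScalars

section Diagonal

variable (K : Type) [Field K] {n : ℕ}

/-- The algebra of diagonal operators, as the image of the algebra of functions on tableaux. -/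
noncomputable def diagAlg (n : ℕ) :
    (StandardTableau (n + 1) → K) →ₐ[K] Module.End K (StandardTableau (n + 1) →₀ K) :=
  AlgHom.ofLinearMap
    { toFun := diagOp K
      map_add' := fun f g => seqVec_ext fun T => by
        simp only [LinearMap.add_apply, diagOp_seqVec, Pi.add_apply, add_smul]
      map_smul' := fun c f => seqVec_ext fun T => by
        simp only [LinearMap.smul_apply, diagOp_seqVec, Pi.smul_apply, smul_eq_mul, mul_smul,
          RingHom.id_apply] }
    diagOp_one fun f g => (diagOp_mul_diagOp f g).symm

variable {K}

theorem diagAlg_apply (f : StandardTableau (n + 1) → K) : diagAlg K n f = diagOp K f := rfl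

theorem diagOp_single_apply (T : StandardTableau (n + 1)) (v : StandardTableau (n + 1) →₀ K) :
    diagOp K (Pi.single T 1) v = v T • seqVec K T.seq := by
  induction v using Finsupp.induction_linear with
  | zero => simp
  | add v w hv hw => rw [map_add, hv, hw, Finsupp.add_apply, add_smul]
  | single S c =>
    rw [← Finsupp.smul_single_one, ← seqVec_seq, map_smul, diagOp_seqVec, Finsupp.smul_apply,
      seqVec_seq, Finsupp.single_apply, Pi.single_apply]
    split_ifs with h
    · rw [h, one_smul, smul_eq_mul, mul_one, seqVec_seq]
    · rw [zero_smul, smul_zero, smul_zero, zero_smul]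

theorem diagOp_single_mul_mul_diagOp_single (A : Module.End K (StandardTableau (n + 1) →₀ K))
    (T : StandardTableau (n + 1)) :
    diagOp K (Pi.single T 1) * A * diagOp K (Pi.single T 1) =
      A (seqVec K T.seq) T • diagOp K (Pi.single T 1) := by
  refine LinearMap.ext fun v => ?_
  rw [Module.End.mul_apply, Module.End.mul_apply, LinearMap.smul_apply, diagOp_single_apply T v,
    map_smul, map_smul, diagOp_single_apply, smul_comm]

theorem pi_single_mem_of_separates {F ι : Type*} [Field F] [Finite ι] [DecidableEq ι]
    (B : Subalgebra F (ι → F)) (T : ι) (hsep : ∀ S ≠ T, ∃ f ∈ B, f T ≠ f S) :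
    (Pi.single T 1 : ι → F) ∈ B := by
  have := Fintype.ofFinite ι
  choose! f hf hne using hsep
  have hprod : (Pi.single T 1 : ι → F) =
      ∏ S ∈ univ.erase T, (f S T - f S S)⁻¹ • (f S - algebraMap F _ (f S S)) := by
    funext R
    rw [Finset.prod_apply, Pi.single_apply]
    split_ifs with hR
    · subst hR
      exact (prod_eq_one fun S hS =>
        inv_mul_cancel₀ (sub_ne_zero.2 (hne S (ne_of_mem_erase hS)))).symm
    · rw [prod_eq_zero (mem_erase.2 ⟨hR, mem_univ R⟩)]
      simp
  rw [hprod]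
  exact prod_mem fun S hS => B.smul_mem
    (sub_mem (hf S (ne_of_mem_erase hS)) (B.algebraMap_mem _)) _

end Diagonal

section TableauIdempotents

variable {n : ℕ} {ξ : Fin 2 → ℂ}

theorem swapOp_extendScalars (K : Type) [Field K] [Algebra ℂ K] (i : Fin n)
    (v : StandardTableau (n + 1) →₀ ℂ) :
    swapOp K i (extendScalars K n v) = extendScalars K n (swapOp ℂ i v) := by
  have hcomp : (swapOp K i).restrictScalars ℂ ∘ₗ extendScalars K n =
      extendScalars K n ∘ₗ swapOp ℂ i := seqVec_ext fun S => by
    simp only [LinearMap.comp_apply, LinearMap.restrictScalars_apply, extendScalars_seqVec,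
      swapOp_seqVec, map_add, extendScalars_smul, invAxialDist, offDiagCoeff,
      apply_ite (algebraMap ℂ K), map_zero, map_one, map_inv₀, map_intCast]
  exact LinearMap.congr_fun hcomp v

theorem diagOp_extendScalars (K : Type) [Field K] [Algebra ℂ K] (f : StandardTableau (n + 1) → ℂ)
    (v : StandardTableau (n + 1) →₀ ℂ) :
    diagOp K (fun S => algebraMap ℂ K (f S)) (extendScalars K n v) =
      extendScalars K n (diagOp ℂ f v) := by
  have hcomp : (diagOp K fun S => algebraMap ℂ K (f S)).restrictScalars ℂ ∘ₗ extendScalars K n =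
      extendScalars K n ∘ₗ diagOp ℂ f := seqVec_ext fun S => by
    simp only [LinearMap.comp_apply, LinearMap.restrictScalars_apply, extendScalars_seqVec,
      diagOp_seqVec, extendScalars_smul]
  exact LinearMap.congr_fun hcomp v

theorem seminormal_extendScalars (K : Type) [Field K] [CharZero K] [Algebra ℂ K]
    (hξ : ∀ k, ξ k ^ 2 = 1) (g : GroupB n) (v : StandardTableau (n + 1) →₀ ℂ) :
    seminormal n (algebraMap_sq_eq_one K hξ) g (extendScalars K n v) =
      extendScalars K n (seminormal n (algebraMap_sq_eq_one ℂ hξ) g v) := by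
  induction g using (coxB n).simple_induction generalizing v with
  | simple i =>
    rw [seminormal_simple, seminormal_simple]
    cases i using Fin.cases with
    | zero => exact diagOp_extendScalars K _ v
    | succ i => rw [genOp_succ, genOp_succ, swapOp_extendScalars]
  | one => rw [map_one, map_one, Module.End.one_apply, Module.End.one_apply]
  | mul g h hg hh =>
    rw [map_mul, map_mul, Module.End.mul_apply, Module.End.mul_apply, hh, hg]

theorem seminormalExt_baseChange_extendScalars (K : Type) [Field K] [CharZero K] [Algebra ℂ K]
    (hξ : ∀ k, ξ k ^ 2 = 1) (x : MonoidAlgebra ℂ (GroupB n)) (v : StandardTableau (n + 1) →₀ ℂ) :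
    seminormalExt K n hξ (baseChange K n x) (extendScalars K n v) =
      extendScalars K n (seminormalExt ℂ n hξ x v) := by
  induction x using MonoidAlgebra.induction_on with
  | of g => rw [baseChange_of, seminormalAlg_of, seminormalAlg_of, seminormal_extendScalars K hξ]
  | add x y hx hy =>
    rw [map_add, map_add, map_add, LinearMap.add_apply, LinearMap.add_apply, map_add, hx, hy]
  | smul c x hx =>
    rw [baseChange_smul, map_smul, map_smul, LinearMap.smul_apply, LinearMap.smul_apply, hx,
      extendScalars_smul]

theorem seminormalExt_baseChange_of_eq_diagOp (K : Type) [Field K] [CharZero K] [Algebra ℂ K]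
    (hξ : ∀ k, ξ k ^ 2 = 1) {x : MonoidAlgebra ℂ (GroupB n)} {f : StandardTableau (n + 1) → ℂ}
    (h : seminormalExt ℂ n hξ x = diagOp ℂ f) :
    seminormalExt K n hξ (baseChange K n x) = diagOp K fun S => algebraMap ℂ K (f S) := by
  refine seqVec_ext fun S => ?_
  rw [← extendScalars_seqVec K, seminormalExt_baseChange_extendScalars, h, diagOp_seqVec,
    extendScalars_smul, extendScalars_seqVec, diagOp_seqVec]

/-- The algebra of the functions on tableaux by which elements of the group algebra act as diagonal
operators. -/
noncomputable def diagonalSubalgebra (n : ℕ) (hξ : ∀ k, ξ k ^ 2 = 1) :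
    Subalgebra ℂ (StandardTableau (n + 1) → ℂ) :=
  (seminormalExt ℂ n hξ).range.comap (diagAlg ℂ n)

theorem mem_diagonalSubalgebra (hξ : ∀ k, ξ k ^ 2 = 1) {f : StandardTableau (n + 1) → ℂ} :
    f ∈ diagonalSubalgebra n hξ ↔ ∃ x, seminormalExt ℂ n hξ x = diagOp ℂ f :=
  Iff.rfl

theorem pos_mem_diagonalSubalgebra (hξ : ∀ k, ξ k ^ 2 = 1) (a : Fin (n + 1)) :
    (fun S => ξ (S.seq a).1) ∈ diagonalSubalgebra n hξ :=
  ⟨MonoidAlgebra.of ℂ _ (signChange (simpleB n) a),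
    (seminormalAlg_of _ _).trans (seminormal_signChange _ a)⟩

theorem ite_fst_eq_mem_diagonalSubalgebra (hξ : ∀ k, ξ k ^ 2 = 1) (hξ' : Function.Injective ξ)
    (a b : Fin (n + 1)) :
    (fun S => if (S.seq a).1 = (S.seq b).1 then 1 else 0) ∈ diagonalSubalgebra n hξ := by
  have hhalf : (fun S : StandardTableau (n + 1) => if (S.seq a).1 = (S.seq b).1 then (1 : ℂ) else 0)
      = (1 / 2 : ℂ) • (1 + (fun S => ξ (S.seq a).1) * fun S => ξ (S.seq b).1) := by
    funext S
    simp only [Pi.smul_apply, Pi.add_apply, Pi.one_apply, Pi.mul_apply,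
      mul_eq_ite_of_sq_eq_one hξ hξ']
    split_ifs <;> norm_num
  rw [hhalf]
  exact Subalgebra.smul_mem _ (add_mem (one_mem _) (mul_mem (pos_mem_diagonalSubalgebra hξ a)
    (pos_mem_diagonalSubalgebra hξ b))) _

-- The element acting by the contents of `i + 1` arises from that of `i` as in the recursion
-- `J_{i+1} = s_i J_i s_i + s_i` for Jucys-Murphy elements.
theorem nodeContent_mem_diagonalSubalgebra (hξ : ∀ k, ξ k ^ 2 = 1) (hξ' : Function.Injective ξ)
    (a : Fin (n + 1)) : (fun S => (nodeContent (S.seq a) : ℂ)) ∈ diagonalSubalgebra n hξ := by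
  induction a using Fin.induction with
  | zero =>
    simp only [nodeContent_seq_zero, Int.cast_zero]
    exact zero_mem _
  | succ i ih =>
    obtain ⟨x, hx⟩ := (mem_diagonalSubalgebra hξ).1 ih
    obtain ⟨y, hy⟩ := (mem_diagonalSubalgebra hξ).1
      (ite_fst_eq_mem_diagonalSubalgebra hξ hξ' i.castSucc i.succ)
    refine (mem_diagonalSubalgebra hξ).2 ⟨genS ℂ i * (x * genS ℂ i + y), ?_⟩
    rw [map_mul, map_add, map_mul, hx, hy, seminormalAlg_genS, ← swapOp_mul_diagOp_nodeContent,
      ← mul_assoc, swapOp_mul_self, one_mul]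

theorem single_mem_diagonalSubalgebra (hξ : ∀ k, ξ k ^ 2 = 1) (hξ' : Function.Injective ξ)
    (T : StandardTableau (n + 1)) :
    (Pi.single T 1 : StandardTableau (n + 1) → ℂ) ∈ diagonalSubalgebra n hξ := by
  refine pi_single_mem_of_separates _ T fun S hS => ?_
  contrapose! hS
  refine seq_ext (funext fun a => (seq_eq_of_nodeContent_eq (T := T) (S := S) (k := n + 1)
    (fun a _ => ⟨?_, ?_⟩) a.2).symm)
  · exact hξ' (hS _ (pos_mem_diagonalSubalgebra hξ a))
  · exact Int.cast_injective (hS _ (nodeContent_mem_diagonalSubalgebra hξ hξ' a))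

/-- The element of the group algebra that acts as the diagonal matrix unit of `T`. -/
noncomputable def tableauIdem (hξ : ∀ k, ξ k ^ 2 = 1) (hξ' : Function.Injective ξ)
    (T : StandardTableau (n + 1)) : MonoidAlgebra ℂ (GroupB n) :=
  ((mem_diagonalSubalgebra hξ).1 (single_mem_diagonalSubalgebra hξ hξ' T)).choose

theorem seminormalExt_tableauIdem (hξ : ∀ k, ξ k ^ 2 = 1) (hξ' : Function.Injective ξ)
    (T : StandardTableau (n + 1)) :
    seminormalExt ℂ n hξ (tableauIdem hξ hξ' T) = diagOp ℂ (Pi.single T 1) :=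
  ((mem_diagonalSubalgebra hξ).1 (single_mem_diagonalSubalgebra hξ hξ' T)).choose_spec

theorem seminormalExt_baseChange_tableauIdem (K : Type) [Field K] [CharZero K] [Algebra ℂ K]
    (hξ : ∀ k, ξ k ^ 2 = 1) (hξ' : Function.Injective ξ) (T : StandardTableau (n + 1)) :
    seminormalExt K n hξ (baseChange K n (tableauIdem hξ hξ' T)) = diagOp K (Pi.single T 1) := by
  rw [seminormalExt_baseChange_of_eq_diagOp K hξ (seminormalExt_tableauIdem hξ hξ' T)]
  congr 1
  funext S
  rw [Pi.apply_single (fun _ => algebraMap ℂ K) (fun _ => map_zero _), map_one]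

theorem sum_tableauIdem (hξ : ∀ k, ξ k ^ 2 = 1) (hξ' : Function.Injective ξ) :
    ∑ T : StandardTableau (n + 1), tableauIdem hξ hξ' T = 1 := by
  refine seminormalExt_injective (K := ℂ) hξ hξ' ?_
  simp only [map_sum, map_one, seminormalExt_tableauIdem, ← diagAlg_apply]
  rw [← map_sum, ← map_one (diagAlg ℂ n)]
  exact congrArg _ (univ_sum_single (1 : StandardTableau (n + 1) → ℂ))

theorem isPrimitiveIdempotent_of_forall_mul_mul {F A : Type} [Field F] [Ring A] [Algebra F A]
    {e : A} (hne : e ≠ 0) (he : IsIdempotentElem e)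
    (hcorner : ∀ a, ∃ α : F, e * a * e = α • e) : IsPrimitiveIdempotent e := by
  refine ⟨hne, he, fun a b ha _ hab hba hsum => ?_⟩
  have heae : e * a * e = a := by
    rw [← hsum, add_mul, hba, add_zero, ha.eq, mul_add, hab, add_zero, ha.eq]
  obtain ⟨α, hα⟩ := hcorner a
  rw [heae] at hα
  have hsq : (α * α - α) • e = 0 := by
    rw [sub_smul, ← hα, sub_eq_zero, ← ha.eq, hα, smul_mul_smul_comm, he.eq]
  have hroot : α * (α - 1) = 0 := by
    linear_combination (smul_eq_zero.1 hsq).resolve_right hne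
  rcases mul_eq_zero.1 hroot with h | h
  · exact Or.inl (by rw [hα, h, zero_smul])
  · rw [sub_eq_zero.1 h, one_smul] at hα
    rw [hα] at hsum
    exact Or.inr (left_eq_add.1 hsum.symm)

theorem isPrimitiveIdempotent_tableauIdem (hξ : ∀ k, ξ k ^ 2 = 1) (hξ' : Function.Injective ξ)
    (T : StandardTableau (n + 1)) : IsPrimitiveIdempotent (tableauIdem hξ hξ' T) := by
  have hinj := seminormalExt_injective (K := ℂ) (n := n) hξ hξ'
  have hact := seminormalExt_tableauIdem hξ hξ' T
  refine isPrimitiveIdempotent_of_forall_mul_mul (F := ℂ) ?_ (hinj ?_) fun a =>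
    ⟨seminormalExt ℂ n hξ a (seqVec ℂ T.seq) T, hinj ?_⟩
  · intro h
    have hzero := LinearMap.congr_fun ((congrArg _ h).symm.trans hact) (seqVec ℂ T.seq)
    rw [map_zero, diagOp_seqVec, Pi.single_eq_same, one_smul, seqVec_seq] at hzero
    exact one_ne_zero (Finsupp.single_eq_zero.1 hzero.symm)
  · rw [map_mul, hact, diagOp_mul_diagOp, ← Pi.single_mul, mul_one]
  · rw [map_mul, map_mul, map_smul, hact, diagOp_single_mul_mul_diagOp_single]

end TableauIdempotents

section ComplexSeminormal

variable {n : ℕ} {ξ : Fin 2 → ℂ}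

theorem StandardTableau.content_eq {m : ℕ} (T : StandardTableau m) (a : Fin m) :
    T.content a = (nodeContent (T.seq a) : ℂ) := by
  simp [content, nodeContent, seq]

theorem diagCoeff_eq_invAxialDist (hξ' : Function.Injective ξ) (i : Fin n)
    (T : StandardTableau (n + 1)) :
    diagCoeff ξ i T = invAxialDist ℂ (T.seq i.castSucc) (T.seq i.succ) := by
  have hpos : T.pos ξ i.castSucc = T.pos ξ i.succ ↔ (T.seq i.castSucc).1 = (T.seq i.succ).1 :=
    hξ'.eq_iff
  simp only [diagCoeff, invAxialDist, hpos, content_eq, one_div, Int.cast_sub]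

theorem seqVec_seq_eq_basisVec (T : StandardTableau (n + 1)) : seqVec ℂ T.seq = basisVec T :=
  seqVec_seq T

theorem isSeminormal_seminormalExt (hξ : ∀ k, ξ k ^ 2 = 1) (hξ' : Function.Injective ξ) :
    IsSeminormal ξ (seminormalExt ℂ n hξ) where
  t_apply T := by
    rw [seminormalAlg_genT, ← seqVec_seq_eq_basisVec, diagOp_seqVec]
    rfl
  s_apply i T S h := by
    rw [seminormalAlg_genS, ← seqVec_seq_eq_basisVec, ← seqVec_seq_eq_basisVec, swapOp_seqVec,
      diagCoeff_eq_invAxialDist hξ', offDiagCoeff, if_neg (exists_isSwap_iff.1 ⟨S, h⟩),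
      isSwap_iff.1 h]
  s_apply_of_not i T h := by
    rw [exists_isSwap_iff, not_not] at h
    rw [seminormalAlg_genS, ← seqVec_seq_eq_basisVec, swapOp_seqVec,
      diagCoeff_eq_invAxialDist hξ', offDiagCoeff, if_pos h, zero_smul, add_zero]

theorem IsSeminormal.unique {ρ ρ' : MonoidAlgebra ℂ (GroupB n) →ₐ[ℂ] Module.End ℂ (TableauSpace n)}
    (hρ : IsSeminormal ξ ρ) (hρ' : IsSeminormal ξ ρ') : ρ = ρ' := by
  refine MonoidAlgebra.algHom_ext' ((coxB n).ext_simple fun b => ?_) (Subsingleton.elim _ _)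
  change ρ (gen ℂ b) = ρ' (gen ℂ b)
  refine seqVec_ext fun T => ?_
  rw [seqVec_seq_eq_basisVec]
  cases b using Fin.cases with
  | zero => exact (hρ.t_apply T).trans (hρ'.t_apply T).symm
  | succ i =>
    by_cases h : ∃ S, T.IsSwap i S
    · obtain ⟨S, h⟩ := h
      exact (hρ.s_apply i T S h).trans (hρ'.s_apply i T S h).symm
    · exact (hρ.s_apply_of_not i T h).trans (hρ'.s_apply_of_not i T h).symm

theorem isSeminormal_iff (hξ : ∀ k, ξ k ^ 2 = 1) (hξ' : Function.Injective ξ)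
    {ρ : MonoidAlgebra ℂ (GroupB n) →ₐ[ℂ] Module.End ℂ (TableauSpace n)} :
    IsSeminormal ξ ρ ↔ ρ = seminormalExt ℂ n hξ :=
  ⟨fun h => h.unique (isSeminormal_seminormalExt hξ hξ'), fun h =>
    h ▸ isSeminormal_seminormalExt hξ hξ'⟩

theorem isTableauIdempotent_iff (hξ : ∀ k, ξ k ^ 2 = 1) (hξ' : Function.Injective ξ)
    (T : StandardTableau (n + 1)) (E : MonoidAlgebra ℂ (GroupB n)) :
    IsTableauIdempotent ξ T E ↔ E = tableauIdem hξ hξ' T := by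
  simp only [IsTableauIdempotent, isSeminormal_iff hξ hξ', exists_eq_left,
    ← seqVec_seq_eq_basisVec]
  rw [← (seminormalExt_injective (K := ℂ) hξ hξ').eq_iff, seminormalExt_tableauIdem]
  constructor
  · rintro ⟨hself, hother⟩
    refine seqVec_ext fun S => ?_
    rw [diagOp_seqVec]
    rcases eq_or_ne S T with rfl | hST
    · rw [hself, Pi.single_eq_same, one_smul]
    · rw [hother S hST, Pi.single_eq_of_ne hST, zero_smul]
  · intro h
    rw [h]
    exact ⟨by rw [diagOp_seqVec, Pi.single_eq_same, one_smul], fun S hST => by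
      rw [diagOp_seqVec, Pi.single_eq_of_ne hST, zero_smul]⟩

end ComplexSeminormal

section Evaluation

variable {m : ℕ} {k : Fin m} {c : ℂ}

theorem ne_zero_of_substVar_ne_zero {Q : MvPolynomial (Fin m) ℂ} (h : substVar k c Q ≠ 0) :
    algebraMap _ (RatFun m) Q ≠ 0 := by
  intro h0
  rw [map_eq_zero_iff _ (IsFractionRing.injective (MvPolynomial (Fin m) ℂ) (RatFun m))] at h0
  exact h (by rw [h0, map_zero])

theorem algebraMap_substVar_ne_zero {Q : MvPolynomial (Fin m) ℂ} (h : substVar k c Q ≠ 0) :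
    algebraMap _ (RatFun m) (substVar k c Q) ≠ 0 := fun h0 =>
  h ((map_eq_zero_iff _ (IsFractionRing.injective (MvPolynomial (Fin m) ℂ) (RatFun m))).1 h0)

theorem IsEvalAt.of_polynomial (P : MvPolynomial (Fin m) ℂ) :
    IsEvalAt k c (algebraMap _ (RatFun m) P) (algebraMap _ (RatFun m) (substVar k c P)) :=
  ⟨P, 1, by simp, by simp, by simp⟩

theorem IsEvalAt.const (a : ℂ) :
    IsEvalAt k c (algebraMap ℂ (RatFun m) a) (algebraMap ℂ (RatFun m) a) := by
  have := IsEvalAt.of_polynomial (k := k) (c := c) (algebraMap ℂ _ a)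
  rwa [AlgHom.commutes, ← IsScalarTower.algebraMap_apply] at this

theorem IsEvalAt.zero : IsEvalAt k c 0 0 := by
  have := IsEvalAt.const (k := k) (c := c) 0
  rwa [map_zero] at this

theorem IsEvalAt.one : IsEvalAt k c 1 1 := by
  have := IsEvalAt.const (k := k) (c := c) 1
  rwa [map_one] at this

theorem IsEvalAt.intCast (z : ℤ) : IsEvalAt k c z z := by
  have := IsEvalAt.const (k := k) (c := c) z
  rwa [map_intCast] at this

theorem IsEvalAt.uvar_self : IsEvalAt k c (uvar k) (algebraMap ℂ (RatFun m) c) := by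
  have := IsEvalAt.of_polynomial (k := k) (c := c) (MvPolynomial.X k)
  rwa [substVar, MvPolynomial.aeval_X, Function.update_self, ← MvPolynomial.algebraMap_eq,
    ← IsScalarTower.algebraMap_apply] at this

theorem IsEvalAt.uvar_of_ne {j : Fin m} (h : j ≠ k) : IsEvalAt k c (uvar j) (uvar j) := by
  have := IsEvalAt.of_polynomial (k := k) (c := c) (MvPolynomial.X j)
  rwa [substVar, MvPolynomial.aeval_X, Function.update_of_ne h] at this

variable {x y x' y' : RatFun m}

theorem IsEvalAt.mul (h : IsEvalAt k c x y) (h' : IsEvalAt k c x' y') :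
    IsEvalAt k c (x * x') (y * y') := by
  obtain ⟨P, Q, hQ, rfl, rfl⟩ := h
  obtain ⟨P', Q', hQ', rfl, rfl⟩ := h'
  refine ⟨P * P', Q * Q', ?_, ?_, ?_⟩
  · rw [map_mul]
    exact mul_ne_zero hQ hQ'
  · rw [map_mul, map_mul, div_mul_div_comm]
  · simp only [map_mul, div_mul_div_comm]

theorem IsEvalAt.add (h : IsEvalAt k c x y) (h' : IsEvalAt k c x' y') :
    IsEvalAt k c (x + x') (y + y') := by
  obtain ⟨P, Q, hQ, rfl, rfl⟩ := h
  obtain ⟨P', Q', hQ', rfl, rfl⟩ := h'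
  refine ⟨P * Q' + Q * P', Q * Q', ?_, ?_, ?_⟩
  · rw [map_mul]
    exact mul_ne_zero hQ hQ'
  · rw [map_add, map_mul, map_mul, map_mul, div_add_div _ _ (ne_zero_of_substVar_ne_zero hQ)
      (ne_zero_of_substVar_ne_zero hQ')]
  · simp only [map_mul, map_add]
    rw [div_add_div _ _ (algebraMap_substVar_ne_zero hQ) (algebraMap_substVar_ne_zero hQ')]

theorem IsEvalAt.neg (h : IsEvalAt k c x y) : IsEvalAt k c (-x) (-y) := by
  have := (IsEvalAt.intCast (k := k) (c := c) (-1)).mul h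
  simpa using this

theorem IsEvalAt.sub (h : IsEvalAt k c x y) (h' : IsEvalAt k c x' y') :
    IsEvalAt k c (x - x') (y - y') := by
  rw [sub_eq_add_neg, sub_eq_add_neg]
  exact h.add h'.neg

theorem IsEvalAt.inv (h : IsEvalAt k c x y) (hy : y ≠ 0) : IsEvalAt k c x⁻¹ y⁻¹ := by
  obtain ⟨P, Q, _, rfl, rfl⟩ := h
  refine ⟨Q, P, ?_, inv_div _ _, inv_div _ _⟩
  intro h0
  rw [h0, map_zero, zero_div] at hy
  exact hy rfl

theorem IsEvalAt.div (h : IsEvalAt k c x y) (h' : IsEvalAt k c x' y') (hy : y' ≠ 0) :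
    IsEvalAt k c (x / x') (y / y') := by
  rw [div_eq_mul_inv, div_eq_mul_inv]
  exact h.mul (h'.inv hy)

/-- The pairs of a rational function and its value at `u_k = c`. -/
def evalSubring (k : Fin m) (c : ℂ) : Subring (RatFun m × RatFun m) where
  carrier := {p | IsEvalAt k c p.1 p.2}
  mul_mem' h h' := h.mul h'
  one_mem' := IsEvalAt.one
  add_mem' h h' := h.add h'
  zero_mem' := IsEvalAt.zero
  neg_mem' h := h.neg

theorem IsEvalAt.prod {ι : Type*} (s : Finset ι) {f g : ι → RatFun m}
    (h : ∀ i ∈ s, IsEvalAt k c (f i) (g i)) : IsEvalAt k c (∏ i ∈ s, f i) (∏ i ∈ s, g i) := by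
  have hprod : ∏ i ∈ s, (f i, g i) ∈ evalSubring k c := prod_mem h
  rwa [← prod_mk_prod] at hprod

variable (G : Type) [Group G]

/-- The pairs of an element of the group algebra over the rational functions and its value at
`u_k = c`. -/
noncomputable def evalAlgebra (k : Fin m) (c : ℂ) :
    Subring (MonoidAlgebra (RatFun m) G × MonoidAlgebra (RatFun m) G) :=
  ((MonoidAlgebra.mapRingHom G ((RingHom.fst _ _).comp (evalSubring k c).subtype)).prod
    (MonoidAlgebra.mapRingHom G ((RingHom.snd _ _).comp (evalSubring k c).subtype))).range

variable {G} {X Y : MonoidAlgebra (RatFun m) G}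

theorem isEvalAt_coeff (h : (X, Y) ∈ evalAlgebra G k c) (g : G) :
    IsEvalAt k c (X.coeff g) (Y.coeff g) := by
  obtain ⟨Z, hZ⟩ := h
  obtain ⟨rfl, rfl⟩ := Prod.mk.inj hZ
  rw [MonoidAlgebra.coeff_mapRingHom, MonoidAlgebra.coeff_mapRingHom]
  exact (Z.coeff g).2

theorem of_mem_evalAlgebra (g : G) :
    (MonoidAlgebra.of (RatFun m) G g, MonoidAlgebra.of (RatFun m) G g) ∈ evalAlgebra G k c :=
  ⟨MonoidAlgebra.of _ G g, by simp [MonoidAlgebra.of_apply]⟩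

theorem mul_mem_evalAlgebra {X' Y' : MonoidAlgebra (RatFun m) G} (h : (X, Y) ∈ evalAlgebra G k c)
    (h' : (X', Y') ∈ evalAlgebra G k c) : (X * X', Y * Y') ∈ evalAlgebra G k c := by
  rw [← Prod.mk_mul_mk]
  exact mul_mem h h'

theorem add_mem_evalAlgebra {X' Y' : MonoidAlgebra (RatFun m) G} (h : (X, Y) ∈ evalAlgebra G k c)
    (h' : (X', Y') ∈ evalAlgebra G k c) : (X + X', Y + Y') ∈ evalAlgebra G k c := by
  rw [← Prod.mk_add_mk]
  exact add_mem h h'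

theorem one_mem_evalAlgebra : ((1, 1) : MonoidAlgebra (RatFun m) G × MonoidAlgebra (RatFun m) G) ∈
    evalAlgebra G k c := by
  rw [Prod.mk_one_one]
  exact one_mem _

theorem smul_mem_evalAlgebra (hx : IsEvalAt k c x y) (h : (X, Y) ∈ evalAlgebra G k c) :
    (x • X, y • Y) ∈ evalAlgebra G k c := by
  have h1 : (x • 1, y • 1) ∈ evalAlgebra G k c := by
    refine ⟨MonoidAlgebra.single 1 ⟨(x, y), hx⟩, ?_⟩
    simp [MonoidAlgebra.one_def]
  have h2 := mul_mem_evalAlgebra h1 h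
  rwa [smul_one_mul, smul_one_mul] at h2

theorem reverse_prod_mem_evalAlgebra {l l' : List (MonoidAlgebra (RatFun m) G)}
    (h : List.Forall₂ (fun X Y => (X, Y) ∈ evalAlgebra G k c) l l') :
    (l.reverse.prod, l'.reverse.prod) ∈ evalAlgebra G k c := by
  induction h with
  | nil => exact one_mem_evalAlgebra
  | cons h _ ih =>
    rw [List.reverse_cons, List.reverse_cons, List.prod_append, List.prod_append,
      List.prod_singleton, List.prod_singleton]
    exact mul_mem_evalAlgebra ih h

theorem sum_mem_evalAlgebra {ι : Type*} (s : Finset ι) {f g : ι → MonoidAlgebra (RatFun m) G}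
    (h : ∀ i ∈ s, (f i, g i) ∈ evalAlgebra G k c) :
    (∑ i ∈ s, f i, ∑ i ∈ s, g i) ∈ evalAlgebra G k c := by
  rw [prod_mk_sum]
  exact sum_mem h

theorem uvar_ne_uvar {i j : Fin m} (h : i ≠ j) : uvar i ≠ uvar j := fun h' =>
  h (MvPolynomial.X_injective (IsFractionRing.injective (MvPolynomial (Fin m) ℂ) (RatFun m) h'))

theorem uvar_ne_const (i : Fin m) (a : ℂ) : uvar i ≠ algebraMap ℂ (RatFun m) a := by
  intro h
  rw [IsScalarTower.algebraMap_apply ℂ (MvPolynomial (Fin m) ℂ) (RatFun m)] at h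
  have h1 := congrArg (MvPolynomial.eval fun _ => a + 1)
    (IsFractionRing.injective (MvPolynomial (Fin m) ℂ) (RatFun m) h)
  simp at h1

theorem uvar_ne_intCast (i : Fin m) (z : ℤ) : uvar i ≠ (z : RatFun m) := by
  have := uvar_ne_const i z
  rwa [map_intCast] at this

end Evaluation

section Baxterized

variable {m n : ℕ} {k : Fin m} {c : ℂ}

theorem baseChange_mem_evalAlgebra (x : MonoidAlgebra ℂ (GroupB n)) :
    (baseChange (RatFun m) n x, baseChange (RatFun m) n x) ∈ evalAlgebra (GroupB n) k c := by
  induction x using MonoidAlgebra.induction_on with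
  | of g =>
    rw [baseChange_of]
    exact of_mem_evalAlgebra g
  | add x y hx hy =>
    rw [map_add]
    exact add_mem_evalAlgebra hx hy
  | smul a x hx =>
    rw [baseChange_smul]
    exact smul_mem_evalAlgebra (IsEvalAt.const a) hx

theorem baxtT_mem_evalAlgebra (p : ℂ) :
    (baxtT (RatFun m) n p, baxtT (RatFun m) n p) ∈ evalAlgebra (GroupB n) k c := by
  have h2 : IsEvalAt k c (1 / 2 : RatFun m) (1 / 2) := by
    have := IsEvalAt.const (k := k) (c := c) (1 / 2)
    rwa [map_div₀, map_one, map_ofNat] at this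
  exact smul_mem_evalAlgebra h2 (add_mem_evalAlgebra one_mem_evalAlgebra
    (smul_mem_evalAlgebra (IsEvalAt.const p) (of_mem_evalAlgebra _)))

theorem baxtS_mem_evalAlgebra (i : Fin n) (p p' : ℂ) {a a' b b' : RatFun m}
    (h : IsEvalAt k c a b) (h' : IsEvalAt k c a' b') (hne : b ≠ b') :
    (baxtS i p p' a a', baxtS i p p' b b') ∈ evalAlgebra (GroupB n) k c := by
  refine add_mem_evalAlgebra (of_mem_evalAlgebra _) ?_
  rw [Algebra.algebraMap_eq_smul_one, Algebra.algebraMap_eq_smul_one]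
  refine smul_mem_evalAlgebra ?_ one_mem_evalAlgebra
  split_ifs
  · exact IsEvalAt.one.div (h.sub h') (sub_ne_zero.2 hne)
  · exact IsEvalAt.zero

theorem phi_mem_evalAlgebra (v : Fin (n + 1) → ℂ) {u w : Fin (n + 1) → RatFun m} (p : ℂ)
    {a b : RatFun m} (h : IsEvalAt k c a b) (r : Fin (n + 1))
    (hu : ∀ i < r, IsEvalAt k c (u i) (w i) ∧ b ≠ w i) :
    (phi v u p a r, phi v w p b r) ∈ evalAlgebra (GroupB n) k c := by
  induction r using Fin.induction with
  | zero => exact baxtT_mem_evalAlgebra p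
  | succ i ih =>
    have hi := hu i.castSucc Fin.castSucc_lt_succ
    exact mul_mem_evalAlgebra
      (mul_mem_evalAlgebra (baxtS_mem_evalAlgebra i p (v i.castSucc) h hi.1 hi.2)
        (ih fun j hj => hu j (hj.trans Fin.castSucc_lt_succ)))
      (of_mem_evalAlgebra _)

end Baxterized

section Fusion

variable {n : ℕ} {ξ : Fin 2 → ℂ}

theorem contentFun_div {K : Type} [Field K] (L : ℕ) (l : ℕ → ℕ) {i : ℕ} (hi : i ≤ L) {u : K}
    (hu : u - addableContent l i ≠ 0) :
    contentFun K L l u / (u - addableContent l i) =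
      (∏ j ∈ (range (L + 1)).erase i, (u - addableContent l j)) /
        ∏ j ∈ range L, (u - addableContent l j + 1) := by
  rw [contentFun, ← mul_prod_erase _ _ (mem_range.2 (Nat.lt_succ_of_le hi)), div_right_comm,
    mul_div_cancel_left₀ _ hu]

theorem addableContent_sub_add_one_ne_zero {l : ℕ → ℕ} (hl : Antitone l) {i : ℕ}
    (hadd : ∀ j < i, l i < l j) (j : ℕ) : addableContent l i - addableContent l j + 1 ≠ 0 := by
  rw [addableContent, addableContent]
  rcases lt_or_ge j i with hj | hj
  · have := hadd j hj
    omega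
  · have := hl hj
    omega

theorem isEvalAt_contentFun_div {m : ℕ} (k : Fin m) (L : ℕ) (l : ℕ → ℕ) (hl : Antitone l)
    {i i₀ : ℕ} (hi : i ≤ L) (hi₀ : i₀ ≤ L) (hadd : ∀ j < i₀, l i₀ < l j) :
    IsEvalAt k (addableContent l i₀ : ℂ)
      (contentFun (RatFun m) L l (uvar k) / (uvar k - addableContent l i))
      (algebraMap ℂ _ (if i = i₀ then (transitionRatio ℂ L l i₀)⁻¹ else 0)) := by
  rw [contentFun_div L l hi (sub_ne_zero.2 (uvar_ne_intCast k _))]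
  have hden : ∏ j ∈ range L,
      (algebraMap ℂ (RatFun m) (addableContent l i₀ : ℂ) - addableContent l j + 1) ≠ 0 := by
    rw [prod_ne_zero_iff]
    intro j _
    rw [map_intCast]
    exact_mod_cast addableContent_sub_add_one_ne_zero hl hadd j
  have hsub (j : ℕ) := IsEvalAt.uvar_self (k := k) (c := (addableContent l i₀ : ℂ)).sub
    (IsEvalAt.intCast (addableContent l j))
  have heval := (IsEvalAt.prod ((range (L + 1)).erase i) fun j _ => hsub j).div
    (IsEvalAt.prod (range L) fun j _ => (hsub j).add IsEvalAt.one) hden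
  convert heval using 1
  split_ifs with h
  · subst h
    simp only [transitionRatio, inv_div, map_div₀, map_prod, map_sub, map_add, map_intCast,
      map_one]
  · rw [map_zero, prod_eq_zero (mem_erase.2 ⟨Ne.symm h, mem_range.2 (Nat.lt_succ_of_le hi₀)⟩),
      zero_div]
    rw [map_intCast, sub_self]

/-- The 2-tableaux that agree with `T` in the numbers less than `k`. -/
noncomputable def agreeing (T : StandardTableau (n + 1)) (k : ℕ) :
    Finset (StandardTableau (n + 1)) :=
  {S | ∀ a : Fin (n + 1), (a : ℕ) < k → S.seq a = T.seq a}

theorem mem_agreeing {T S : StandardTableau (n + 1)} {k : ℕ} :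
    S ∈ agreeing T k ↔ ∀ a : Fin (n + 1), (a : ℕ) < k → S.seq a = T.seq a := by
  simp [agreeing]

theorem agreeing_zero (T : StandardTableau (n + 1)) : agreeing T 0 = univ := by
  ext S
  simp [mem_agreeing]

theorem agreeing_last (T : StandardTableau (n + 1)) : agreeing T (n + 1) = {T} := by
  ext S
  rw [mem_agreeing, mem_singleton]
  constructor
  · intro h
    exact seq_ext (funext fun a => h a a.2)
  · rintro rfl a _
    rfl

theorem agreeing_succ (T : StandardTableau (n + 1)) (k : Fin (n + 1)) :
    agreeing T (k + 1) = (agreeing T k).filter fun S => S.seq k = T.seq k := by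
  ext S
  rw [mem_filter, mem_agreeing, mem_agreeing]
  constructor
  · intro h
    exact ⟨fun a ha => h a (by omega), h k (by omega)⟩
  · rintro ⟨h, hk⟩ a ha
    rcases Nat.lt_succ_iff_lt_or_eq.1 ha with h' | h'
    · exact h a h'
    · rw [Fin.ext h', hk]

/-- The sum of the idempotents of the 2-tableaux that agree with `T` in the numbers less than `k`,
divided by the hook factor of the shape of the 2-tableau formed by these numbers. -/
noncomputable def partialIdem (hξ : ∀ k, ξ k ^ 2 = 1) (hξ' : Function.Injective ξ)
    (T : StandardTableau (n + 1)) (k : ℕ) : MonoidAlgebra ℂ (GroupB n) :=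
  (partialHookWeight ℂ (n + 1) T k)⁻¹ • ∑ S ∈ agreeing T k, tableauIdem hξ hξ' S

theorem phi_mul_baseChange_tableauIdem {K : Type} [Field K] [CharZero K] [Algebra ℂ K]
    (hξ : ∀ k, ξ k ^ 2 = 1) (hξ' : Function.Injective ξ)
    (T : StandardTableau (n + 1)) (u : Fin (n + 1) → K) {u' : K}
    (hu' : ∀ z : ℤ, u' ≠ z) (r : Fin (n + 1))
    (hu : ∀ a < r, u a = nodeContent (T.seq a)) {S : StandardTableau (n + 1)}
    (hS : S ∈ agreeing T r) :
    phi (T.pos ξ) u (T.pos ξ r) u' r * baseChange K n (tableauIdem hξ hξ' S) =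
      (if (S.seq r).1 = (T.seq r).1 then
        contentFun K (n + 1) (T.rows r (T.seq r).1) u' / (u' - nodeContent (S.seq r)) else 0) •
        baseChange K n (tableauIdem hξ hξ' S) := by
  apply seminormalExt_injective (K := K) hξ hξ'
  rw [map_mul, map_smul, seminormalExt_baseChange_tableauIdem]
  refine seqVec_ext fun R => ?_
  rw [Module.End.mul_apply, LinearMap.smul_apply, diagOp_seqVec, map_smul, smul_comm]
  by_cases hR : R = S
  · subst hR
    congr 1
    exact seminormalExt_phi_seqVec hξ hξ' T u (T.seq r).1 hu' r hu _ (mem_agreeing.1 hS)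
  · rw [Pi.single_eq_of_ne hR, zero_smul, zero_smul]

/-- The arguments of the function `Φ` after the first `k` evaluations. -/
noncomputable def evaluatedVar (T : StandardTableau (n + 1)) (k : ℕ) (i : Fin (n + 1)) :
    RatFun (n + 1) :=
  if (i : ℕ) < k then (nodeContent (T.seq i) : RatFun (n + 1)) else uvar i

theorem evaluatedVar_of_lt {T : StandardTableau (n + 1)} {k : ℕ} {i : Fin (n + 1)}
    (h : (i : ℕ) < k) : evaluatedVar T k i = nodeContent (T.seq i) := if_pos h

theorem evaluatedVar_of_le {T : StandardTableau (n + 1)} {k : ℕ} {i : Fin (n + 1)}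
    (h : k ≤ i) : evaluatedVar T k i = uvar i := if_neg (not_lt.2 h)

theorem isEvalAt_evaluatedVar (T : StandardTableau (n + 1)) (k i : Fin (n + 1)) :
    IsEvalAt k (T.content k) (evaluatedVar T k i) (evaluatedVar T (k + 1) i) := by
  rcases lt_trichotomy i k with h | rfl | h
  · rw [evaluatedVar_of_lt h, evaluatedVar_of_lt (Nat.lt_succ_of_lt h)]
    exact IsEvalAt.intCast _
  · rw [evaluatedVar_of_le le_rfl, evaluatedVar_of_lt (Nat.lt_succ_self _)]
    have := IsEvalAt.uvar_self (k := i) (c := T.content i)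
    rwa [content_eq, map_intCast, ← content_eq] at this
  · rw [evaluatedVar_of_le h.le, evaluatedVar_of_le (Nat.succ_le_of_lt h)]
    exact IsEvalAt.uvar_of_ne h.ne'

/-- The factors of the function `Φ` after the first `k` evaluations. -/
noncomputable def evaluatedPhi (ξ : Fin 2 → ℂ) (T : StandardTableau (n + 1)) (k : ℕ)
    (j : Fin (n + 1)) : MonoidAlgebra (RatFun (n + 1)) (GroupB n) :=
  phi (T.pos ξ) (evaluatedVar T k) (T.pos ξ j) (evaluatedVar T k j) j

theorem evaluatedPhi_mem_evalAlgebra (T : StandardTableau (n + 1)) {k j : Fin (n + 1)}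
    (h : k < j) : (evaluatedPhi ξ T k j, evaluatedPhi ξ T (k + 1) j) ∈
      evalAlgebra (GroupB n) k (T.content k) := by
  refine phi_mem_evalAlgebra _ _ (isEvalAt_evaluatedVar T k j) j fun i hi =>
    ⟨isEvalAt_evaluatedVar T k i, ?_⟩
  rw [evaluatedVar_of_le (Nat.succ_le_of_lt h)]
  unfold evaluatedVar
  split_ifs
  · exact uvar_ne_intCast _ _
  · exact uvar_ne_uvar hi.ne'

theorem seq_eq_seq_iff_of_mem_agreeing {T S : StandardTableau (n + 1)} {k : Fin (n + 1)}
    (hS : S ∈ agreeing T k) (h : (S.seq k).1 = (T.seq k).1) :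
    S.seq k = T.seq k ↔ (S.seq k).2.1 = (T.seq k).2.1 := by
  refine ⟨fun h => by rw [h], fun hrow => Prod.ext h (Prod.ext hrow ?_)⟩
  rw [S.col_eq_rows, T.col_eq_rows, h, hrow, rows_congr (mem_agreeing.1 hS)]

theorem isEvalAt_eigenvalue {T S : StandardTableau (n + 1)} {k : Fin (n + 1)}
    (hS : S ∈ agreeing T k) :
    IsEvalAt k (T.content k)
      (if (S.seq k).1 = (T.seq k).1 then contentFun (RatFun (n + 1)) (n + 1)
        (T.rows k (T.seq k).1) (uvar k) / (uvar k - nodeContent (S.seq k)) else 0)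
      (algebraMap ℂ _ (if S.seq k = T.seq k then
        (transitionRatio ℂ (n + 1) (T.rows k (T.seq k).1) (T.seq k).2.1)⁻¹ else 0)) := by
  by_cases h : (S.seq k).1 = (T.seq k).1
  · have hcontent :
        nodeContent (S.seq k) = addableContent (T.rows k (T.seq k).1) (S.seq k).2.1 := by
      rw [S.nodeContent_seq, h, addableContent, addableContent, rows_congr (mem_agreeing.1 hS)]
    simp only [if_pos h, hcontent, content_eq, T.nodeContent_seq,
      seq_eq_seq_iff_of_mem_agreeing hS h]
    exact isEvalAt_contentFun_div k (n + 1) (T.rows k (T.seq k).1) (T.rows_antitone k _)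
      ((S.row_le k).trans k.2.le) ((T.row_le k).trans k.2.le) fun j hj => T.rows_lt_of_lt k hj
  · rw [if_neg h, if_neg fun heq => h (by rw [heq]), map_zero]
    exact IsEvalAt.zero

theorem evaluatedPhi_mul_partialIdem (hξ : ∀ k, ξ k ^ 2 = 1) (hξ' : Function.Injective ξ)
    (T : StandardTableau (n + 1)) (k : Fin (n + 1)) :
    (evaluatedPhi ξ T k k * baseChange (RatFun (n + 1)) n (partialIdem hξ hξ' T k),
      baseChange (RatFun (n + 1)) n (partialIdem hξ hξ' T (k + 1))) ∈
        evalAlgebra (GroupB n) k (T.content k) := by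
  have hsum := smul_mem_evalAlgebra
    (IsEvalAt.const (k := k) (c := T.content k) (partialHookWeight ℂ (n + 1) T k)⁻¹)
    (sum_mem_evalAlgebra (agreeing T k) fun S hS => smul_mem_evalAlgebra (isEvalAt_eigenvalue hS)
      (baseChange_mem_evalAlgebra (tableauIdem hξ hξ' S)))
  convert hsum using 2
  · rw [partialIdem, baseChange_smul, map_sum, mul_smul_comm, mul_sum]
    refine congrArg _ (sum_congr rfl fun S hS => ?_)
    rw [evaluatedPhi, evaluatedVar_of_le le_rfl]
    exact phi_mul_baseChange_tableauIdem hξ hξ' T _ (uvar_ne_intCast k) k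
      (fun a ha => evaluatedVar_of_lt ha) hS
  · rw [partialIdem, baseChange_smul, map_sum, agreeing_succ, sum_filter,
      partialHookWeight_succ le_rfl, mul_inv, map_mul, mul_smul, smul_sum]
    refine congrArg _ (sum_congr rfl fun S _ => ?_)
    split_ifs
    · rfl
    · rw [smul_zero, map_zero, zero_smul]

theorem reverse_prod_drop_mul_partialIdem (hξ : ∀ k, ξ k ^ 2 = 1) (hξ' : Function.Injective ξ)
    (T : StandardTableau (n + 1)) (k : Fin (n + 1)) :
    (((List.ofFn (evaluatedPhi ξ T k)).drop k).reverse.prod *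
        baseChange (RatFun (n + 1)) n (partialIdem hξ hξ' T k),
      ((List.ofFn (evaluatedPhi ξ T (k + 1))).drop (k + 1)).reverse.prod *
        baseChange (RatFun (n + 1)) n (partialIdem hξ hξ' T (k + 1))) ∈
        evalAlgebra (GroupB n) k (T.content k) := by
  have hlen : (k : ℕ) < (List.ofFn (evaluatedPhi ξ T k)).length := by
    rw [List.length_ofFn]
    exact k.2
  rw [List.drop_eq_getElem_cons hlen, List.reverse_cons, List.prod_append, List.prod_singleton,
    List.getElem_ofFn, mul_assoc]
  refine mul_mem_evalAlgebra (reverse_prod_mem_evalAlgebra (List.forall₂_iff_get.2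
    ⟨by rw [List.length_drop, List.length_drop, List.length_ofFn, List.length_ofFn], ?_⟩))
    (evaluatedPhi_mul_partialIdem hξ hξ' T k)
  intro i h h'
  simp only [List.get_eq_getElem, List.getElem_drop, List.getElem_ofFn]
  exact evaluatedPhi_mem_evalAlgebra T (Fin.lt_def.2 (by simp only []; omega))

theorem isConsecutiveEval_Phi (hξ : ∀ k, ξ k ^ 2 = 1) (hξ' : Function.Injective ξ)
    (T : StandardTableau (n + 1)) :
    IsConsecutiveEval (Phi (T.pos ξ) uvar) T.content (partialIdem hξ hξ' T (n + 1)) := by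
  refine ⟨fun k => ((List.ofFn (evaluatedPhi ξ T k)).drop k).reverse.prod *
    baseChange (RatFun (n + 1)) n (partialIdem hξ hξ' T k), ?_, ?_, ?_⟩
  · have h0 : evaluatedVar T 0 = uvar := funext fun i => evaluatedVar_of_le (Nat.zero_le _)
    have h1 : evaluatedPhi ξ T 0 = fun j => phi (T.pos ξ) uvar (T.pos ξ j) (uvar j) j := by
      funext j
      rw [evaluatedPhi, h0]
    simp only [Fin.val_zero, List.drop_zero, partialIdem, partialHookWeight_zero, agreeing_zero,
      sum_tableauIdem, inv_one, one_smul, map_one, mul_one, h1]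
    rfl
  · exact fun k => isEvalAt_coeff (reverse_prod_drop_mul_partialIdem hξ hξ' T k)
  · intro g
    beta_reduce
    rw [Fin.val_last, List.drop_eq_nil_of_le (by simp), List.reverse_nil, List.prod_nil, one_mul,
      MonoidAlgebra.coeff_mapRingHom]

theorem hookFactor_eq (T : StandardTableau (n + 1)) : hookFactor T.shape = hookWeight ℂ T := by
  rw [hookFactor, hookWeight, prod_inv_distrib]

theorem hookFactor_ne_zero (T : StandardTableau (n + 1)) : hookFactor T.shape ≠ 0 := by
  refine inv_ne_zero (prod_ne_zero_iff.2 fun κ _ => prod_ne_zero_iff.2 fun α hα =>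
    Nat.cast_ne_zero.2 (card_ne_zero_of_mem (a := α) ?_))
  simpa using hα

theorem hookFactor_smul_partialIdem (hξ : ∀ k, ξ k ^ 2 = 1) (hξ' : Function.Injective ξ)
    (T : StandardTableau (n + 1)) :
    hookFactor T.shape • partialIdem hξ hξ' T (n + 1) = tableauIdem hξ hξ' T := by
  rw [partialIdem, agreeing_last, sum_singleton, ← hookWeight_eq_partialHookWeight le_rfl,
    ← hookFactor_eq, smul_inv_smul₀ (hookFactor_ne_zero T)]

end Fusion

end FusionB

theorem theorem1 (n : ℕ) (ξ : Fin 2 → ℂ) (hξ : ∀ k, ξ k ^ 2 = 1) (hξ' : Function.Injective ξ)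
    (T : FusionB.StandardTableau (n + 1)) :
    (∃! E : MonoidAlgebra ℂ (FusionB.GroupB n), FusionB.IsTableauIdempotent ξ T E) ∧
    (∀ E : MonoidAlgebra ℂ (FusionB.GroupB n), FusionB.IsTableauIdempotent ξ T E →
      FusionB.IsPrimitiveIdempotent E ∧
      ∃ Y : MonoidAlgebra ℂ (FusionB.GroupB n),
        FusionB.IsConsecutiveEval (FusionB.Phi (T.pos ξ) FusionB.uvar) T.content Y ∧
        E = FusionB.hookFactor T.shape • Y) ∧
    ∀ v : Fin (n + 1) → ℂ,
      FusionB.IsBaxterizedLongestWord v (FusionB.Phi v FusionB.uvar) := by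
  simp only [FusionB.isTableauIdempotent_iff hξ hξ', existsUnique_eq, forall_eq, true_and]
  exact ⟨⟨FusionB.isPrimitiveIdempotent_tableauIdem hξ hξ' T, _,
    FusionB.isConsecutiveEval_Phi hξ hξ' T, (FusionB.hookFactor_smul_partialIdem hξ hξ' T).symm⟩,
    FusionB.isBaxterizedLongestWord_Phi⟩
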